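/- Let $H=L_2(\Omega,\mathcal F,\mathsf P)$, $T>0$, $d\ge 0$, let $\tau\ge1$ be an integer, and let $\xi,\eta:\mathbb R\to H$ be locally square integrable processes whose increments $\xi^{(d)}(t,\tau'T)=\sum_{l=0}^d(-1)^l\binom dl\xi(t-l\tau'T)$, $\tau'\in\mathbb Z$ (and likewise $\eta^{(d)}$), have mean values and second moments that do not change when all times are shifted by $T$. Let $e_k(u)=T^{-1/2}e^{2\pi i(-1)^k[k/2]u/T}$, $k\ge1$, and let $\xi_k(j,\tau')=\int_0^T\xi^{(d)}(jT-u,\tau'T)\overline{e_k(u)}\,du$ be the generated vector sequence, with spectral density $f(\lambda)=\{f_{kn}(\lambda)\}_{k,n\ge1}$: a positive, trace class operator function on $(-\pi,\pi]$ with integrable trace and $$\mathsf E\,\xi_k(l,\tau_1)\overline{\xi_n(j,\tau_2)}=\frac1{2\pi}\int_{-\pi}^{\pi}e^{i(l-j)\lambda}(1-e^{-i\tau_1\lambda})^d(1-e^{i\tau_2\lambda})^d\lambda^{-2d}f_{kn}(\lambda)\,d\lambda .$$ Let $\eta$ generate $\eta_k(j,\tau')$ with spectral density $g$ in the same way. Assume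 that the generated sequences with step $\tau$ have mean zero and that $\xi^{(d)}(\cdot,\tau T)$ and $\eta^{(d)}(\cdot,\tau T)$ are uncorrelated. Let $a$ be locally square integrable on $[0,\infty)$ and let the integral $A\xi=\int_0^\infty a(t)\xi(-t)\,dt$ converge in $H$. Let $\vec a_j$ be the vector of the Fourier coefficients of $u\mapsto a(u+jT)$, $u\in[0,T)$, in the order $1,3,2,5,4,\dots$, let $\sum_kd_\tau(k)x^k=(\sum_jx^{\tau j})^d$ and $\vec b_j=(D^\tau\mathbf a)_j=\sum_{m=0}^jd_\tau(j-m)\vec a_m$, and assume $\sum_j(j+1)\|\vec b_j\|<\infty$. Put $\vec B_\tau(e^{-i\lambda})=\sum_{j\ge0}\vec b_je^{-i\lambda j}$. Let $\widehat A\xi$ be the orthogonal projection of $A\xi$ on the closed span $H^0$ of $\zeta_k(j)=\xi_k(j,\tau)+\eta_k(j,\tau)$, $k\ge1$, $j\le0$. A vector function $\vec h$ is the spectral characteristic of $Y\in H$, $Y=\int\vec h^\top d\vec Z_{\xi^{(d)}+\eta^{(d)}}$, if $Y$ is the image of $\vec h\in L_2(f+g)$ under the isometry that sends $e^{i\lambda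 j}\frac{(1-e^{-i\lambda\tau})^d}{(i\lambda)^d}\vec\delta_k$ to $\zeta_k(j)$; the norm of $L_2(f+g)$ is given by $\int_{-\pi}^{\pi}\vec h^\top(f+g)\overline{\vec h}\,d\lambda$. Assume the canonical factorization $$\frac{|1-e^{i\lambda\tau}|^{2d}}{\lambda^{2d}}(f+g)=\Theta_\tau(e^{-i\lambda})\Theta_\tau^*(e^{-i\lambda}),\qquad \Theta_\tau(e^{-i\lambda})=\sum_{k\ge0}\theta_\tau(k)e^{-i\lambda k},$$ with $\infty\times M$ matrices $\theta_\tau(k)$, $M\le\infty$, whose entries are square summable (over $k$ and all entries); canonical means that the delayed rows $\big(0,\dots,0,\theta_{\tau,k\cdot}(0),\theta_{\tau,k\cdot}(1),\dots\big)$ span a dense subspace of $\ell_2$, i.e. observations and innovations generate the same past. Assume that $\Psi_\tau(e^{-i\lambda})=\sum_{k\ge0}\psi_\tau(k)e^{-i\lambda k}$, an $M\times\infty$ matrix function each of whose rows has square summable coefficients, satisfies $\Psi_\tau\Theta_\tau=E_M$ (so that $\Psi_\tau^*\Psi_\tau$ plays the role of $\frac{\lambda^{2d}}{|1-e^{i\lambda\tau}|^{2d}}(f+g)^{-1}$).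 (1) Let $\frac{|1-e^{i\lambda\tau}|^{2d}}{\lambda^{2d}}f=\Phi_\tau(e^{-i\lambda})\Phi_\tau^*(e^{-i\lambda})$, $\Phi_\tau(e^{-i\lambda})=\sum_{k\ge0}\phi_\tau(k)e^{-i\lambda k}$, with $\phi_\tau$ square summable, and let the matrix $\widetilde\Phi_\tau$ with blocks $(\widetilde\Phi_\tau)_{l,j}=\phi_\tau^\top(l-j)$ for $0\le j\le l$ and $0$ for $l<j$ define a bounded operator in $\ell_2$. Put $$\mathbf c^f_\tau(m)=(\widetilde\Phi_\tau^*\widetilde\Phi_\tau D^\tau\mathbf a)_m=\sum_{l\ge0}\overline\phi_\tau(l)(\widetilde\Phi_\tau D^\tau\mathbf a)_{l+m},\qquad(\overline\psi_\tau\mathbf C^f_\tau)_m=\sum_{j\ge0}\overline\psi_\tau(j)\mathbf c^f_\tau(j+m).$$ Then these series converge, the spectral characteristic of $\widehat A\xi$ is $$\vec h_\tau(\lambda)=\frac{(1-e^{-i\lambda\tau})^d}{(i\lambda)^d}\Big(\sum_{k\ge0}\psi_\tau^\top(k)e^{-i\lambda k}\Big)\sum_{m\ge0}(\overline\psi_\tau\mathbf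 C^f_\tau)_me^{-i\lambda m},$$ and $\mathsf E|A\xi-\widehat A\xi|^2=\|\widetilde\Phi_\tau D^\tau\mathbf a\|^2-\|\overline\psi_\tau\mathbf C^f_\tau\|^2$. (2) Let $\frac{|1-e^{i\lambda\tau}|^{2d}}{\lambda^{2d}}g=\Omega_\tau(e^{-i\lambda})\Omega_\tau^*(e^{-i\lambda})$, $\Omega_\tau(e^{-i\lambda})=\sum_{k\ge0}\omega_\tau(k)e^{-i\lambda k}$, under the same conditions, and define $\widetilde\Omega_\tau$, $\mathbf c^g_\tau$, $\overline\psi_\tau\mathbf C^g_\tau$ as in (1) with $\omega_\tau$ instead of $\phi_\tau$. Then these series converge, the spectral characteristic of $\widehat A\xi$ is $$\vec h_\tau(\lambda)=\frac{(1-e^{-i\lambda\tau})^d}{(i\lambda)^d}\Big(\vec B_\tau(e^{-i\lambda})-\Big(\sum_{k\ge0}\psi_\tau^\top(k)e^{-i\lambda k}\Big)\sum_{m\ge0}(\overline\psi_\tau\mathbf C^g_\tau)_me^{-i\lambda m}\Big),$$ and $\mathsf E|A\xi-\widehat A\xi|^2=\|\widetilde\Omega_\tau D^\tau\mathbf a\|^2-\|\overline\psi_\tau\mathbf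 C^g_\tau\|^2$. If $M=\infty$, the product of the matrix $\sum_k\psi_\tau^\top(k)e^{-i\lambda k}$ and the vector on its right is the sum over the $M$ components, converging in $L_2(f+g)$. -/

import Mathlib

open MeasureTheory Filter Topology

noncomputable section

namespace PCFilter

/-! ### Second order random variables -/

section Sequences

variable {Ω : Type*} [MeasurableSpace Ω] {P : Measure Ω}

/-- The expectation `E X`. -/
def expect (X : Lp ℂ 2 P) : ℂ := ∫ ω, X ω ∂P

/-- The second moment `E X Ȳ`. -/
def cov (X Y : Lp ℂ 2 P) : ℂ := ∫ ω, X ω * star (Y ω) ∂P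

/-- The mean square error `E |X - Y|²`. -/
def mse (X Y : Lp ℂ 2 P) : ℝ := ∫ ω, ‖(X - Y) ω‖ ^ 2 ∂P

/-- The `d`-th increment `ξ^{(d)}(t, s) = ∑_{l ≤ d} (-1)^l (d choose l) ξ(t - l s)`. -/
def incr (d : ℕ) (ξ : ℝ → Lp ℂ 2 P) (t s : ℝ) : Lp ℂ 2 P :=
  ∑ l ∈ Finset.range (d + 1), ((-1 : ℂ) ^ l * (d.choose l : ℂ)) • ξ (t - l * s)

/-- A second order process, locally square integrable in time, whose `d`-th increments with steps
`τ T`, `τ ∈ ℤ`, are periodically stationary with period `T`. -/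
structure HasPeriodicIncrements (T : ℝ) (d : ℕ) (ξ : ℝ → Lp ℂ 2 P) : Prop where
  locally_memLp : ∀ R : ℝ, MemLp ξ 2 (volume.restrict (Set.Icc (-R) R))
  mean_periodic : ∀ (τ : ℤ) (t : ℝ),
    expect (incr d ξ (t + T) (τ * T)) = expect (incr d ξ t (τ * T))
  cov_periodic : ∀ (τ₁ τ₂ : ℤ) (t s : ℝ),
    cov (incr d ξ (t + T) (τ₁ * T)) (incr d ξ (s + T) (τ₂ * T)) =
      cov (incr d ξ t (τ₁ * T)) (incr d ξ s (τ₂ * T))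

/-! ### The Fourier basis and the generated vector sequence -/

/-- The frequencies `0, 1, -1, 2, -2, …` of the basis; index `k` here is index `k + 1` of the
usual enumeration `(-1)^k [k/2]`, `k = 1, 2, …`. -/
def freq (k : ℕ) : ℤ := (-1) ^ (k + 1) * (((k + 1) / 2 : ℕ) : ℤ)

/-- The orthonormal basis `e_k(u) = T^{-1/2} exp(2 π i freq(k) u / T)` of `L²[0, T)`. -/
def basisFun (T : ℝ) (k : ℕ) (u : ℝ) : ℂ :=
  ((1 / Real.sqrt T : ℝ) : ℂ) *
    Complex.exp (2 * Real.pi * Complex.I * (freq k : ℂ) * u / T)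

/-- The index of the complex conjugate of the `k`-th basis function: the order `1, 3, 2, 5, 4, …`
when indices start from `1`. -/
def swapIdx (k : ℕ) : ℕ := if k = 0 then 0 else if k % 2 = 1 then k + 1 else k - 1

/-- The component `ξ_k(j, τ)` of the generated vector sequence: the `k`-th Fourier coefficient of
the `H`-valued function `u ↦ ξ^{(d)}(j T - u, τ T)` on `[0, T)`. -/
def genSeq (T : ℝ) (d : ℕ) (ξ : ℝ → Lp ℂ 2 P) (τ : ℤ) (j : ℤ) (k : ℕ) : Lp ℂ 2 P :=
  ∫ u in (0 : ℝ)..T, star (basisFun T k u) • incr d ξ (j * T - u) (τ * T)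

/-- `f` is the spectral density (operator function given by its matrix) of the generated
stationary increment sequence. -/
structure IsSpectralDensity (T : ℝ) (d : ℕ) (ξ : ℝ → Lp ℂ 2 P) (f : ℝ → Matrix ℕ ℕ ℂ) :
    Prop where
  measurable : ∀ k n,
    AEStronglyMeasurable (fun x => f x k n) (volume.restrict (Set.Ioc (-Real.pi) Real.pi))
  hermitian : ∀ᵐ x ∂(volume.restrict (Set.Ioc (-Real.pi) Real.pi)), (f x).IsHermitian
  nonneg : ∀ᵐ x ∂(volume.restrict (Set.Ioc (-Real.pi) Real.pi)), ∀ v : ℕ →₀ ℂ,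
    0 ≤ (v.sum fun k a => v.sum fun n b => star a * f x k n * b).re
  kernel : ∀ᵐ x ∂(volume.restrict (Set.Ioc (-Real.pi) Real.pi)),
    Summable fun k => (f x k k).re
  kernel_integrable : Integrable (fun x => ∑' k, (f x k k).re)
    (volume.restrict (Set.Ioc (-Real.pi) Real.pi))
  structural : ∀ (τ₁ τ₂ l j : ℤ) (k n : ℕ),
    cov (genSeq T d ξ τ₁ l k) (genSeq T d ξ τ₂ j n) =
      (1 / (2 * Real.pi) : ℂ) * ∫ x in Set.Ioc (-Real.pi) Real.pi,
        Complex.exp (Complex.I * ((l - j : ℤ) : ℂ) * x) *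
          (1 - Complex.exp (-(Complex.I * τ₁ * x))) ^ d *
          (1 - Complex.exp (Complex.I * τ₂ * x)) ^ d / (x : ℂ) ^ (2 * d) * f x k n

end Sequences

/-! ### The coefficients of the functional -/

/-- The vectors `a_j`, `j ≥ 0`: Fourier coefficients of `u ↦ a(u + j T)` on `[0, T)`,
reordered so that `∫₀ᵀ a(u + jT) x(u) du = ∑_k a_{j,k} ⟨x, e_k⟩`. -/
def aVec (T : ℝ) (a : ℝ → ℂ) (j k : ℕ) : ℂ :=
  ∫ u in (0 : ℝ)..T, a (u + j * T) * star (basisFun T (swapIdx k) u)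

/-- The coefficients `d_τ(k)` of the power series `(∑_j x^{τ j})^d`. -/
def dCoeff (d τ k : ℕ) : ℂ :=
  PowerSeries.coeff k ((PowerSeries.mk fun n => if τ ∣ n then (1 : ℂ) else 0) ^ d)

/-- The vectors `b_j = (D^τ a)_j = ∑_{m ≤ j} d_τ(j - m) a_m`, indexed by `(j, k)`. -/
def bVec (T : ℝ) (d τ : ℕ) (a : ℝ → ℂ) (q : ℕ × ℕ) : ℂ :=
  ∑ m ∈ Finset.range (q.1 + 1), dCoeff d τ (q.1 - m) * aVec T a m q.2

/-- The norm of the `j`-th block of `b`. -/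
def blockNorm (b : ℕ × ℕ → ℂ) (j : ℕ) : ℝ := Real.sqrt (∑' k, ‖b (j, k)‖ ^ 2)

/-! ### Expansions and factorizations -/

/-- `u(λ) = ∑_{l ≥ 0} c(l) e^{-i λ l}` in the sense of `L²(-π, π]`. -/
def HasExpansion (u : ℝ → ℂ) (c : ℕ → ℂ) : Prop :=
  MemLp u 2 (volume.restrict (Set.Ioc (-Real.pi) Real.pi)) ∧
  Tendsto (fun N : ℕ => eLpNorm
      (fun x => u x - ∑ l ∈ Finset.range N, c l * Complex.exp (-(Complex.I * l * x))) 2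
      (volume.restrict (Set.Ioc (-Real.pi) Real.pi))) atTop (𝓝 0)

/-- The density `|1 - e^{i λ τ}|^{2d} λ^{-2d} f(λ)`. -/
def stepDensity (d τ : ℕ) (f : ℝ → Matrix ℕ ℕ ℂ) (x : ℝ) : Matrix ℕ ℕ ℂ :=
  (((‖1 - Complex.exp (Complex.I * x * τ)‖ ^ (2 * d) / x ^ (2 * d) : ℝ)) : ℂ) • f x

/-- The factorization `p(λ) = X(λ) X(λ)^*` a.e. with `X(λ) = ∑_{l ≥ 0} x(l) e^{-i λ l}`, where the
`x(l)` are matrices with a square summable family of entries. -/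
structure IsFactorization {κ : Type*} (p : ℝ → Matrix ℕ ℕ ℂ) (X : ℝ → Matrix ℕ κ ℂ)
    (x : ℕ → Matrix ℕ κ ℂ) : Prop where
  square_summable : Summable fun q : ℕ × ℕ × κ => ‖x q.1 q.2.1 q.2.2‖ ^ 2
  expansion : ∀ k μ, HasExpansion (fun t => X t k μ) (fun l => x l k μ)
  factor : ∀ᵐ t ∂(volume.restrict (Set.Ioc (-Real.pi) Real.pi)), ∀ k n,
    HasSum (fun μ => X t k μ * star (X t n μ)) (p t k n)

/-- A factorization is canonical if the sequence with moving average coefficients `x(l)` and its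
innovation sequence generate the same past: the delayed rows of the coefficients span a dense
subspace of `ℓ²`. -/
structure IsCanonicalFactorization {κ : Type*} (p : ℝ → Matrix ℕ ℕ ℂ) (X : ℝ → Matrix ℕ κ ℂ)
    (x : ℕ → Matrix ℕ κ ℂ) : Prop extends IsFactorization p X x where
  canonical : (Submodule.span ℂ {v : lp (fun _ : ℕ × κ => ℂ) 2 | ∃ s k : ℕ, ∀ (l : ℕ) (μ : κ),
    v (l, μ) = if s ≤ l then x (l - s) k μ else 0}).topologicalClosure = ⊤

open Classical in
/-- `Ψ(λ) = ∑_{l ≥ 0} ψ(l) e^{-i λ l}`, with square summable rows, satisfies `Ψ(λ) Θ(λ) = E`. -/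
structure IsInverseFactor {κ : Type*} (Θ : ℝ → Matrix ℕ κ ℂ) (Ψ : ℝ → Matrix κ ℕ ℂ)
    (ψ : ℕ → Matrix κ ℕ ℂ) : Prop where
  square_summable : ∀ μ, Summable fun q : ℕ × ℕ => ‖ψ q.1 μ q.2‖ ^ 2
  expansion : ∀ μ k, HasExpansion (fun t => Ψ t μ k) (fun l => ψ l μ k)
  mul_eq_one : ∀ᵐ t ∂(volume.restrict (Set.Ioc (-Real.pi) Real.pi)), ∀ μ ν,
    HasSum (fun k => Ψ t μ k * Θ t k ν) ((1 : Matrix κ κ ℂ) μ ν)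

/-! ### Infinite matrices -/

/-- The product of an infinite matrix and a vector. -/
def infMulVec {α β : Type*} (A : Matrix α β ℂ) (v : β → ℂ) (i : α) : ℂ := ∑' j, A i j * v j

/-- `A` is the matrix of a bounded linear operator between `ℓ²` spaces. -/
def IsL2Bounded {α β : Type*} (A : Matrix α β ℂ) : Prop :=
  ∃ L : lp (fun _ : β => ℂ) 2 →L[ℂ] lp (fun _ : α => ℂ) 2,
    ∀ v i, HasSum (fun j => A i j * v j) (L v i)

/-- The matrix with blocks `x(l - j)ᵀ` for `j ≤ l` and zero blocks for `l < j`. -/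
def toeplitz {κ : Type*} (x : ℕ → Matrix ℕ κ ℂ) : Matrix (ℕ × κ) (ℕ × ℕ) ℂ :=
  fun p q => if q.1 ≤ p.1 then x (p.1 - q.1) q.2 p.2 else 0

/-- `c = X̃^* X̃ b` for the matrix `X̃ = toeplitz x`. -/
def cVec {κ : Type*} (x : ℕ → Matrix ℕ κ ℂ) (b : ℕ × ℕ → ℂ) : ℕ × ℕ → ℂ :=
  infMulVec (toeplitz x).conjTranspose (infMulVec (toeplitz x) b)

/-- `(ψ̄ C)_m = ∑_j ψ̄(j) c(j + m)`, indexed by `(m, μ)`. -/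
def psiC {κ : Type*} (ψ : ℕ → Matrix κ ℕ ℂ) (c : ℕ × ℕ → ℂ) (p : ℕ × κ) : ℂ :=
  ∑' q : ℕ × ℕ, star (ψ q.1 p.2 q.2) * c (q.1 + p.1, q.2)

/-- The squared `ℓ²` norm. -/
def sqNorm {α : Type*} (v : α → ℂ) : ℝ := ∑' i, ‖v i‖ ^ 2

/-! ### Spectral characteristics -/

/-- The factor `(1 - e^{-i λ τ})^d / (i λ)^d`. -/
def incFactor (d τ : ℕ) (x : ℝ) : ℂ :=
  (1 - Complex.exp (-(Complex.I * x * τ))) ^ d / (Complex.I * x) ^ d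

/-- The quadratic form `hᵀ F h̄`. -/
def quadForm (F : Matrix ℕ ℕ ℂ) (h : ℕ → ℂ) : ℝ :=
  (∑' q : ℕ × ℕ, h q.1 * F q.1 q.2 * star (h q.2)).re

/-- The vector function `∑ c_{j,k} e^{i λ j} (1 - e^{-i λ τ})^d (i λ)^{-d} δ_k`. -/
def spectralPoly (d τ : ℕ) (c : ℤ × ℕ →₀ ℂ) (x : ℝ) (k : ℕ) : ℂ :=
  incFactor d τ x *
    c.sum fun q a => if q.2 = k then a * Complex.exp (Complex.I * (q.1 : ℂ) * x) else 0

/-- `Y = ∫ h(λ)ᵀ dZ_ζ(λ)` for the increment sequence `ζ` with spectral density `F`, that is, `Y` is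
the image of `h ∈ L₂(F)` under the isometry that takes `e^{i λ j} (1 - e^{-i λ τ})^d (i λ)^{-d} δ_k`
to `ζ_k(j)`. -/
def IsSpectralCharacteristic {H : Type*} [NormedAddCommGroup H] [NormedSpace ℂ H]
    (d τ : ℕ) (F : ℝ → Matrix ℕ ℕ ℂ) (ζ : ℤ → ℕ → H) (h : ℝ → ℕ → ℂ) (Y : H) : Prop :=
  (∀ k, AEStronglyMeasurable (fun x => h x k)
    (volume.restrict (Set.Ioc (-Real.pi) Real.pi))) ∧
  (∀ᵐ x ∂(volume.restrict (Set.Ioc (-Real.pi) Real.pi)), Summable fun k => ‖h x k‖ ^ 2) ∧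
  ∃ c : ℕ → (ℤ × ℕ →₀ ℂ),
    Tendsto (fun N => ∫⁻ x in Set.Ioc (-Real.pi) Real.pi,
      ENNReal.ofReal (quadForm (F x) fun k => h x k - spectralPoly d τ (c N) x k))
      atTop (𝓝 0) ∧
    Tendsto (fun N => (c N).sum fun q a => a • ζ q.1 q.2) atTop (𝓝 Y)

/-- `Y = ∫ h(λ)ᵀ dZ_ζ(λ)` for `h = h₀ + ∑_μ h_μ`, where the series converges in `L₂(F)`
(equivalently, the integrals of its terms are summable). -/
def HasSpectralSeries {H κ : Type*} [NormedAddCommGroup H] [NormedSpace ℂ H]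
    (d τ : ℕ) (F : ℝ → Matrix ℕ ℕ ℂ) (ζ : ℤ → ℕ → H) (h₀ : ℝ → ℕ → ℂ) (h : κ → ℝ → ℕ → ℂ)
    (Y : H) : Prop :=
  ∃ (Y₀ : H) (y : κ → H), IsSpectralCharacteristic d τ F ζ h₀ Y₀ ∧
    (∀ μ, IsSpectralCharacteristic d τ F ζ (h μ) (y μ)) ∧ HasSum y (Y - Y₀)

/-- The components of `B_τ(e^{-i λ}) = ∑_j b_j e^{-i λ j}`. -/
def bSeries (b : ℕ × ℕ → ℂ) (x : ℝ) (k : ℕ) : ℂ :=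
  ∑' j : ℕ, b (j, k) * Complex.exp (-(Complex.I * j * x))

/-- The subspace `H⁰(ζ)`: closed linear span of the `ζ_k(j)`, `j ≤ 0`. -/
def pastSpace {H : Type*} [NormedAddCommGroup H] [NormedSpace ℂ H] (ζ : ℤ → ℕ → H) :
    Submodule ℂ H :=
  (Submodule.span ℂ {v | ∃ (j : ℤ) (k : ℕ), j ≤ 0 ∧ v = ζ j k}).topologicalClosure

/-- The space of observations is complete, so that the orthogonal projection on it exists. -/
instance instCompletePastSpace {H : Type*} [NormedAddCommGroup H] [NormedSpace ℂ H] [CompleteSpace H]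
    (ζ : ℤ → ℕ → H) : CompleteSpace (pastSpace ζ) :=
  inferInstanceAs (CompleteSpace (Submodule.topologicalClosure _))

/-- The generated sequence of the observed process `ξ + η`. -/
def obsSeq {Ω : Type*} [MeasurableSpace Ω] {P : Measure Ω} (T : ℝ) (d τ : ℕ)
    (ξ η : ℝ → Lp ℂ 2 P) (j : ℤ) (k : ℕ) : Lp ℂ 2 P :=
  genSeq T d ξ τ j k + genSeq T d η τ j k

/-- The optimal linear estimate: the projection of `A` on the space of observations. -/
def optEstimate {Ω : Type*} [MeasurableSpace Ω] {P : Measure Ω} (T : ℝ) (d τ : ℕ)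
    (ξ η : ℝ → Lp ℂ 2 P) (A : Lp ℂ 2 P) : Lp ℂ 2 P :=
  (pastSpace (obsSeq T d τ ξ η)).starProjection A

end PCFilter

end

/-!
The proof works with coordinates in the innovation space `ℓ² = ℓ²(ℕ × κ)` and never constructs
the stochastic spectral measure.

*Innovations.* Let `ζ = ξ-sequence + η-sequence`. The factorization `Θ Θ^*` of its density says that
the covariances of `ζ_k(-s)`, `s ≥ 0`, are the inner products of the delayed rows of the coefficients
of `Θ` (`IsFactorization.inner_delayedRow`, `gram_obsSeq`). So there is an isometry `V` of `ℓ²` into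
`H` that takes delayed rows to observations (`exists_synthesis`), and canonicity says that its range
is the space of observations `H⁰`. The projection on `H⁰` is therefore `V V^*`
(`starProjection_pastSpace`). If `Θᵀ r` has coefficients `w ∈ ℓ²`, then `V w` has spectral
characteristic `incFactor * r` (`HasCoordinates.isSpectralCharacteristic`): the `L₂(f + g)` norm of
`incFactor * r` is the `L²` norm of `Θᵀ r`, and canonicity yields approximating polynomials.

*The functional.* `A ξ = ∑ b_{j,k} ξ_k(-j, τ)` (`hasSum_functional`). On segments of length `T` the
functional is `∑ S_n a_n`, with `S_n` the pairing with the path of `ξ` on the `n`-th segment, and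
`b = D^τ a` inverts the difference operator of order `d`, so that the claim is a summation by parts
of order `d`. Only the differences of order `d` of `S` are bounded, by periodicity of the increments;
`S` itself may grow and the boundary terms need not vanish. Abel means take care of them
(`hasSum_shiftDiff`): the uniform bound `exists_uniform_bound` permits the passage to the limit.

*The projection.* Let `X` be a signal sequence with density `Φ Φ^*`, uncorrelated with the noise, and
`B = ∑ b_{j,k} X_k(-j)`. Then `c = Φ̃^* Φ̃ b`, for the Toeplitz matrix `Φ̃` of `Φ`, has the components
`c_k(m) = ⟪X_k(-m), B⟫`. Since `Ψ Θ = 1`, the innovation `V δ_{m,μ}` is formally the series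
`∑ ψ_{μk}(j) ζ_k(-m-j)`, so `⟪V δ_{m,μ}, B⟫ = (ψ̄ C)_{m,μ}`, and these are the coordinates of `V^* B`
(`projection_of_signal`). The series of the `ζ_k` need not converge; that of the `X_k` does, because
`Φ̃` is bounded, and it can be used instead since the density of `X` is dominated by the density of
the observations (`hasSum_inner_innovation`). The error is given by Pythagoras' theorem.

*Two formulas.* With the density of the signal given, this applies to `X = ξ`-sequence. With the
density of the noise given, it applies to `X = η`-sequence: `A ξ + A η` lies in `H⁰` and has
spectral characteristic `incFactor * B_τ`, so the estimate of `A ξ` is `A ξ + A η` minus the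
estimate of `A η`, and both errors are equal up to sign.
-/

open MeasureTheory Filter Topology

namespace PCFilter

/-! ### The trigonometric system on an interval -/

/-- The trigonometric monomials, normalized in `L²` of an interval of length `T`. -/
noncomputable def trigFun (T : ℝ) (n : ℤ) (x : ℝ) : ℂ :=
  ((1 / Real.sqrt T : ℝ) : ℂ) * Complex.exp (2 * Real.pi * Complex.I * (n : ℂ) * x / T)

lemma continuous_trigFun (T : ℝ) (n : ℤ) : Continuous (trigFun T n) := by
  unfold trigFun; fun_prop

lemma norm_trigFun (T : ℝ) (n : ℤ) (x : ℝ) : ‖trigFun T n x‖ = 1 / Real.sqrt T := by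
  have h : (2 * Real.pi * Complex.I * (n : ℂ) * x / T : ℂ) =
      ((2 * Real.pi * n * x / T : ℝ) : ℂ) * Complex.I := by push_cast; ring
  rw [trigFun, norm_mul, h, Complex.norm_exp_ofReal_mul_I, Complex.norm_real, mul_one,
    Real.norm_of_nonneg (by positivity)]

lemma memLp_trigFun (T : ℝ) (n : ℤ) (μ : Measure ℝ) [IsFiniteMeasure μ] :
    MemLp (trigFun T n) 2 μ :=
  MemLp.of_bound (continuous_trigFun T n).aestronglyMeasurable (1 / Real.sqrt T)
    (ae_of_all _ fun x => (norm_trigFun T n x).le)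

/-- The trigonometric monomials as elements of `L²(a, b]`. -/
noncomputable def trigLp (T a b : ℝ) (n : ℤ) : Lp ℂ 2 (volume.restrict (Set.Ioc a b)) :=
  (memLp_trigFun T n (volume.restrict (Set.Ioc a b))).toLp

lemma inner_toLp {α : Type*} [MeasurableSpace α] {μ : Measure α} {u v : α → ℂ}
    (hu : MemLp u 2 μ) (hv : MemLp v 2 μ) :
    inner ℂ hu.toLp hv.toLp = ∫ x, star (u x) * v x ∂μ := by
  rw [L2.inner_def]
  refine integral_congr_ae ?_
  filter_upwards [hu.coeFn_toLp, hv.coeFn_toLp] with x hx hy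
  rw [hx, hy, RCLike.inner_apply, mul_comm]; rfl

lemma star_trigFun (T : ℝ) (n : ℤ) (x : ℝ) : star (trigFun T n x) = trigFun T (-n) x := by
  unfold trigFun
  rw [← starRingEnd_apply, map_mul, Complex.conj_ofReal, ← Complex.exp_conj]
  congr 2
  simp only [map_div₀, map_mul, Complex.conj_ofReal, Complex.conj_I, map_ofNat, Int.cast_neg,
    map_intCast]
  ring

lemma trigFun_mul (T : ℝ) (m n : ℤ) (x : ℝ) :
    trigFun T m x * trigFun T n x = ((1 / Real.sqrt T : ℝ) : ℂ) * trigFun T (m + n) x := by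
  unfold trigFun
  rw [show (2 * Real.pi * Complex.I * ((m + n : ℤ) : ℂ) * x / T : ℂ) =
    2 * Real.pi * Complex.I * m * x / T + 2 * Real.pi * Complex.I * n * x / T by
      push_cast; ring, Complex.exp_add]
  ring

lemma integral_trigFun {T a b : ℝ} (hT : 0 < T) (hb : b = a + T) (n : ℤ) :
    ∫ x in Set.Ioc a b, trigFun T n x = if n = 0 then (Real.sqrt T : ℂ) else 0 := by
  have hab : a ≤ b := by linarith
  have hTc : (T : ℂ) ≠ 0 := by exact_mod_cast hT.ne'
  rw [← intervalIntegral.integral_of_le hab]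
  unfold trigFun
  rw [intervalIntegral.integral_const_mul]
  split_ifs with h
  · subst h
    simp only [Int.cast_zero, mul_zero, zero_mul, zero_div, Complex.exp_zero,
      intervalIntegral.integral_const, hb, add_sub_cancel_left]
    rw [Complex.real_smul, mul_one, ← Complex.ofReal_mul]
    congr 1
    have := Real.mul_self_sqrt hT.le
    have h0 : Real.sqrt T ≠ 0 := (Real.sqrt_pos.2 hT).ne'
    field_simp
    nlinarith
  · have hc : (2 * Real.pi * Complex.I * (n : ℂ) / T : ℂ) ≠ 0 := by
      simp [Real.pi_ne_zero, hTc, h]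
    have h1 : ∀ x : ℝ, (2 * Real.pi * Complex.I * (n : ℂ) * x / T : ℂ) =
      (2 * Real.pi * Complex.I * (n : ℂ) / T : ℂ) * x := fun x => by ring
    simp_rw [h1]
    rw [integral_exp_mul_complex hc, hb, Complex.ofReal_add, mul_add, Complex.exp_add,
      div_mul_cancel₀ _ hTc, show (2 * Real.pi * Complex.I * (n : ℂ) : ℂ) =
        n * (2 * Real.pi * Complex.I) by ring, Complex.exp_int_mul_two_pi_mul_I]
    simp

lemma inner_trigLp {T a b : ℝ} (n : ℤ) {u : ℝ → ℂ}
    (hu : MemLp u 2 (volume.restrict (Set.Ioc a b))) :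
    inner ℂ (trigLp T a b n) hu.toLp = ∫ x in Set.Ioc a b, star (trigFun T n x) * u x :=
  inner_toLp _ _

lemma orthonormal_trigLp {T a b : ℝ} (hT : 0 < T) (hb : b = a + T) :
    Orthonormal ℂ (trigLp T a b) := by
  classical
  rw [orthonormal_iff_ite]
  intro m n
  rw [trigLp, trigLp, inner_toLp]
  simp_rw [star_trigFun, trigFun_mul T]
  rw [integral_const_mul, integral_trigFun hT hb]
  have h0 : (Real.sqrt T : ℂ) ≠ 0 := by exact_mod_cast (Real.sqrt_pos.2 hT).ne'
  by_cases h : m = n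
  · simp [h, h0]
  · have h' : ¬ (-m + n = 0) := by omega
    rw [if_neg h', if_neg h, mul_zero]

lemma orthogonal_trigLp {T a b : ℝ} (hT : 0 < T) (hb : b = a + T) :
    (Submodule.span ℂ (Set.range (trigLp T a b)))ᗮ = ⊥ := by
  rw [Submodule.eq_bot_iff]
  intro g hg
  have hab : a < b := by linarith
  have h1 : ∀ n, ∫ x in Set.Ioc a b, star (trigFun T n x) * g x = 0 := fun n => by
    have h := (Submodule.mem_orthogonal _ _).1 hg _
      (Submodule.subset_span (Set.mem_range_self n))
    have h2 := inner_trigLp (T := T) n (Lp.memLp g)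
    rw [Lp.toLp_coeFn, h] at h2
    exact h2.symm
  have hsum := hasSum_sq_fourierCoeffOn hab (Lp.memLp g)
  have h2 : ∀ n, fourierCoeffOn hab g n = 0 := fun n => by
    rw [fourierCoeffOn_eq_integral, intervalIntegral.integral_of_le hab.le]
    have h3 := h1 n
    simp_rw [star_trigFun, trigFun, mul_assoc] at h3
    rw [integral_const_mul] at h3
    have h0 : ((1 / Real.sqrt T : ℝ) : ℂ) ≠ 0 := by
      have := Real.sqrt_pos.2 hT
      exact_mod_cast (by positivity : (1 / Real.sqrt T : ℝ) ≠ 0)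
    have h4 := (mul_eq_zero.1 h3).resolve_left h0
    rw [smul_eq_zero]
    right
    rw [← h4]
    refine integral_congr_ae (ae_of_all _ fun x => ?_)
    simp only [fourier_coe_apply, smul_eq_mul]
    rw [show b - a = T by linarith]
    congr 2
    ring
  simp only [h2, norm_zero, ne_eq, OfNat.ofNat_ne_zero, not_false_eq_true, zero_pow] at hsum
  have h3 := hsum.unique hasSum_zero
  rw [smul_eq_mul, mul_eq_zero] at h3
  have h4 := h3.resolve_left (inv_ne_zero (by linarith))
  rw [intervalIntegral.integral_of_le hab.le] at h4
  have h5 : inner ℂ g g = 0 := by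
    rw [L2.inner_def]
    have : ∀ x, inner ℂ (g x) (g x) = ((‖g x‖ ^ 2 : ℝ) : ℂ) := fun x => by
      rw [inner_self_eq_norm_sq_to_K]; norm_cast
    simp_rw [this]
    rw [integral_complex_ofReal, h4]; rfl
  exact inner_self_eq_zero.1 h5

/-- The trigonometric monomials form a Hilbert basis of `L²` of an interval of length `T`. -/
noncomputable def trigBasis {T a b : ℝ} (hT : 0 < T) (hb : b = a + T) :
    HilbertBasis ℤ ℂ (Lp ℂ 2 (volume.restrict (Set.Ioc a b))) :=
  HilbertBasis.mkOfOrthogonalEqBot (orthonormal_trigLp hT hb) (orthogonal_trigLp hT hb)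

lemma coe_trigBasis {T a b : ℝ} (hT : 0 < T) (hb : b = a + T) :
    ⇑(trigBasis hT hb) = trigLp T a b :=
  HilbertBasis.coe_mkOfOrthogonalEqBot _ _

local notation "μπ" => volume.restrict (Set.Ioc (-Real.pi) Real.pi)

/-! ### One-sided trigonometric expansions -/

/-- The space `ℓ²` over an index set. -/
noncomputable abbrev ell2 (α : Type*) := lp (fun _ : α => ℂ) 2

lemma summable_sq_ell2 {α : Type*} (w : ell2 α) : Summable fun i => ‖w i‖ ^ 2 := by
  simpa using (lp.memℓp w).summable (by norm_num)

lemma hasSum_sq_ell2 {α : Type*} (w : ell2 α) : HasSum (fun i => ‖w i‖ ^ 2) (‖w‖ ^ 2) := by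
  simpa using lp.hasSum_norm (p := 2) (by norm_num) w

lemma exists_ell2 {α : Type*} {c : α → ℂ} (hc : Summable fun i => ‖c i‖ ^ 2) :
    ∃ w : ell2 α, ∀ i, w i = c i :=
  ⟨⟨c, memℓp_gen (by simpa using hc)⟩, fun _ => rfl⟩

lemma orthonormal_negExp :
    Orthonormal ℂ fun l : ℕ => trigLp (2 * Real.pi) (-Real.pi) Real.pi (-(l : ℤ)) :=
  (orthonormal_trigLp Real.two_pi_pos (by ring)).comp (fun l : ℕ => -(l : ℤ))
    (fun a b h => by simpa using h)

/-- The isometry `ℓ² → L²(-π, π]` that takes the `l`-th unit vector to the normalized `e^{-i λ l}`.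
-/
noncomputable def synth : ell2 ℕ →ₗᵢ[ℂ] Lp ℂ 2 μπ :=
  orthonormal_negExp.orthogonalFamily.linearIsometry

lemma hasSum_synth (w : ell2 ℕ) :
    HasSum (fun l : ℕ => w l • trigLp (2 * Real.pi) (-Real.pi) Real.pi (-(l : ℤ))) (synth w) := by
  simpa using! orthonormal_negExp.orthogonalFamily.hasSum_linearIsometry w

lemma sqrt_two_pi_ne_zero : (Real.sqrt (2 * Real.pi) : ℂ) ≠ 0 := by
  exact_mod_cast (Real.sqrt_pos.2 Real.two_pi_pos).ne'

lemma sqrt_two_pi_mul_trigFun (l : ℕ) (x : ℝ) :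
    (Real.sqrt (2 * Real.pi) : ℂ) * trigFun (2 * Real.pi) (-(l : ℤ)) x =
      Complex.exp (-(Complex.I * l * x)) := by
  unfold trigFun
  have h := sqrt_two_pi_ne_zero
  have hp : (Real.pi : ℂ) ≠ 0 := by exact_mod_cast Real.pi_ne_zero
  rw [← mul_assoc, Complex.ofReal_div, Complex.ofReal_one, mul_one_div_cancel h, one_mul]
  congr 1
  push_cast
  field_simp

/-- The partial sums of a trigonometric series, as elements of `L²`. -/
lemma coeFn_partialSum (c : ℕ → ℂ) (s : Finset ℕ) :
    (fun x : ℝ => ∑ l ∈ s, c l * Complex.exp (-(Complex.I * l * x))) =ᵐ[μπ]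
      ((Real.sqrt (2 * Real.pi) : ℂ) •
        ∑ l ∈ s, c l • trigLp (2 * Real.pi) (-Real.pi) Real.pi (-(l : ℤ)) : Lp ℂ 2 μπ) := by
  have h1 := Lp.coeFn_smul (Real.sqrt (2 * Real.pi) : ℂ)
    (∑ l ∈ s, c l • trigLp (2 * Real.pi) (-Real.pi) Real.pi (-(l : ℤ)))
  have h2 := Lp.coeFn_finsetSum s fun l : ℕ =>
    c l • trigLp (2 * Real.pi) (-Real.pi) Real.pi (-(l : ℤ))
  have h3 : ∀ l : ℕ, ∀ᵐ x ∂μπ,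
      (c l • trigLp (2 * Real.pi) (-Real.pi) Real.pi (-(l : ℤ)) : Lp ℂ 2 μπ) x =
        c l * trigFun (2 * Real.pi) (-(l : ℤ)) x := fun l => by
    filter_upwards [Lp.coeFn_smul (c l) (trigLp (2 * Real.pi) (-Real.pi) Real.pi (-(l : ℤ))),
      (memLp_trigFun (2 * Real.pi) (-(l : ℤ)) μπ).coeFn_toLp] with x h4 h5
    rw [h4, Pi.smul_apply, smul_eq_mul, trigLp, h5]
  filter_upwards [h1, h2, ae_all_iff.2 h3] with x h4 h5 h6
  rw [h4, Pi.smul_apply, h5, Finset.sum_apply, smul_eq_mul, Finset.mul_sum]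
  refine Finset.sum_congr rfl fun l _ => ?_
  rw [h6, ← sqrt_two_pi_mul_trigFun]
  ring

lemma hasExpansion_iff_tendsto {u : ℝ → ℂ} {c : ℕ → ℂ} :
    HasExpansion u c ↔ ∃ hu : MemLp u 2 μπ, Tendsto (fun N : ℕ =>
      ((Real.sqrt (2 * Real.pi) : ℂ) • ∑ l ∈ Finset.range N,
        c l • trigLp (2 * Real.pi) (-Real.pi) Real.pi (-(l : ℤ)) : Lp ℂ 2 μπ)) atTop
        (𝓝 hu.toLp) := by
  have key : ∀ hu : MemLp u 2 μπ, ∀ N : ℕ, eLpNorm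
      (fun x => u x - ∑ l ∈ Finset.range N, c l * Complex.exp (-(Complex.I * l * x))) 2 μπ =
      eLpNorm (⇑((Real.sqrt (2 * Real.pi) : ℂ) • ∑ l ∈ Finset.range N,
        c l • trigLp (2 * Real.pi) (-Real.pi) Real.pi (-(l : ℤ)) : Lp ℂ 2 μπ) - ⇑(hu.toLp)) 2
        μπ := fun hu N => by
    rw [eLpNorm_sub_comm]
    refine eLpNorm_congr_ae ?_
    filter_upwards [coeFn_partialSum c (Finset.range N), hu.coeFn_toLp] with x h1 h2
    rw [Pi.sub_apply, h2, ← h1]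
  constructor
  · rintro ⟨hu, h⟩
    refine ⟨hu, (Lp.tendsto_Lp_iff_tendsto_eLpNorm' _ _).2 ?_⟩
    simpa only [← key hu] using h
  · rintro ⟨hu, h⟩
    refine ⟨hu, ?_⟩
    have := (Lp.tendsto_Lp_iff_tendsto_eLpNorm' _ _).1 h
    simpa only [key hu] using this

/-- A function has the expansion `c` exactly if `c` is square summable and the function is the
image of `c` under the (rescaled) synthesis isometry. -/
lemma hasExpansion_iff {u : ℝ → ℂ} {c : ℕ → ℂ} :
    HasExpansion u c ↔ ∃ (hu : MemLp u 2 μπ) (w : ell2 ℕ), (∀ l, w l = c l) ∧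
      hu.toLp = (Real.sqrt (2 * Real.pi) : ℂ) • synth w := by
  rw [hasExpansion_iff_tendsto]
  constructor
  · rintro ⟨hu, h⟩
    have hs := sqrt_two_pi_ne_zero
    have hcoef : ∀ l : ℕ, inner ℂ (trigLp (2 * Real.pi) (-Real.pi) Real.pi (-(l : ℤ)))
        ((Real.sqrt (2 * Real.pi) : ℂ)⁻¹ • hu.toLp) = c l := fun l => by
      have h1 : Tendsto (fun N : ℕ => inner ℂ
          (trigLp (2 * Real.pi) (-Real.pi) Real.pi (-(l : ℤ)))
          ((Real.sqrt (2 * Real.pi) : ℂ)⁻¹ • ((Real.sqrt (2 * Real.pi) : ℂ) •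
            ∑ l ∈ Finset.range N,
              c l • trigLp (2 * Real.pi) (-Real.pi) Real.pi (-(l : ℤ)) : Lp ℂ 2 μπ))) atTop
          (𝓝 (inner ℂ (trigLp (2 * Real.pi) (-Real.pi) Real.pi (-(l : ℤ)))
            ((Real.sqrt (2 * Real.pi) : ℂ)⁻¹ • hu.toLp))) :=
        tendsto_const_nhds.inner (h.const_smul _)
      refine tendsto_nhds_unique h1 (tendsto_const_nhds.congr' ?_)
      filter_upwards [eventually_gt_atTop l] with N hN
      rw [inv_smul_smul₀ hs, orthonormal_negExp.inner_right_sum c (Finset.mem_range.2 hN)]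
    have hsum : Summable fun l => ‖c l‖ ^ 2 := by
      have := orthonormal_negExp.inner_products_summable
        (x := (Real.sqrt (2 * Real.pi) : ℂ)⁻¹ • hu.toLp)
      simpa only [hcoef] using this
    obtain ⟨w, hw⟩ := exists_ell2 hsum
    refine ⟨hu, w, hw, tendsto_nhds_unique h ?_⟩
    have := (hasSum_synth w).tendsto_sum_nat.const_smul (Real.sqrt (2 * Real.pi) : ℂ)
    simpa only [hw] using this
  · rintro ⟨hu, w, hw, h⟩
    refine ⟨hu, ?_⟩
    rw [h]
    have := (hasSum_synth w).tendsto_sum_nat.const_smul (Real.sqrt (2 * Real.pi) : ℂ)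
    simpa only [hw] using this

namespace HasExpansion

lemma of_ae_eq {u : ℝ → ℂ} {w : ell2 ℕ}
    (h : u =ᵐ[μπ] ((Real.sqrt (2 * Real.pi) : ℂ) • synth w : Lp ℂ 2 μπ)) :
    HasExpansion u w := by
  have hu : MemLp u 2 μπ := (memLp_congr_ae h).2 (Lp.memLp _)
  refine hasExpansion_iff.2 ⟨hu, w, fun _ => rfl, ?_⟩
  rw [← Lp.toLp_coeFn ((Real.sqrt (2 * Real.pi) : ℂ) • synth w) (Lp.memLp _)]
  exact (MemLp.toLp_eq_toLp_iff _ _).2 h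

lemma exists_ae_eq {u : ℝ → ℂ} {c : ℕ → ℂ} (h : HasExpansion u c) :
    ∃ w : ell2 ℕ, (∀ l, w l = c l) ∧
      u =ᵐ[μπ] ((Real.sqrt (2 * Real.pi) : ℂ) • synth w : Lp ℂ 2 μπ) := by
  obtain ⟨hu, w, hw, e⟩ := hasExpansion_iff.1 h
  exact ⟨w, hw, by rw [← e]; exact hu.coeFn_toLp.symm⟩

lemma congr_coeff {u : ℝ → ℂ} {c c' : ℕ → ℂ} (h : HasExpansion u c) (e : ∀ l, c l = c' l) :
    HasExpansion u c' := (funext e : c = c') ▸ h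

lemma congr_ae {u v : ℝ → ℂ} {c : ℕ → ℂ} (h : HasExpansion u c) (e : v =ᵐ[μπ] u) :
    HasExpansion v c := by
  obtain ⟨w, hw, e'⟩ := h.exists_ae_eq
  exact (of_ae_eq (e.trans e')).congr_coeff hw

lemma summable {u : ℝ → ℂ} {c : ℕ → ℂ} (h : HasExpansion u c) : Summable fun l => ‖c l‖ ^ 2 := by
  obtain ⟨w, hw, -⟩ := h.exists_ae_eq
  simpa only [hw] using summable_sq_ell2 w

lemma add {u v : ℝ → ℂ} {c c' : ℕ → ℂ} (h : HasExpansion u c) (h' : HasExpansion v c') :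
    HasExpansion (fun x => u x + v x) (fun l => c l + c' l) := by
  obtain ⟨w, hw, e⟩ := h.exists_ae_eq
  obtain ⟨w', hw', e'⟩ := h'.exists_ae_eq
  refine (of_ae_eq (w := w + w') ?_).congr_coeff (c := (w + w' : ell2 ℕ)) fun l => by
    rw [lp.coeFn_add, Pi.add_apply, hw, hw']
  rw [map_add, smul_add]
  filter_upwards [e, e', Lp.coeFn_add ((Real.sqrt (2 * Real.pi) : ℂ) • synth w)
    ((Real.sqrt (2 * Real.pi) : ℂ) • synth w')] with x h1 h2 h3
  rw [h3, Pi.add_apply, h1, h2]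

lemma const_mul {u : ℝ → ℂ} {c : ℕ → ℂ} (h : HasExpansion u c) (a : ℂ) :
    HasExpansion (fun x => a * u x) (fun l => a * c l) := by
  obtain ⟨w, hw, e⟩ := h.exists_ae_eq
  refine (of_ae_eq (w := a • w) ?_).congr_coeff (c := (a • w : ell2 ℕ)) fun l => by
    rw [lp.coeFn_smul, Pi.smul_apply, hw, smul_eq_mul]
  rw [map_smul, smul_comm]
  filter_upwards [e, Lp.coeFn_smul a ((Real.sqrt (2 * Real.pi) : ℂ) • synth w)] with x h1 h3
  rw [h3, Pi.smul_apply, h1, smul_eq_mul]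

lemma zero : HasExpansion (fun _ => 0) (fun _ => 0) := by
  refine (of_ae_eq (w := 0) ?_).congr_coeff (c := (0 : ell2 ℕ)) fun l => by simp
  rw [map_zero, smul_zero]
  exact (Lp.coeFn_zero _ _ _).symm

lemma sub {u v : ℝ → ℂ} {c c' : ℕ → ℂ} (h : HasExpansion u c) (h' : HasExpansion v c') :
    HasExpansion (fun x => u x - v x) (fun l => c l - c' l) := by
  have := h.add (h'.const_mul (-1))
  simpa only [neg_one_mul, ← sub_eq_add_neg] using this

lemma sum {ι : Type*} (s : Finset ι) {u : ι → ℝ → ℂ} {c : ι → ℕ → ℂ}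
    (h : ∀ i ∈ s, HasExpansion (u i) (c i)) :
    HasExpansion (fun x => ∑ i ∈ s, u i x) (fun l => ∑ i ∈ s, c i l) := by
  classical
  induction s using Finset.induction_on with
  | empty => simpa using zero
  | insert i s hi ih =>
    simp only [Finset.sum_insert hi]
    exact (h i (Finset.mem_insert_self i s)).add
      (ih fun j hj => h j (Finset.mem_insert_of_mem hj))

lemma norm_exp_neg (s : ℕ) (x : ℝ) : ‖Complex.exp (-(Complex.I * s * x))‖ = 1 := by
  rw [show (-(Complex.I * s * x) : ℂ) = ((-(s * x) : ℝ) : ℂ) * Complex.I by push_cast; ring,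
    Complex.norm_exp_ofReal_mul_I]

/-- Multiplication by `e^{-i λ s}` delays the coefficients. -/
lemma shift {u : ℝ → ℂ} {c : ℕ → ℂ} (h : HasExpansion u c) (s : ℕ) :
    HasExpansion (fun x => Complex.exp (-(Complex.I * s * x)) * u x)
      (fun l => if s ≤ l then c (l - s) else 0) := by
  have hcont : Continuous fun x : ℝ => Complex.exp (-(Complex.I * s * x)) := by fun_prop
  refine ⟨h.1.of_le (hcont.aestronglyMeasurable.mul h.1.1)
    (ae_of_all _ fun x => by rw [norm_mul, norm_exp_neg, one_mul]), ?_⟩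
  rw [← tendsto_add_atTop_iff_nat s]
  refine h.2.congr fun N => ?_
  refine eLpNorm_congr_norm_ae (ae_of_all _ fun x => ?_)
  rw [add_comm N s, Finset.sum_range_add]
  have h1 : ∑ l ∈ Finset.range s, (if s ≤ l then c (l - s) else 0) *
      Complex.exp (-(Complex.I * l * x)) = 0 := Finset.sum_eq_zero fun l hl => by
    rw [if_neg (not_le.2 (Finset.mem_range.1 hl)), zero_mul]
  have h2 : ∑ l ∈ Finset.range N, (if s ≤ s + l then c (s + l - s) else 0) *
      Complex.exp (-(Complex.I * (s + l : ℕ) * x)) = Complex.exp (-(Complex.I * s * x)) *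
        ∑ l ∈ Finset.range N, c l * Complex.exp (-(Complex.I * l * x)) := by
    rw [Finset.mul_sum]
    refine Finset.sum_congr rfl fun l _ => ?_
    rw [if_pos (Nat.le_add_right s l), Nat.add_sub_cancel_left, mul_left_comm, ← Complex.exp_add]
    congr 2
    push_cast
    ring
  rw [h1, h2, zero_add, ← mul_sub, norm_mul, norm_exp_neg, one_mul]

lemma hasSum_inner {u v : ℝ → ℂ} {c c' : ℕ → ℂ} (h : HasExpansion u c) (h' : HasExpansion v c') :
    HasSum (fun l => c l * star (c' l)) ((1 / (2 * Real.pi) : ℂ) * ∫ x, u x * star (v x) ∂μπ) := by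
  obtain ⟨hu, w, hw, e⟩ := hasExpansion_iff.1 h
  obtain ⟨hv, w', hw', e'⟩ := hasExpansion_iff.1 h'
  have h1 := inner_toLp hv hu
  rw [e, e', inner_smul_left, inner_smul_right, synth.inner_map_map, Complex.conj_ofReal,
    ← mul_assoc, ← Complex.ofReal_mul, Real.mul_self_sqrt Real.two_pi_pos.le] at h1
  have h2 : (1 / (2 * Real.pi) : ℂ) * ∫ x, u x * star (v x) ∂μπ = inner ℂ w' w := by
    have h3 : ∫ x, u x * star (v x) ∂μπ = ∫ x, star (v x) * u x ∂μπ := by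
      simp_rw [mul_comm]
    rw [h3, ← h1]
    have : (Real.pi : ℂ) ≠ 0 := by exact_mod_cast Real.pi_ne_zero
    push_cast
    field_simp
  rw [h2]
  have h4 := lp.hasSum_inner (𝕜 := ℂ) w' w
  simpa only [RCLike.inner_apply, hw, hw', starRingEnd_apply] using h4

lemma integrable_mul_star {u v : ℝ → ℂ} {c c' : ℕ → ℂ} (h : HasExpansion u c)
    (h' : HasExpansion v c') : Integrable (fun x => u x * star (v x)) μπ :=
  h.1.integrable_mul h'.1.star

/-- Parseval's identity. -/
lemma lintegral_sq {u : ℝ → ℂ} {c : ℕ → ℂ} (h : HasExpansion u c) :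
    ∫⁻ x, ‖u x‖ₑ ^ 2 ∂μπ = ENNReal.ofReal (2 * Real.pi * ∑' l, ‖c l‖ ^ 2) := by
  have h1 := h.hasSum_inner h
  have h2 : ∀ l, c l * star (c l) = ((‖c l‖ ^ 2 : ℝ) : ℂ) := fun l => by
    have := Complex.mul_conj' (c l)
    push_cast
    exact this
  have h3 : ∀ x, u x * star (u x) = ((‖u x‖ ^ 2 : ℝ) : ℂ) := fun l => by
    have := Complex.mul_conj' (u l)
    push_cast
    exact this
  simp_rw [h2, h3] at h1
  rw [integral_complex_ofReal] at h1
  have h4 := h1.tsum_eq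
  rw [← Complex.ofReal_tsum] at h4
  have h5 : 2 * Real.pi * ∑' l, ‖c l‖ ^ 2 = ∫ x, ‖u x‖ ^ 2 ∂μπ := by
    have h6 : ((2 * Real.pi * ∑' l, ‖c l‖ ^ 2 : ℝ) : ℂ) = ((∫ x, ‖u x‖ ^ 2 ∂μπ : ℝ) : ℂ) := by
      rw [Complex.ofReal_mul, h4]
      have : (Real.pi : ℂ) ≠ 0 := by exact_mod_cast Real.pi_ne_zero
      push_cast
      field_simp
    exact_mod_cast h6
  rw [h5, ofReal_integral_eq_lintegral_ofReal h.1.integrable_norm_pow'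
    (ae_of_all _ fun x => by positivity)]
  refine lintegral_congr fun x => ?_
  rw [ENNReal.ofReal_pow (norm_nonneg _), ofReal_norm]

lemma exists_of_summable {c : ℕ → ℂ} (hc : Summable fun l => ‖c l‖ ^ 2) :
    ∃ u, HasExpansion u c := by
  obtain ⟨w, hw⟩ := exists_ell2 hc
  exact ⟨_, (of_ae_eq (w := w) (EventuallyEq.refl _ _)).congr_coeff hw⟩

/-- If the coefficients converge in `ℓ²` and the functions converge in measure, the limits
correspond to each other. -/
lemma of_tendsto {ι : Type*} {l : Filter ι} [l.NeBot] [l.IsCountablyGenerated] {u : ι → ℝ → ℂ}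
    {w : ι → ell2 ℕ} {u₀ : ℝ → ℂ} {w₀ : ell2 ℕ} (h : ∀ i, HasExpansion (u i) (w i))
    (hw : Tendsto w l (𝓝 w₀)) (hu : TendstoInMeasure μπ u l u₀) : HasExpansion u₀ w₀ := by
  have h1 : Tendsto (fun i => (Real.sqrt (2 * Real.pi) : ℂ) • synth (w i)) l
      (𝓝 ((Real.sqrt (2 * Real.pi) : ℂ) • synth w₀)) :=
    ((synth.continuous.tendsto w₀).comp hw).const_smul _
  have h2 := tendstoInMeasure_of_tendsto_Lp h1
  refine of_ae_eq (tendstoInMeasure_ae_unique hu (h2.congr_left fun i => ?_))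
  obtain ⟨w', hw', e'⟩ := (h i).exists_ae_eq
  rw [show w' = w i from lp.ext (funext hw')] at e'
  exact e'.symm

end HasExpansion

/-- Parseval's identity for vector functions. -/
lemma lintegral_tsum_sq {κ : Type*} [Countable κ] {G : ℝ → κ → ℂ} {w : ell2 (ℕ × κ)}
    (h : ∀ ν, HasExpansion (fun x => G x ν) fun l => w (l, ν)) :
    ∫⁻ x, ∑' ν, ‖G x ν‖ₑ ^ 2 ∂μπ = ENNReal.ofReal (2 * Real.pi * ‖w‖ ^ 2) := by
  rw [lintegral_tsum fun ν => ((h ν).1.1.enorm.pow_const 2)]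
  simp_rw [(h _).lintegral_sq]
  have h1 := (Equiv.prodComm κ ℕ).hasSum_iff.2 (hasSum_sq_ell2 w)
  have h2 : ∀ ν : κ, HasSum (fun l : ℕ => ‖w (l, ν)‖ ^ 2) (∑' l : ℕ, ‖w (l, ν)‖ ^ 2) :=
    fun ν => (h ν).summable.hasSum
  have h3 := (h1.prod_fiberwise h2).mul_left (2 * Real.pi)
  rw [← h3.tsum_eq, ENNReal.ofReal_tsum_of_nonneg (fun ν => ?_) h3.summable]
  exact mul_nonneg Real.two_pi_pos.le (tsum_nonneg fun l => by positivity)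

/-! ### Square summable matrices -/

lemma summable_mul_of_sq {ι : Type*} {a b : ι → ℝ} (ha : Summable fun i => a i ^ 2)
    (hb : Summable fun i => b i ^ 2) : Summable fun i => a i * b i := by
  refine Summable.of_norm_bounded (ha.add hb) fun i => ?_
  rw [Real.norm_eq_abs, abs_le]
  constructor <;> nlinarith [sq_nonneg (a i + b i), sq_nonneg (a i - b i), sq_nonneg (a i)]

lemma tsum_mul_sq_le {ι : Type*} {a b : ι → ℝ} (ha : Summable fun i => a i ^ 2)
    (hb : Summable fun i => b i ^ 2) :
    (∑' i, a i * b i) ^ 2 ≤ (∑' i, a i ^ 2) * ∑' i, b i ^ 2 := by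
  refine le_of_tendsto_of_tendsto' ((summable_mul_of_sq ha hb).hasSum.pow 2)
    (Tendsto.mul ha.hasSum hb.hasSum) fun s => ?_
  exact Finset.sum_mul_sq_le_sq_mul_sq s a b

section Pointwise

variable {κ : Type*} {M : Matrix ℕ κ ℂ} {r : ℕ → ℂ}

lemma summable_col (hM : Summable fun q : ℕ × κ => ‖M q.1 q.2‖ ^ 2) (ν : κ) :
    Summable fun k => ‖M k ν‖ ^ 2 :=
  hM.comp_injective (i := fun k : ℕ => (k, ν)) fun a b h => by simpa using h

lemma summable_norm_mulVec (hM : Summable fun q : ℕ × κ => ‖M q.1 q.2‖ ^ 2)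
    (hr : Summable fun k => ‖r k‖ ^ 2) (ν : κ) : Summable fun k => ‖M k ν * r k‖ := by
  simpa only [norm_mul] using summable_mul_of_sq (summable_col hM ν) hr

lemma sq_tsum_norm_mulVec_le (hM : Summable fun q : ℕ × κ => ‖M q.1 q.2‖ ^ 2)
    (hr : Summable fun k => ‖r k‖ ^ 2) (ν : κ) :
    (∑' k, ‖M k ν * r k‖) ^ 2 ≤ (∑' k, ‖M k ν‖ ^ 2) * ∑' k, ‖r k‖ ^ 2 := by
  simpa only [norm_mul] using tsum_mul_sq_le (summable_col hM ν) hr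

lemma summable_sq_tsum_norm_mulVec (hM : Summable fun q : ℕ × κ => ‖M q.1 q.2‖ ^ 2)
    (hr : Summable fun k => ‖r k‖ ^ 2) :
    Summable fun ν => (∑' k, ‖M k ν * r k‖) ^ 2 := by
  have h1 : Summable fun ν : κ => ∑' k, ‖M k ν‖ ^ 2 :=
    ((summable_prod_of_nonneg fun q => sq_nonneg _).1
      ((Equiv.prodComm κ ℕ).summable_iff.2 hM)).2
  exact Summable.of_nonneg_of_le (fun ν => sq_nonneg _) (sq_tsum_norm_mulVec_le hM hr)
    (h1.mul_right _)

/-- The quadratic form `rᵀ M M^* r̄` is the squared norm of `Mᵀ r`, and its double series converges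
absolutely. -/
lemma hasSum_quadForm {p : Matrix ℕ ℕ ℂ} (hM : Summable fun q : ℕ × κ => ‖M q.1 q.2‖ ^ 2)
    (hr : Summable fun k => ‖r k‖ ^ 2)
    (hp : ∀ k n, HasSum (fun μ => M k μ * star (M n μ)) (p k n)) :
    HasSum (fun q : ℕ × ℕ => r q.1 * p q.1 q.2 * star (r q.2))
      ((∑' ν, ‖∑' k, M k ν * r k‖ ^ 2 : ℝ) : ℂ) := by
  let t : κ × (ℕ × ℕ) → ℂ := fun z => (M z.2.1 z.1 * r z.2.1) * star (M z.2.2 z.1 * r z.2.2)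
  have hrow : ∀ ν, Summable fun q : ℕ × ℕ => ‖t (ν, q)‖ := fun ν => by
    have := (summable_norm_mulVec hM hr ν).mul_of_nonneg (summable_norm_mulVec hM hr ν)
      (fun _ => norm_nonneg _) (fun _ => norm_nonneg _)
    simpa only [t, norm_mul, norm_star] using this
  have hrow' : ∀ ν, ∑' q : ℕ × ℕ, ‖t (ν, q)‖ = (∑' k, ‖M k ν * r k‖) ^ 2 := fun ν => by
    have h := (summable_norm_mulVec hM hr ν)
    rw [sq, h.tsum_mul_tsum h (h.mul_of_nonneg h (fun _ => norm_nonneg _)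
      (fun _ => norm_nonneg _))]
    simp only [t, norm_mul, norm_star]
  have hsum : Summable t := by
    refine Summable.of_norm ((summable_prod_of_nonneg fun _ => norm_nonneg _).2 ⟨hrow, ?_⟩)
    simp_rw [hrow']
    exact summable_sq_tsum_norm_mulVec hM hr
  have h1 : ∀ ν, HasSum (fun q : ℕ × ℕ => t (ν, q)) ((‖∑' k, M k ν * r k‖ ^ 2 : ℝ) : ℂ) :=
    fun ν => by
    have h := (summable_norm_mulVec hM hr ν)
    have h2 := h.of_norm.hasSum.mul (h.of_norm.hasSum.star) (hrow ν).of_norm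
    rw [← starRingEnd_apply, Complex.mul_conj'] at h2
    exact_mod_cast h2
  have h3 := hsum.hasSum.prod_fiberwise h1
  have h4 : ∀ q : ℕ × ℕ, HasSum (fun ν => t (ν, q)) (r q.1 * p q.1 q.2 * star (r q.2)) :=
    fun q => by
    have := (hp q.1 q.2).mul_left (r q.1 * star (r q.2))
    rw [mul_right_comm] at this
    refine this.congr_fun fun ν => ?_
    simp only [t, star_mul']
    ring
  have h5 := ((Equiv.prodComm (ℕ × ℕ) κ).hasSum_iff.2 hsum.hasSum).prod_fiberwise h4
  convert h5 using 1
  rw [Complex.ofReal_tsum]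
  exact h3.tsum_eq

lemma quadForm_eq {p : Matrix ℕ ℕ ℂ} (hM : Summable fun q : ℕ × κ => ‖M q.1 q.2‖ ^ 2)
    (hr : Summable fun k => ‖r k‖ ^ 2)
    (hp : ∀ k n, HasSum (fun μ => M k μ * star (M n μ)) (p k n)) :
    quadForm p r = ∑' ν, ‖∑' k, M k ν * r k‖ ^ 2 := by
  rw [quadForm, (hasSum_quadForm hM hr hp).tsum_eq, Complex.ofReal_re]

lemma summable_sq_mulVec (hM : Summable fun q : ℕ × κ => ‖M q.1 q.2‖ ^ 2)
    (hr : Summable fun k => ‖r k‖ ^ 2) :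
    Summable fun ν => ‖∑' k, M k ν * r k‖ ^ 2 := by
  refine Summable.of_nonneg_of_le (fun ν => sq_nonneg _) (fun ν => ?_)
    (summable_sq_tsum_norm_mulVec hM hr)
  gcongr
  exact norm_tsum_le_tsum_norm (summable_norm_mulVec hM hr ν)

/-- The finite sections of a nonnegative form. -/
lemma sum_quadForm_nonneg {p p₁ : Matrix ℕ ℕ ℂ}
    (hdom : ∀ v : ℕ →₀ ℂ, 0 ≤ (v.sum fun k a => v.sum fun n b =>
      star a * (p k n - p₁ k n) * b).re) (r : ℕ → ℂ) (N : ℕ) :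
    0 ≤ ∑ q ∈ Finset.range N ×ˢ Finset.range N,
      (r q.1 * p q.1 q.2 * star (r q.2) - r q.1 * p₁ q.1 q.2 * star (r q.2)).re := by
  let c : ℕ → ℂ := fun k => if k < N then star (r k) else 0
  have hc : ∀ k, c k ≠ 0 → k ∈ Finset.range N := fun k hk => by
    rw [Finset.mem_range]
    by_contra hcon
    exact hk (if_neg hcon)
  have hin : ∀ (k : ℕ) (a : ℂ), ((Finsupp.onFinset (Finset.range N) c hc).sum fun n b =>
      star a * (p k n - p₁ k n) * b) =
      ∑ n ∈ Finset.range N, star a * (p k n - p₁ k n) * c n := fun k a =>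
    Finsupp.onFinset_sum (g := fun n b => star a * (p k n - p₁ k n) * b) hc
      (fun n => mul_zero _)
  have hv := hdom (Finsupp.onFinset (Finset.range N) c hc)
  simp only [hin] at hv
  rw [Finsupp.onFinset_sum hc (fun k => by simp)] at hv
  rw [Finset.sum_product]
  refine hv.trans_eq ?_
  rw [Complex.re_sum]
  refine Finset.sum_congr rfl fun k hk => ?_
  rw [Complex.re_sum]
  refine Finset.sum_congr rfl fun n hn => ?_
  simp only [c]
  rw [if_pos (Finset.mem_range.1 hk), if_pos (Finset.mem_range.1 hn), star_star]
  congr 1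
  ring

/-- If `M₁ M₁^* ≤ M M^*`, then `‖M₁ᵀ r‖ ≤ ‖Mᵀ r‖`. -/
lemma tsum_sq_mulVec_le {κ₁ : Type*} {M₁ : Matrix ℕ κ₁ ℂ} {p p₁ : Matrix ℕ ℕ ℂ}
    (hM : Summable fun q : ℕ × κ => ‖M q.1 q.2‖ ^ 2)
    (hM₁ : Summable fun q : ℕ × κ₁ => ‖M₁ q.1 q.2‖ ^ 2)
    (hp : ∀ k n, HasSum (fun μ => M k μ * star (M n μ)) (p k n))
    (hp₁ : ∀ k n, HasSum (fun μ => M₁ k μ * star (M₁ n μ)) (p₁ k n))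
    (hdom : ∀ v : ℕ →₀ ℂ, 0 ≤ (v.sum fun k a => v.sum fun n b =>
      star a * (p k n - p₁ k n) * b).re)
    (hr : Summable fun k => ‖r k‖ ^ 2) :
    ∑' ν, ‖∑' k, M₁ k ν * r k‖ ^ 2 ≤ ∑' ν, ‖∑' k, M k ν * r k‖ ^ 2 := by
  have h := (hasSum_quadForm hM hr hp).sub (hasSum_quadForm hM₁ hr hp₁)
  have hre := Complex.hasSum_re h
  rw [Complex.sub_re, Complex.ofReal_re, Complex.ofReal_re] at hre
  have hsq : Tendsto (fun N : ℕ => Finset.range N ×ˢ Finset.range N) atTop atTop := by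
    have h1 : Tendsto (fun N : ℕ => (Finset.range N, Finset.range N)) atTop atTop := by
      rw [← prod_atTop_atTop_eq]
      exact tendsto_finset_range.prodMk tendsto_finset_range
    exact tendsto_finsetProd_atTop.comp h1
  rw [← sub_nonneg]
  exact ge_of_tendsto' (Tendsto.comp hre hsq) fun N => sum_quadForm_nonneg hdom r N

end Pointwise

/-! ### Families with the same Gram matrix -/

/-- Two families with the same Gram matrix are related by an operator that is isometric on the
closed span of the first one. -/
theorem exists_isometry_of_inner_eq {ι E F : Type*} [NormedAddCommGroup E] [InnerProductSpace ℂ E]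
    [CompleteSpace E] [NormedAddCommGroup F] [InnerProductSpace ℂ F] [CompleteSpace F]
    {x : ι → E} {y : ι → F} (h : ∀ i j, inner ℂ (x i) (x j) = inner ℂ (y i) (y j)) :
    ∃ W : E →L[ℂ] F, (∀ i, W (x i) = y i) ∧
      ∀ e ∈ (Submodule.span ℂ (Set.range x)).topologicalClosure,
      ∀ e' ∈ (Submodule.span ℂ (Set.range x)).topologicalClosure,
        inner ℂ (W e) (W e') = inner ℂ e e' := by
  set K := (Submodule.span ℂ (Set.range x)).topologicalClosure with hK
  have : CompleteSpace K := inferInstanceAs (CompleteSpace (Submodule.topologicalClosure _))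
  let Tx : (ι →₀ ℂ) →ₗ[ℂ] E := Finsupp.linearCombination ℂ x
  let Ty : (ι →₀ ℂ) →ₗ[ℂ] F := Finsupp.linearCombination ℂ y
  have hin : ∀ c c', inner ℂ (Tx c) (Tx c') = inner ℂ (Ty c) (Ty c') := fun c c' => by
    simp only [Tx, Ty, Finsupp.linearCombination_apply, Finsupp.sum, sum_inner, inner_sum,
      inner_smul_left, inner_smul_right, h]
  have hmem : ∀ c, Tx c ∈ K := fun c => Submodule.le_topologicalClosure _ (by
    rw [← Finsupp.range_linearCombination]; exact LinearMap.mem_range_self _ c)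
  let e : (ι →₀ ℂ) →ₗ[ℂ] K := Tx.codRestrict K hmem
  have hnorm : ∀ c, ‖Ty c‖ = ‖e c‖ := fun c => by
    rw [← sq_eq_sq₀ (norm_nonneg _) (norm_nonneg _)]
    have := congrArg Complex.re (hin c c)
    rw [inner_self_eq_norm_sq_to_K, inner_self_eq_norm_sq_to_K] at this
    norm_cast at this
    exact this.symm
  have hdense : DenseRange e := fun z => by
    rw [closure_subtype]
    have h1 : ((↑) : K → E) '' Set.range e = (Submodule.span ℂ (Set.range x) : Set E) := by
      rw [← Finsupp.range_linearCombination, ← Set.range_comp]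
      rfl
    rw [h1]
    exact z.2
  let W₀ : K →L[ℂ] F := Ty.extendOfNorm e
  have hW₀ : ∀ c, W₀ (e c) = Ty c := LinearMap.extendOfNorm_eq hdense ⟨1, fun c => by
    rw [one_mul]; exact (hnorm c).le⟩
  have hW₁ : ∀ z z' : K, inner ℂ (W₀ z) (W₀ z') = inner ℂ z z' := fun z z' => by
    refine hdense.induction_on₂ (p := fun z z' => inner ℂ (W₀ z) (W₀ z') = inner ℂ z z')
      (isClosed_eq (by fun_prop) (by fun_prop)) (fun c c' => ?_) z z'
    rw [hW₀, hW₀, ← hin]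
    rfl
  have hproj : ∀ z : K, K.orthogonalProjectionOnto (z : E) = z :=
    fun z => K.orthogonalProjectionOnto_mem_subspace_eq_self z
  refine ⟨W₀.comp K.orthogonalProjectionOnto, fun i => ?_, fun z hz z' hz' => ?_⟩
  · have h1 := hW₀ (Finsupp.single i 1)
    have h2 : ((e (Finsupp.single i 1) : K) : E) = x i := by
      change Tx (Finsupp.single i 1) = x i
      simp [Tx]
    rw [ContinuousLinearMap.comp_apply, ← h2, hproj, h1]
    simp [Ty]
  · have h1 := hproj ⟨z, hz⟩
    have h2 := hproj ⟨z', hz'⟩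
    simp only at h1 h2
    rw [ContinuousLinearMap.comp_apply, ContinuousLinearMap.comp_apply, h1, h2, hW₁]
    rfl

/-! ### Delayed rows of a factorization -/

lemma lintegral_mul_sq_le {α : Type*} [MeasurableSpace α] {μ : Measure α} {f g : α → ENNReal}
    (hf : AEMeasurable f μ) (hg : AEMeasurable g μ) :
    (∫⁻ x, f x * g x ∂μ) ^ 2 ≤ (∫⁻ x, f x ^ 2 ∂μ) * ∫⁻ x, g x ^ 2 ∂μ := by
  have h := ENNReal.lintegral_mul_le_Lp_mul_Lq μ (p := 2) (q := 2)
    ⟨by norm_num, by norm_num, by norm_num⟩ hf hg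
  have h2 := pow_le_pow_left' h 2
  refine h2.trans_eq ?_
  rw [mul_pow, ← ENNReal.rpow_natCast, ← ENNReal.rpow_natCast, ← ENNReal.rpow_mul,
    ← ENNReal.rpow_mul]
  norm_num

lemma tsum_mul_sq_le_ennreal (f g : ℕ → ENNReal) :
    (∑' k, f k * g k) ^ 2 ≤ (∑' k, f k ^ 2) * ∑' k, g k ^ 2 := by
  simpa only [lintegral_count] using lintegral_mul_sq_le (μ := Measure.count)
    (measurable_of_countable f).aemeasurable (measurable_of_countable g).aemeasurable

lemma summable_sq_of_tsum_ne_top {ι : Type*} {c : ι → ℂ} (h : ∑' i, ‖c i‖ₑ ^ 2 ≠ ⊤) :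
    Summable fun i => ‖c i‖ ^ 2 := by
  simpa using ENNReal.summable_toReal h

lemma enorm_star_complex (z : ℂ) : ‖star z‖ₑ = ‖z‖ₑ := by
  rw [← ofReal_norm, norm_star, ofReal_norm]

lemma tsum_enorm_sq {ι : Type*} {c : ι → ℂ} (h : Summable fun i => ‖c i‖ ^ 2) :
    ∑' i, ‖c i‖ₑ ^ 2 = ENNReal.ofReal (∑' i, ‖c i‖ ^ 2) := by
  rw [ENNReal.ofReal_tsum_of_nonneg (fun i => sq_nonneg _) h]
  refine tsum_congr fun i => ?_
  rw [ENNReal.ofReal_pow (norm_nonneg _), ofReal_norm]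

section Rows

variable {κ : Type*} {x : ℕ → Matrix ℕ κ ℂ}

lemma hasSum_toeplitz_sq (hx : Summable fun q : ℕ × ℕ × κ => ‖x q.1 q.2.1 q.2.2‖ ^ 2)
    (q : ℕ × ℕ) :
    HasSum (fun p : ℕ × κ => ‖toeplitz x p q‖ ^ 2) (∑' p : ℕ × κ, ‖x p.1 q.2 p.2‖ ^ 2) := by
  have h1 : Summable fun p : ℕ × κ => ‖x p.1 q.2 p.2‖ ^ 2 :=
    hx.comp_injective (i := fun p : ℕ × κ => (p.1, q.2, p.2)) fun a b h => by
      simp only [Prod.mk.injEq] at h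
      exact Prod.ext h.1 h.2.2
  have hinj : Function.Injective fun p : ℕ × κ => (q.1 + p.1, p.2) := fun a b h => by
    simp only [Prod.mk.injEq, add_right_inj] at h
    exact Prod.ext h.1 h.2
  refine (hinj.hasSum_iff fun p hp => ?_).1 ?_
  · have : ¬ q.1 ≤ p.1 := fun hle => hp ⟨(p.1 - q.1, p.2), by
      simp only [Nat.add_sub_cancel' hle]⟩
    simp [toeplitz, this]
  · refine h1.hasSum.congr_fun fun p => ?_
    simp [toeplitz]

/-- The row `k` of the coefficients, delayed by `s`, where `q = (s, k)`: the column `q` of the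
matrix `toeplitz x`, as an element of `ℓ²`. -/
noncomputable def delayedRow (hx : Summable fun q : ℕ × ℕ × κ => ‖x q.1 q.2.1 q.2.2‖ ^ 2)
    (q : ℕ × ℕ) : ell2 (ℕ × κ) :=
  ⟨fun p => toeplitz x p q, memℓp_gen (by simpa using (hasSum_toeplitz_sq hx q).summable)⟩

variable (hx : Summable fun q : ℕ × ℕ × κ => ‖x q.1 q.2.1 q.2.2‖ ^ 2)

lemma delayedRow_apply (q : ℕ × ℕ) (p : ℕ × κ) : delayedRow hx q p = toeplitz x p q := rfl

lemma norm_sq_delayedRow (q : ℕ × ℕ) :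
    ‖delayedRow hx q‖ ^ 2 = ∑' p : ℕ × κ, ‖x p.1 q.2 p.2‖ ^ 2 :=
  (hasSum_sq_ell2 (delayedRow hx q)).unique (hasSum_toeplitz_sq hx q)

lemma norm_delayedRow (q : ℕ × ℕ) : ‖delayedRow hx q‖ = ‖delayedRow hx (0, q.2)‖ := by
  rw [← sq_eq_sq₀ (norm_nonneg _) (norm_nonneg _), norm_sq_delayedRow, norm_sq_delayedRow]

lemma summable_norm_sq_delayedRow :
    Summable fun k : ℕ => ‖delayedRow hx (0, k)‖ ^ 2 := by
  simp_rw [norm_sq_delayedRow]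
  let e : ℕ × (ℕ × κ) ≃ ℕ × ℕ × κ :=
    { toFun := fun z => (z.2.1, z.1, z.2.2)
      invFun := fun z => (z.2.1, z.1, z.2.2)
      left_inv := fun _ => rfl
      right_inv := fun _ => rfl }
  exact ((summable_prod_of_nonneg fun q => sq_nonneg _).1 (e.summable_iff.2 hx)).2

end Rows

namespace IsFactorization

variable {κ : Type*} {p : ℝ → Matrix ℕ ℕ ℂ} {X : ℝ → Matrix ℕ κ ℂ} {x : ℕ → Matrix ℕ κ ℂ}

lemma expansion_delayedRow (hX : IsFactorization p X x) (s k : ℕ) (μ : κ) :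
    HasExpansion (fun t => Complex.exp (-(Complex.I * s * t)) * X t k μ)
      (fun l => delayedRow hX.square_summable (s, k) (l, μ)) :=
  (hX.expansion k μ).shift s

lemma lintegral_tsum_sq_row [Countable κ] (hX : IsFactorization p X x) (k : ℕ) :
    ∫⁻ t, ∑' μ, ‖X t k μ‖ₑ ^ 2 ∂μπ =
      ENNReal.ofReal (2 * Real.pi * ‖delayedRow hX.square_summable (0, k)‖ ^ 2) := by
  refine lintegral_tsum_sq (w := delayedRow hX.square_summable (0, k)) fun μ => ?_
  simpa using hX.expansion_delayedRow 0 k μ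

lemma aemeasurable_row [Countable κ] (hX : IsFactorization p X x) (k : ℕ) :
    AEMeasurable (fun t => ∑' μ, ‖X t k μ‖ₑ ^ 2) μπ :=
  AEMeasurable.tsum fun μ => (hX.expansion k μ).1.1.enorm.pow_const 2

lemma lintegral_tsum_sq_ne_top [Countable κ] (hX : IsFactorization p X x) :
    ∫⁻ t, ∑' q : ℕ × κ, ‖X t q.1 q.2‖ₑ ^ 2 ∂μπ ≠ ⊤ := by
  have h1 : ∀ t, ∑' q : ℕ × κ, ‖X t q.1 q.2‖ₑ ^ 2 = ∑' k, ∑' μ, ‖X t k μ‖ₑ ^ 2 := fun t =>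
    ENNReal.tsum_prod (f := fun k μ => ‖X t k μ‖ₑ ^ 2)
  simp_rw [h1]
  rw [lintegral_tsum fun k => hX.aemeasurable_row k]
  simp_rw [hX.lintegral_tsum_sq_row]
  rw [← ENNReal.ofReal_tsum_of_nonneg (fun k => by positivity)
    ((summable_norm_sq_delayedRow hX.square_summable).mul_left _)]
  exact ENNReal.ofReal_ne_top

/-- The factor is a Hilbert–Schmidt matrix almost everywhere. -/
lemma ae_summable [Countable κ] (hX : IsFactorization p X x) :
    ∀ᵐ t ∂μπ, Summable fun q : ℕ × κ => ‖X t q.1 q.2‖ ^ 2 := by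
  have hm : AEMeasurable (fun t => ∑' q : ℕ × κ, ‖X t q.1 q.2‖ₑ ^ 2) μπ :=
    AEMeasurable.tsum fun q => (hX.expansion q.1 q.2).1.1.enorm.pow_const 2
  filter_upwards [ae_lt_top' hm hX.lintegral_tsum_sq_ne_top] with t ht
  exact summable_sq_of_tsum_ne_top ht.ne

lemma integrable [Countable κ] (hX : IsFactorization p X x) (k n : ℕ) :
    Integrable (fun t => p t k n) μπ := by
  have hm : ∀ μ, AEStronglyMeasurable (fun t => X t k μ * star (X t n μ)) μπ := fun μ =>
    ((hX.expansion k μ).integrable_mul_star (hX.expansion n μ)).1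
  have hae : (fun t => p t k n) =ᵐ[μπ] fun t => ∑' μ, X t k μ * star (X t n μ) := by
    filter_upwards [hX.factor] with t ht
    exact (ht k n).tsum_eq.symm
  have hmp : AEStronglyMeasurable (fun t => p t k n) μπ := by
    refine aestronglyMeasurable_of_tendsto_ae (ι := Finset κ) atTop
      (f := fun s t => ∑ μ ∈ s, X t k μ * star (X t n μ))
      (fun s => Finset.aestronglyMeasurable_fun_sum s fun μ _ => hm μ) ?_
    filter_upwards [hX.factor] with t ht
    simpa [HasSum] using ht k n
  refine ⟨hmp, ?_⟩
  have h1 : ∀ᵐ t ∂μπ, ‖p t k n‖ₑ ≤ (∑' μ, ‖X t k μ‖ₑ ^ 2) + ∑' μ, ‖X t n μ‖ₑ ^ 2 := by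
    filter_upwards [hae] with t ht
    rw [ht, ← ENNReal.tsum_add]
    refine enorm_tsum_le_tsum_enorm.trans (ENNReal.tsum_le_tsum fun μ => ?_)
    rw [enorm_mul, enorm_star_complex, sq, sq]
    rcases le_total ‖X t k μ‖ₑ ‖X t n μ‖ₑ with h | h
    · exact (mul_le_mul_left h _).trans le_add_self
    · exact (mul_le_mul_right h _).trans le_self_add
  refine (lintegral_mono_ae h1).trans_lt ?_
  rw [lintegral_add_left' (hX.aemeasurable_row k), hX.lintegral_tsum_sq_row,
    hX.lintegral_tsum_sq_row]
  exact ENNReal.add_lt_top.2 ⟨ENNReal.ofReal_lt_top, ENNReal.ofReal_lt_top⟩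

/-- The Gram matrix of the delayed rows consists of the Fourier coefficients of the density. -/
lemma inner_delayedRow [Countable κ] (hX : IsFactorization p X x) (s k t n : ℕ) :
    inner ℂ (delayedRow hX.square_summable (t, n)) (delayedRow hX.square_summable (s, k)) =
      (1 / (2 * Real.pi) : ℂ) * ∫ y, Complex.exp (-(Complex.I * s * y)) *
        star (Complex.exp (-(Complex.I * t * y))) * p y k n ∂μπ := by
  set u := delayedRow hX.square_summable (s, k)
  set v := delayedRow hX.square_summable (t, n)
  let F : κ → ℝ → ℂ := fun μ y => (Complex.exp (-(Complex.I * s * y)) * X y k μ) *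
    star (Complex.exp (-(Complex.I * t * y)) * X y n μ)
  have hF : ∀ μ y, F μ y = (Complex.exp (-(Complex.I * s * y)) *
      star (Complex.exp (-(Complex.I * t * y)))) * (X y k μ * star (X y n μ)) := fun μ y => by
    simp only [F, star_mul']
    ring
  have h1 : HasSum (fun q : ℕ × κ => u q * star (v q)) (inner ℂ v u) := by
    have := lp.hasSum_inner (𝕜 := ℂ) v u
    simpa only [RCLike.inner_apply, starRingEnd_apply] using this
  have h2 : ∀ μ, HasSum (fun l => u (l, μ) * star (v (l, μ)))
      ((1 / (2 * Real.pi) : ℂ) * ∫ y, F μ y ∂μπ) := fun μ =>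
    (hX.expansion_delayedRow s k μ).hasSum_inner (hX.expansion_delayedRow t n μ)
  have h3 := ((Equiv.prodComm κ ℕ).hasSum_iff.2 h1).prod_fiberwise h2
  have hint : ∀ μ, Integrable (F μ) μπ := fun μ =>
    (hX.expansion_delayedRow s k μ).integrable_mul_star (hX.expansion_delayedRow t n μ)
  have hfin : ∑' μ, ∫⁻ y, ‖F μ y‖ₑ ∂μπ ≠ ⊤ := by
    have : ∀ μ y, ‖F μ y‖ₑ ≤ ‖X y k μ‖ₑ ^ 2 + ‖X y n μ‖ₑ ^ 2 := fun μ y => by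
      have e1 : ∀ (a : ℕ), ‖Complex.exp (-(Complex.I * a * y))‖ₑ = 1 := fun a => by
        rw [← ofReal_norm, HasExpansion.norm_exp_neg, ENNReal.ofReal_one]
      rw [hF, enorm_mul, enorm_mul, enorm_mul, enorm_star_complex, enorm_star_complex, e1, e1, one_mul, one_mul,
        sq, sq]
      rcases le_total ‖X y k μ‖ₑ ‖X y n μ‖ₑ with h | h
      · exact (mul_le_mul_left h _).trans le_add_self
      · exact (mul_le_mul_right h _).trans le_self_add
    refine ne_top_of_le_ne_top ?_ (ENNReal.tsum_le_tsum fun μ => lintegral_mono (this μ))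
    have e2 : ∀ μ, ∫⁻ y, (‖X y k μ‖ₑ ^ 2 + ‖X y n μ‖ₑ ^ 2) ∂μπ =
        ∫⁻ y, ‖X y k μ‖ₑ ^ 2 ∂μπ + ∫⁻ y, ‖X y n μ‖ₑ ^ 2 ∂μπ := fun μ =>
      lintegral_add_left' ((hX.expansion k μ).1.1.enorm.pow_const 2) _
    simp_rw [e2]
    rw [ENNReal.tsum_add, ← lintegral_tsum fun μ => (hX.expansion k μ).1.1.enorm.pow_const 2,
      ← lintegral_tsum fun μ => (hX.expansion n μ).1.1.enorm.pow_const 2,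
      hX.lintegral_tsum_sq_row, hX.lintegral_tsum_sq_row]
    exact ENNReal.add_ne_top.2 ⟨ENNReal.ofReal_ne_top, ENNReal.ofReal_ne_top⟩
  have h4 : ∫ y, ∑' μ, F μ y ∂μπ = ∑' μ, ∫ y, F μ y ∂μπ :=
    integral_tsum (fun μ => (hint μ).1) hfin
  rw [← h3.tsum_eq, tsum_mul_left, ← h4]
  congr 1
  refine integral_congr_ae ?_
  filter_upwards [hX.factor] with y hy
  simp_rw [hF]
  rw [tsum_mul_left, (hy k n).tsum_eq]

end IsFactorization

/-! ### Row vectors multiplied by a factor -/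

/-- The vector polynomial `∑ c_{j,k} e^{-i λ j} δ_k`. -/
noncomputable def pastPoly (c : ℕ × ℕ →₀ ℂ) (x : ℝ) (k : ℕ) : ℂ :=
  c.sum fun q a => if q.2 = k then a * Complex.exp (-(Complex.I * q.1 * x)) else 0

lemma pastPoly_eq_zero (c : ℕ × ℕ →₀ ℂ) (x : ℝ) {k : ℕ} (hk : k ∉ c.support.image Prod.snd) :
    pastPoly c x k = 0 :=
  Finset.sum_eq_zero fun q hq => if_neg fun h => hk (Finset.mem_image.2 ⟨q, hq, h⟩)

lemma summable_sq_pastPoly (c : ℕ × ℕ →₀ ℂ) (x : ℝ) :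
    Summable fun k => ‖pastPoly c x k‖ ^ 2 :=
  summable_of_ne_finset_zero (s := c.support.image Prod.snd) fun k hk => by
    rw [pastPoly_eq_zero c x hk, norm_zero, zero_pow two_ne_zero]

lemma tsum_mul_pastPoly (c : ℕ × ℕ →₀ ℂ) (x : ℝ) (m : ℕ → ℂ) :
    ∑' k, m k * pastPoly c x k =
      c.sum fun q a => a * (Complex.exp (-(Complex.I * q.1 * x)) * m q.2) := by
  have h : ∀ q ∈ c.support, HasSum (fun k => if k = q.2 then
      c q * (Complex.exp (-(Complex.I * q.1 * x)) * m q.2) else 0)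
      (c q * (Complex.exp (-(Complex.I * q.1 * x)) * m q.2)) := fun q _ => hasSum_ite_eq _ _
  refine ((hasSum_sum h).congr_fun fun k => ?_).tsum_eq
  rw [pastPoly, Finsupp.sum, Finset.mul_sum]
  refine Finset.sum_congr rfl fun q _ => ?_
  by_cases hk : q.2 = k
  · rw [if_pos hk, if_pos hk.symm, hk]; ring
  · rw [if_neg hk, if_neg fun e => hk e.symm, mul_zero]

lemma spectralPoly_eq (d τ : ℕ) (c : ℕ × ℕ →₀ ℂ) (x : ℝ) (k : ℕ) :
    spectralPoly d τ (c.mapDomain fun q => (-(q.1 : ℤ), q.2)) x k =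
      incFactor d τ x * pastPoly c x k := by
  rw [spectralPoly, pastPoly, Finsupp.sum_mapDomain_index]
  · congr 1
    refine Finsupp.sum_congr fun q _ => ?_
    congr 3
    push_cast
    ring
  · intro q; simp
  · intro q a b
    split_ifs <;> ring

lemma hasExpansion_exp (j : ℕ) : HasExpansion
    (fun x => Complex.exp (-(Complex.I * j * x))) (fun l => if l = j then 1 else 0) := by
  have hcont : Continuous fun x : ℝ => Complex.exp (-(Complex.I * j * x)) := by fun_prop
  refine ⟨MemLp.of_bound hcont.aestronglyMeasurable 1
    (ae_of_all _ fun x => (HasExpansion.norm_exp_neg j x).le), ?_⟩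
  refine tendsto_const_nhds.congr' ?_
  filter_upwards [eventually_gt_atTop j] with N hN
  have : ∀ x : ℝ, Complex.exp (-(Complex.I * j * x)) - ∑ l ∈ Finset.range N,
      (if l = j then (1 : ℂ) else 0) * Complex.exp (-(Complex.I * l * x)) = 0 := fun x => by
    simp only [ite_mul, one_mul, zero_mul]
    rw [Finset.sum_ite_eq' , if_pos (Finset.mem_range.2 hN), sub_self]
  simp_rw [this]
  simp

lemma hasExpansion_pastPoly (c : ℕ × ℕ →₀ ℂ) (k : ℕ) :
    HasExpansion (fun x => pastPoly c x k) (fun l => c (l, k)) := by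
  have h : HasExpansion (fun x => pastPoly c x k)
      (fun l => ∑ q ∈ c.support, (if q.2 = k then c q else 0) * if l = q.1 then 1 else 0) := by
    refine (HasExpansion.sum c.support fun q _ => (hasExpansion_exp q.1).const_mul
      (if q.2 = k then c q else 0)).congr_ae (ae_of_all _ fun x => ?_)
    refine Finset.sum_congr rfl fun q _ => ?_
    simp only [ite_mul, zero_mul]
  refine h.congr_coeff fun l => ?_
  rw [Finset.sum_eq_single (l, k)]
  · simp
  · intro q _ hq
    by_cases h1 : q.2 = k
    · rw [if_neg (fun h2 => hq (Prod.ext h2.symm h1) : ¬ l = q.1), mul_zero]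
    · rw [if_neg h1, zero_mul]
  · intro hq
    simp [Finsupp.notMem_support_iff.1 hq]

lemma summable_sq_slice {κ : Type*} (ν : κ) (w : ell2 (ℕ × κ)) :
    Summable fun l : ℕ => ‖w (l, ν)‖ ^ 2 :=
  (summable_sq_ell2 w).comp_injective (i := fun l : ℕ => (l, ν)) fun a b h => by simpa using h

/-- The coordinates `w(·, ν)` of an element of `ℓ²(ℕ × κ)`. -/
noncomputable def sliceLin {κ : Type*} (ν : κ) : ell2 (ℕ × κ) →ₗ[ℂ] ell2 ℕ where
  toFun w := ⟨fun l => w (l, ν), memℓp_gen (by simpa using! summable_sq_slice ν w)⟩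
  map_add' _ _ := rfl
  map_smul' _ _ := rfl

lemma norm_sliceLin_le {κ : Type*} (ν : κ) (w : ell2 (ℕ × κ)) : ‖sliceLin ν w‖ ≤ 1 * ‖w‖ := by
  rw [one_mul, ← sq_le_sq₀ (norm_nonneg _) (norm_nonneg _)]
  have h : HasSum (fun l : ℕ => ‖w (l, ν)‖ ^ 2) (‖sliceLin ν w‖ ^ 2) :=
    hasSum_sq_ell2 (sliceLin ν w)
  rw [← h.tsum_eq, ← (hasSum_sq_ell2 w).tsum_eq]
  exact (summable_sq_slice ν w).tsum_le_tsum_of_inj (fun l : ℕ => (l, ν))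
    (fun a b h => by simpa using h) (fun _ _ => sq_nonneg _) (fun _ => le_rfl)
    (summable_sq_ell2 w)

/-- The continuous version of `sliceLin`. -/
noncomputable def slice {κ : Type*} (ν : κ) : ell2 (ℕ × κ) →L[ℂ] ell2 ℕ :=
  (sliceLin ν).mkContinuous 1 (norm_sliceLin_le ν)

/-- Vector functions with square summable coefficients take values in `ℓ²` almost everywhere. -/
lemma ae_summable_sq_of_expansion {κ : Type*} [Countable κ] {r : ℝ → κ → ℂ} {ρ : ell2 (ℕ × κ)}
    (hr : ∀ k, HasExpansion (fun x => r x k) fun l => ρ (l, k)) :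
    ∀ᵐ x ∂μπ, Summable fun k => ‖r x k‖ ^ 2 := by
  have hm : AEMeasurable (fun x => ∑' k, ‖r x k‖ₑ ^ 2) μπ :=
    AEMeasurable.tsum fun k => (hr k).1.1.enorm.pow_const 2
  filter_upwards [ae_lt_top' hm ((lintegral_tsum_sq hr).trans_ne ENNReal.ofReal_ne_top)] with x hx
  exact summable_sq_of_tsum_ne_top hx.ne

namespace IsFactorization

variable {κ : Type*} {p : ℝ → Matrix ℕ ℕ ℂ} {X : ℝ → Matrix ℕ κ ℂ}
  {x : ℕ → Matrix ℕ κ ℂ}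

lemma expansion_pastPoly (hX : IsFactorization p X x) (c : ℕ × ℕ →₀ ℂ) (ν : κ) :
    HasExpansion (fun t => ∑' k, X t k ν * pastPoly c t k)
      (fun l => (c.sum fun q a => a • delayedRow hX.square_summable q : ell2 (ℕ × κ)) (l, ν)) := by
  have h := HasExpansion.sum c.support fun q _ =>
    (hX.expansion_delayedRow q.1 q.2 ν).const_mul (c q)
  refine (h.congr_ae (ae_of_all _ fun t => tsum_mul_pastPoly c t fun k => X t k ν)).congr_coeff
    fun l => ?_
  rw [Finsupp.sum, lp.coeFn_sum, Finset.sum_apply]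
  rfl

/-- If `Xᵀ r` has the coefficients `w`, then approximation of `r` by a polynomial in `L₂(X X^*)` is
approximation of `w` by a combination of delayed rows in `ℓ²`. -/
lemma lintegral_sub_pastPoly [Countable κ] (hX : IsFactorization p X x) {r : ℝ → ℕ → ℂ} {w : ell2 (ℕ × κ)}
    (hr : ∀ᵐ t ∂μπ, Summable fun k => ‖r t k‖ ^ 2)
    (hw : ∀ ν, HasExpansion (fun t => ∑' k, X t k ν * r t k) fun l => w (l, ν))
    (c : ℕ × ℕ →₀ ℂ) :
    ∫⁻ t, ∑' ν, ‖∑' k, X t k ν * (r t k - pastPoly c t k)‖ₑ ^ 2 ∂μπ = ENNReal.ofReal (2 * Real.pi *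
      ‖w - c.sum fun q a => a • delayedRow hX.square_summable q‖ ^ 2) := by
  refine lintegral_tsum_sq fun ν => ?_
  refine ((hw ν).sub (hX.expansion_pastPoly c ν)).congr_ae ?_
  filter_upwards [hr, hX.ae_summable] with t h1 h2
  rw [← (summable_norm_mulVec h2 h1 ν).of_norm.tsum_sub
    (summable_norm_mulVec h2 (summable_sq_pastPoly c t) ν).of_norm]
  exact tsum_congr fun k => mul_sub _ _ _

/-- If `r = ∑ ρ_{j,k} e^{-i λ j} δ_k` and the series `∑ ρ_{j,k} x_{j,k}` of delayed rows converges
in `ℓ²`, then its sum is the coefficient vector of `Xᵀ r`. -/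
lemma expansion_mulVec [Countable κ] (hX : IsFactorization p X x) {r : ℝ → ℕ → ℂ} {ρ : ell2 (ℕ × ℕ)}
    {z : ell2 (ℕ × κ)} (hr : ∀ k, HasExpansion (fun t => r t k) fun l => ρ (l, k))
    (hz : HasSum (fun q => ρ q • delayedRow hX.square_summable q) z) (ν : κ) :
    HasExpansion (fun t => ∑' k, X t k ν * r t k) fun l => z (l, ν) := by
  classical
  let c : Finset (ℕ × ℕ) → (ℕ × ℕ →₀ ℂ) := fun s => ∑ q ∈ s, Finsupp.single q (ρ q)
  have hcs : ∀ s, (c s).sum (fun q a => a • delayedRow hX.square_summable q) =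
      ∑ q ∈ s, ρ q • delayedRow hX.square_summable q := fun s => by
    rw [← Finsupp.linearCombination_apply, map_sum]
    simp only [Finsupp.linearCombination_single]
  have hc : ∀ s q, (c s) q = (∑ q ∈ s, lp.single 2 q (ρ q) : ell2 (ℕ × ℕ)) q := fun s q => by
    rw [lp.coeFn_sum, Finset.sum_apply, Finsupp.finsetSum_apply]
    refine Finset.sum_congr rfl fun q' _ => ?_
    rw [lp.single_apply, Finsupp.single_apply, Pi.single_apply]
    by_cases h : q' = q
    · simp [h]
    · rw [if_neg h, if_neg fun e => h e.symm]
  -- the polynomials converge to `r` in `L²`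
  have hR : Tendsto (fun s => ∫⁻ t, ∑' k, ‖r t k - pastPoly (c s) t k‖ₑ ^ 2 ∂μπ) atTop (𝓝 0) := by
    have h1 : ∀ s, ∫⁻ t, ∑' k, ‖r t k - pastPoly (c s) t k‖ₑ ^ 2 ∂μπ = ENNReal.ofReal
        (2 * Real.pi * ‖ρ - ∑ q ∈ s, lp.single 2 q (ρ q)‖ ^ 2) := fun s => by
      refine lintegral_tsum_sq fun k => ?_
      refine ((hr k).sub (hasExpansion_pastPoly (c s) k)).congr_coeff fun l => ?_
      rw [hc, lp.coeFn_sub, Pi.sub_apply]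
    simp_rw [h1]
    have h2 : HasSum (fun q => lp.single 2 q (ρ q)) ρ := lp.hasSum_single (by norm_num) ρ
    have h3 : Tendsto (fun s : Finset (ℕ × ℕ) =>
        2 * Real.pi * ‖ρ - ∑ q ∈ s, lp.single 2 q (ρ q)‖ ^ 2) atTop
        (𝓝 (2 * Real.pi * ‖ρ - ρ‖ ^ 2)) := by
      have h4 : Tendsto (fun s : Finset (ℕ × ℕ) => ∑ q ∈ s, lp.single 2 q (ρ q)) atTop (𝓝 ρ) := by
        simpa [HasSum] using h2
      exact ((tendsto_const_nhds.sub h4).norm.pow 2).const_mul _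
    have h5 := ENNReal.tendsto_ofReal h3
    simpa using h5
  have hrs := ae_summable_sq_of_expansion hr
  have hmX : AEMeasurable (fun t => ∑' k, ‖X t k ν‖ₑ ^ 2) μπ :=
    AEMeasurable.tsum fun k => (hX.expansion k ν).1.1.enorm.pow_const 2
  have hXfin : ∫⁻ t, ∑' k, ‖X t k ν‖ₑ ^ 2 ∂μπ ≠ ⊤ := by
    refine ne_top_of_le_ne_top hX.lintegral_tsum_sq_ne_top (lintegral_mono fun t => ?_)
    exact ENNReal.tsum_comp_le_tsum_of_injective
      (f := fun k : ℕ => (k, ν)) (fun a b h => by simpa using h) fun q => ‖X t q.1 q.2‖ₑ ^ 2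
  -- hence the products converge in `L¹`
  have hL1 : Tendsto (fun s => eLpNorm ((fun t => ∑' k, X t k ν * pastPoly (c s) t k) -
      fun t => ∑' k, X t k ν * r t k) 1 μπ) atTop (𝓝 0) := by
    have hb : ∀ s, eLpNorm ((fun t => ∑' k, X t k ν * pastPoly (c s) t k) -
        fun t => ∑' k, X t k ν * r t k) 1 μπ ^ 2 ≤ (∫⁻ t, ∑' k, ‖X t k ν‖ₑ ^ 2 ∂μπ) *
          ∫⁻ t, ∑' k, ‖r t k - pastPoly (c s) t k‖ₑ ^ 2 ∂μπ := fun s => by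
      have hmR : AEMeasurable (fun t => ∑' k, ‖r t k - pastPoly (c s) t k‖ₑ ^ 2) μπ :=
        AEMeasurable.tsum fun k =>
          ((hr k).sub (hasExpansion_pastPoly (c s) k)).1.1.enorm.pow_const 2
      have h1 := lintegral_mul_sq_le (μ := μπ) (hmX.pow_const (1 / 2 : ℝ))
        (hmR.pow_const (1 / 2 : ℝ))
      have e : ∀ y : ENNReal, (y ^ (1 / 2 : ℝ)) ^ 2 = y := fun y => by
        rw [← ENNReal.rpow_natCast, ← ENNReal.rpow_mul]; norm_num
      simp_rw [e] at h1
      refine le_trans ?_ h1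
      rw [eLpNorm_one_eq_lintegral_enorm]
      gcongr 1
      refine lintegral_mono_ae ?_
      filter_upwards [hrs, hX.ae_summable] with t h3 h2
      rw [Pi.sub_apply, ← enorm_neg, neg_sub,
        ← (summable_norm_mulVec h2 h3 ν).of_norm.tsum_sub
        (summable_norm_mulVec h2 (summable_sq_pastPoly (c s) t) ν).of_norm]
      simp_rw [← mul_sub]
      refine enorm_tsum_le_tsum_enorm.trans ?_
      simp_rw [enorm_mul]
      rw [← ENNReal.pow_le_pow_left_iff two_ne_zero, mul_pow, e, e]
      exact tsum_mul_sq_le_ennreal _ _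
    have h2 : Tendsto (fun s => eLpNorm ((fun t => ∑' k, X t k ν * pastPoly (c s) t k) -
      fun t => ∑' k, X t k ν * r t k) 1 μπ ^ 2) atTop (𝓝 0) := by
      refine tendsto_of_tendsto_of_tendsto_of_le_of_le tendsto_const_nhds ?_ (fun _ => zero_le)
        hb
      simpa using ENNReal.Tendsto.const_mul hR (Or.inr hXfin)
    have h3 := ((ENNReal.continuous_rpow_const (y := 1 / 2)).tendsto 0).comp h2
    rw [ENNReal.zero_rpow_of_pos (by norm_num)] at h3
    refine h3.congr fun s => ?_
    rw [Function.comp_apply, ← ENNReal.rpow_natCast, ← ENNReal.rpow_mul]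
    norm_num
  have hmeas : ∀ s, AEStronglyMeasurable (fun t => ∑' k, X t k ν * pastPoly (c s) t k) μπ :=
    fun s => (hX.expansion_pastPoly (c s) ν).1.1
  have hmeas' : AEStronglyMeasurable (fun t => ∑' k, X t k ν * r t k) μπ := by
    refine aestronglyMeasurable_of_tendsto_ae atTop
      (f := fun N t => ∑ k ∈ Finset.range N, X t k ν * r t k)
      (fun N => Finset.aestronglyMeasurable_fun_sum _ fun k _ =>
        (hX.expansion k ν).1.1.mul (hr k).1.1) ?_
    filter_upwards [hrs, hX.ae_summable] with t h3 h2
    exact (summable_norm_mulVec h2 h3 ν).of_norm.hasSum.tendsto_sum_nat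
  have hw : Tendsto (fun s => slice ν (∑ q ∈ s, ρ q • delayedRow hX.square_summable q)) atTop
      (𝓝 (slice ν z)) := by
    have h4 : Tendsto (fun s : Finset (ℕ × ℕ) =>
        ∑ q ∈ s, ρ q • delayedRow hX.square_summable q) atTop (𝓝 z) := by
      simpa [HasSum] using hz
    exact ((slice ν).continuous.tendsto z).comp h4
  refine HasExpansion.of_tendsto (w₀ := slice ν z) (fun s => ?_) hw
    (tendstoInMeasure_of_tendsto_eLpNorm one_ne_zero hmeas hmeas' hL1)
  have := hX.expansion_pastPoly (c s) ν
  rw [hcs] at this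
  exact this

end IsFactorization

/-! ### Spectral characteristics and innovations -/

lemma hasSum_delayedRow_of_bounded {κ : Type*} {x : ℕ → Matrix ℕ κ ℂ}
    (hx : Summable fun q : ℕ × ℕ × κ => ‖x q.1 q.2.1 q.2.2‖ ^ 2)
    {L : ell2 (ℕ × ℕ) →L[ℂ] ell2 (ℕ × κ)}
    (hL : ∀ v i, HasSum (fun j => toeplitz x i j * v j) (L v i)) (ρ : ell2 (ℕ × ℕ)) :
    HasSum (fun q => ρ q • delayedRow hx q) (L ρ) := by
  classical
  have h1 : HasSum (fun q => L (lp.single 2 q (ρ q))) (L ρ) :=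
    (lp.hasSum_single (by norm_num) ρ).mapL L
  refine h1.congr_fun fun q => ?_
  refine lp.ext (funext fun i => ?_)
  have h2 : HasSum (fun j => toeplitz x i j * (lp.single 2 q (ρ q) : ell2 (ℕ × ℕ)) j)
      (toeplitz x i q * ρ q) := by
    convert hasSum_single (f := fun j => toeplitz x i j *
      (lp.single 2 q (ρ q) : ell2 (ℕ × ℕ)) j) q fun j hj => ?_ using 1
    · rw [lp.single_apply_self]
    · rw [lp.single_apply_ne _ _ _ hj, mul_zero]
  rw [(hL _ i).unique h2, lp.coeFn_smul, Pi.smul_apply, delayedRow_apply, smul_eq_mul, mul_comm]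

lemma summable_sq_sub {ι : Type*} {u v : ι → ℂ} (hu : Summable fun i => ‖u i‖ ^ 2)
    (hv : Summable fun i => ‖v i‖ ^ 2) : Summable fun i => ‖u i - v i‖ ^ 2 := by
  obtain ⟨u', hu'⟩ := exists_ell2 hu
  obtain ⟨v', hv'⟩ := exists_ell2 hv
  refine (summable_sq_ell2 (u' - v')).congr fun i => ?_
  rw [lp.coeFn_sub, Pi.sub_apply, hu', hv']

lemma incFactor_mul_star (d τ : ℕ) (x : ℝ) :
    incFactor d τ x * star (incFactor d τ x) =
      ((‖1 - Complex.exp (Complex.I * x * τ)‖ ^ (2 * d) / x ^ (2 * d) : ℝ) : ℂ) := by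
  have h : star (1 - Complex.exp (-(Complex.I * x * τ))) = 1 - Complex.exp (Complex.I * x * τ) := by
    rw [← starRingEnd_apply, map_sub, map_one, ← Complex.exp_conj]
    simp
  rw [← h, norm_star, ← starRingEnd_apply, Complex.mul_conj', incFactor, norm_div, norm_pow,
    norm_pow, norm_mul, Complex.norm_I, one_mul, Complex.norm_real, Real.norm_eq_abs]
  have hx : |x| ^ (d * 2) = x ^ (d * 2) := (even_two.mul_left d).pow_abs x
  rw [← Complex.ofReal_pow]
  congr 1
  rw [div_pow, ← pow_mul, ← pow_mul, hx, mul_comm d 2]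

lemma quadForm_incFactor_mul (d τ : ℕ) (F : ℝ → Matrix ℕ ℕ ℂ) (x : ℝ) (s : ℕ → ℂ) :
    quadForm (F x) (fun k => incFactor d τ x * s k) = quadForm (stepDensity d τ F x) s := by
  unfold quadForm
  congr 1
  refine tsum_congr fun q => ?_
  have : stepDensity d τ F x q.1 q.2 = incFactor d τ x * star (incFactor d τ x) * F x q.1 q.2 := by
    rw [incFactor_mul_star]
    rfl
  rw [this, star_mul']
  ring

lemma exists_tendsto_sum_of_mem_closure {ι E : Type*} [NormedAddCommGroup E] [NormedSpace ℂ E]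
    {x : ι → E} {w : E} (hw : w ∈ (Submodule.span ℂ (Set.range x)).topologicalClosure) :
    ∃ c : ℕ → (ι →₀ ℂ), Tendsto (fun N => (c N).sum fun i a => a • x i) atTop (𝓝 w) := by
  obtain ⟨y, hy, hlim⟩ := mem_closure_iff_seq_limit.1 hw
  choose c hc using fun N => Finsupp.mem_span_range_iff_exists_finsupp.1 (hy N)
  exact ⟨c, by simpa only [hc] using hlim⟩

/-- If `Xᵀ r` has coefficients `w`, then `(1 - e^{-i λ τ})^d (i λ)^{-d} r` is the spectral
characteristic of the element with coordinates `w`. -/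
theorem isSpectralCharacteristic_of_expansion {H κ : Type*} [NormedAddCommGroup H]
    [NormedSpace ℂ H] [Countable κ] {d τ : ℕ} {F : ℝ → Matrix ℕ ℕ ℂ} {X : ℝ → Matrix ℕ κ ℂ}
    {x : ℕ → Matrix ℕ κ ℂ} (hX : IsFactorization (stepDensity d τ F) X x) {ζ : ℤ → ℕ → H}
    {V : ell2 (ℕ × κ) →L[ℂ] H}
    (hV : ∀ q, V (delayedRow hX.square_summable q) = ζ (-(q.1 : ℤ)) q.2) {w : ell2 (ℕ × κ)}
    (hwmem : w ∈ (Submodule.span ℂ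
      (Set.range (delayedRow hX.square_summable))).topologicalClosure)
    {r : ℝ → ℕ → ℂ} (hrm : ∀ k, AEStronglyMeasurable (fun t => r t k) μπ)
    (hr : ∀ᵐ t ∂μπ, Summable fun k => ‖r t k‖ ^ 2)
    (hw : ∀ ν, HasExpansion (fun t => ∑' k, X t k ν * r t k) fun l => w (l, ν)) :
    IsSpectralCharacteristic d τ F ζ (fun t k => incFactor d τ t * r t k) (V w) := by
  have hinc : Measurable (incFactor d τ) := by unfold incFactor; fun_prop
  refine ⟨fun k => hinc.aestronglyMeasurable.mul (hrm k), ?_, ?_⟩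
  · filter_upwards [hr] with t ht
    simp_rw [norm_mul, mul_pow]
    exact ht.mul_left _
  obtain ⟨c, hc⟩ := exists_tendsto_sum_of_mem_closure hwmem
  refine ⟨fun N => (c N).mapDomain fun q => (-(q.1 : ℤ), q.2), ?_, ?_⟩
  · have h1 : ∀ N, ∫⁻ t in Set.Ioc (-Real.pi) Real.pi, ENNReal.ofReal (quadForm (F t) fun k =>
        incFactor d τ t * r t k -
          spectralPoly d τ ((c N).mapDomain fun q => (-(q.1 : ℤ), q.2)) t k) =
        ENNReal.ofReal (2 * Real.pi *
          ‖w - (c N).sum fun q a => a • delayedRow hX.square_summable q‖ ^ 2) := fun N => by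
      rw [← hX.lintegral_sub_pastPoly hr hw]
      refine lintegral_congr_ae ?_
      filter_upwards [hr, hX.ae_summable, hX.factor] with t h1 h2 h3
      have h4 := summable_sq_sub h1 (summable_sq_pastPoly (c N) t)
      simp_rw [spectralPoly_eq, ← mul_sub]
      rw [quadForm_incFactor_mul, quadForm_eq h2 h4 h3, tsum_enorm_sq (summable_sq_mulVec h2 h4)]
    simp_rw [h1]
    have h2 := (((tendsto_const_nhds (x := w)).sub hc).norm.pow 2).const_mul (2 * Real.pi)
    simpa using ENNReal.tendsto_ofReal h2
  · have h1 := (V.continuous.tendsto w).comp hc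
    refine h1.congr fun N => ?_
    have h2 := Finsupp.sum_mapDomain_index (s := c N) (f := fun q : ℕ × ℕ => (-(q.1 : ℤ), q.2))
      (h := fun q a => a • ζ q.1 q.2) (fun _ => zero_smul _ _) (fun _ _ _ => add_smul _ _ _)
    refine Eq.trans ?_ h2.symm
    rw [Function.comp_apply, map_finsuppSum]
    refine Finsupp.sum_congr fun q _ => ?_
    rw [map_smul, hV]

/-- The delayed rows of a canonical factorization have dense span. -/
lemma IsCanonicalFactorization.mem_closure {κ : Type*} {p : ℝ → Matrix ℕ ℕ ℂ}
    {X : ℝ → Matrix ℕ κ ℂ} {x : ℕ → Matrix ℕ κ ℂ} (hX : IsCanonicalFactorization p X x)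
    (w : ell2 (ℕ × κ)) : w ∈ (Submodule.span ℂ
      (Set.range (delayedRow hX.square_summable))).topologicalClosure := by
  have h : {v : ell2 (ℕ × κ) | ∃ s k : ℕ, ∀ (l : ℕ) (μ : κ),
      v (l, μ) = if s ≤ l then x (l - s) k μ else 0} =
      Set.range (delayedRow hX.square_summable) := by
    ext v
    constructor
    · rintro ⟨s, k, h⟩
      exact ⟨(s, k), lp.ext (funext fun q => (h q.1 q.2).symm)⟩
    · rintro ⟨⟨s, k⟩, rfl⟩
      exact ⟨s, k, fun l μ => rfl⟩
  rw [← h, hX.canonical]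
  trivial

lemma hasExpansion_single {κ : Type*} [DecidableEq κ] (m : ℕ) (μ ν : κ) :
    HasExpansion (fun t => Complex.exp (-(Complex.I * m * t)) * (1 : Matrix κ κ ℂ) μ ν)
      (fun l => (lp.single 2 (m, μ) (1 : ℂ) : ell2 (ℕ × κ)) (l, ν)) := by
  have h := (hasExpansion_exp m).const_mul ((1 : Matrix κ κ ℂ) μ ν)
  refine (h.congr_ae (ae_of_all _ fun t => mul_comm _ _)).congr_coeff fun l => ?_
  rw [lp.single_apply, Pi.single_apply, Matrix.one_apply]
  by_cases h1 : μ = ν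
  · by_cases h2 : l = m
    · simp [h1, h2]
    · simp [h2]
  · have : ¬ ν = μ := fun e => h1 e.symm
    simp [h1, this]

/-- The coefficients of `e^{-i λ m} Ψ_μ`. -/
lemma IsInverseFactor.exists_shift {κ : Type*} {Θ : ℝ → Matrix ℕ κ ℂ} {Ψ : ℝ → Matrix κ ℕ ℂ}
    {ψ : ℕ → Matrix κ ℕ ℂ} (hΨ : IsInverseFactor Θ Ψ ψ) (m : ℕ) (μ : κ) :
    ∃ ρ : ell2 (ℕ × ℕ), ∀ q : ℕ × ℕ, ρ q = if m ≤ q.1 then ψ (q.1 - m) μ q.2 else 0 := by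
  refine exists_ell2 ?_
  have hinj : Function.Injective fun p : ℕ × ℕ => (m + p.1, p.2) := fun a b h => by
    simp only [Prod.mk.injEq, add_right_inj] at h
    exact Prod.ext h.1 h.2
  refine (hinj.summable_iff fun p hp => ?_).1 ?_
  · have : ¬ m ≤ p.1 := fun hle => hp ⟨(p.1 - m, p.2), by
      simp only [Nat.add_sub_cancel' hle]⟩
    simp [this]
  · refine (hΨ.square_summable μ).congr fun p => ?_
    simp

open Classical in
/-- The coordinates of the innovations. If `ζ = X + Y` with `Y` orthogonal to `X` and to `B`, then
the innovation `V δ_{m,μ}`, formally `∑ ψ_{μk}(j) ζ_k(-m-j)`, can be replaced by the convergent series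
`∑ ψ_{μk}(j) X_k(-m-j)` in inner products with `B`: both are limits of the same combinations of the
`ζ` and of the `X`, since `‖Φᵀ r‖ ≤ ‖Θᵀ r‖` for all `r`. -/
theorem hasSum_inner_innovation {H κ κ₁ : Type*} [NormedAddCommGroup H] [InnerProductSpace ℂ H]
    [CompleteSpace H] [Countable κ] [Countable κ₁]
    {X Y ζ : ℤ → ℕ → H} (hζ : ∀ j k, ζ j k = X j k + Y j k) {B : H}
    (hYB : ∀ j k, inner ℂ (Y j k) B = 0)
    {p p₁ : ℝ → Matrix ℕ ℕ ℂ} {Θ : ℝ → Matrix ℕ κ ℂ} {θ : ℕ → Matrix ℕ κ ℂ}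
    (hΘ : IsCanonicalFactorization p Θ θ) {Ψ : ℝ → Matrix κ ℕ ℂ} {ψ : ℕ → Matrix κ ℕ ℂ}
    (hΨ : IsInverseFactor Θ Ψ ψ) {Φ : ℝ → Matrix ℕ κ₁ ℂ} {φ : ℕ → Matrix ℕ κ₁ ℂ}
    (hΦ : IsFactorization p₁ Φ φ) {L : ell2 (ℕ × ℕ) →L[ℂ] ell2 (ℕ × κ₁)}
    (hL : ∀ v i, HasSum (fun j => toeplitz φ i j * v j) (L v i))
    (hdom : ∀ᵐ t ∂μπ, ∀ v : ℕ →₀ ℂ, 0 ≤ (v.sum fun k a => v.sum fun n b =>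
      star a * (p t k n - p₁ t k n) * b).re)
    {V : ell2 (ℕ × κ) →L[ℂ] H}
    (hV : ∀ q, V (delayedRow hΘ.square_summable q) = ζ (-(q.1 : ℤ)) q.2)
    {W : ell2 (ℕ × κ₁) →L[ℂ] H}
    (hW : ∀ q, W (delayedRow hΦ.square_summable q) = X (-(q.1 : ℤ)) q.2) (m : ℕ) (μ : κ) :
    HasSum (fun q : ℕ × ℕ => star (ψ q.1 μ q.2) * inner ℂ (X (-((q.1 + m : ℕ) : ℤ)) q.2) B)
      (inner ℂ (V (lp.single 2 (m, μ) 1)) B) := by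
  set δ : ell2 (ℕ × κ) := lp.single 2 (m, μ) 1
  obtain ⟨c, hc⟩ := exists_tendsto_sum_of_mem_closure (hΘ.mem_closure δ)
  obtain ⟨ρ, hρ⟩ := hΨ.exists_shift m μ
  let r : ℝ → ℕ → ℂ := fun t k => Complex.exp (-(Complex.I * m * t)) * Ψ t μ k
  have hr : ∀ k, HasExpansion (fun t => r t k) fun l => ρ (l, k) := fun k =>
    ((hΨ.expansion μ k).shift m).congr_coeff fun l => (hρ (l, k)).symm
  have hrs := ae_summable_sq_of_expansion hr
  have hΘr : ∀ ν, HasExpansion (fun t => ∑' k, Θ t k ν * r t k) fun l => δ (l, ν) := fun ν => by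
    refine (hasExpansion_single m μ ν).congr_ae ?_
    filter_upwards [hΨ.mul_eq_one] with t ht
    refine (((ht μ ν).mul_left (Complex.exp (-(Complex.I * m * t)))).congr_fun fun k => ?_).tsum_eq
    simp only [r]
    ring
  have hz := hasSum_delayedRow_of_bounded hΦ.square_summable hL ρ
  have hΦr := hΦ.expansion_mulVec hr hz
  -- the combinations that approximate the innovation also converge when `ζ` is replaced by `X`
  have hcΦ : Tendsto (fun N => (c N).sum fun q a => a • delayedRow hΦ.square_summable q) atTop
      (𝓝 (L ρ)) := by
    have h1 : ∀ N, ‖L ρ - (c N).sum fun q a => a • delayedRow hΦ.square_summable q‖ ≤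
        ‖δ - (c N).sum fun q a => a • delayedRow hΘ.square_summable q‖ := fun N => by
      have h2 : ENNReal.ofReal (2 * Real.pi *
          ‖L ρ - (c N).sum fun q a => a • delayedRow hΦ.square_summable q‖ ^ 2) ≤
          ENNReal.ofReal (2 * Real.pi *
          ‖δ - (c N).sum fun q a => a • delayedRow hΘ.square_summable q‖ ^ 2) := by
        rw [← hΦ.lintegral_sub_pastPoly hrs hΦr,
          ← hΘ.toIsFactorization.lintegral_sub_pastPoly hrs hΘr]
        refine lintegral_mono_ae ?_
        filter_upwards [hrs, hΦ.ae_summable, hΘ.toIsFactorization.ae_summable, hΦ.factor,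
          hΘ.factor, hdom] with t h1 h2 h3 h4 h5 h6
        have h7 := summable_sq_sub h1 (summable_sq_pastPoly (c N) t)
        rw [tsum_enorm_sq (summable_sq_mulVec h2 h7), tsum_enorm_sq (summable_sq_mulVec h3 h7)]
        exact ENNReal.ofReal_le_ofReal (tsum_sq_mulVec_le h3 h2 h5 h4 h6 h7)
      rw [ENNReal.ofReal_le_ofReal_iff (by positivity)] at h2
      have h3 := le_of_mul_le_mul_left h2 Real.two_pi_pos
      exact (sq_le_sq₀ (norm_nonneg _) (norm_nonneg _)).1 h3
    rw [tendsto_iff_norm_sub_tendsto_zero]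
    have h2 := ((tendsto_const_nhds (x := δ)).sub hc).norm
    rw [sub_self, norm_zero] at h2
    refine squeeze_zero (fun _ => norm_nonneg _) (fun N => ?_) h2
    rw [norm_sub_rev]
    exact h1 N
  have h1 : Tendsto (fun N => inner ℂ (V ((c N).sum fun q a =>
      a • delayedRow hΘ.square_summable q)) B) atTop (𝓝 (inner ℂ (V δ) B)) :=
    ((V.continuous.tendsto δ).comp hc).inner tendsto_const_nhds
  have h2 : Tendsto (fun N => inner ℂ (W ((c N).sum fun q a =>
      a • delayedRow hΦ.square_summable q)) B) atTop (𝓝 (inner ℂ (W (L ρ)) B)) :=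
    ((W.continuous.tendsto (L ρ)).comp hcΦ).inner tendsto_const_nhds
  have h3 : inner ℂ (V δ) B = inner ℂ (W (L ρ)) B := by
    refine tendsto_nhds_unique h1 (h2.congr fun N => ?_)
    simp only [Finsupp.sum, map_sum, map_smul, hV, hW, hζ, sum_inner, inner_smul_left,
      inner_add_left, hYB, add_zero]
  have h4 : HasSum (fun q => star (ρ q) * inner ℂ (X (-(q.1 : ℤ)) q.2) B)
      (inner ℂ (W (L ρ)) B) := by
    have h5 := ((hz.mapL W).mapL (innerSL ℂ B)).star
    have h6 : ∀ v : H, star (innerSL ℂ B v) = inner ℂ v B := fun v => by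
      rw [innerSL_apply_apply, ← starRingEnd_apply, inner_conj_symm]
    simp only [h6] at h5
    refine h5.congr_fun fun q => ?_
    rw [map_smul, hW, inner_smul_left, starRingEnd_apply]
  rw [h3]
  have hinj : Function.Injective fun q : ℕ × ℕ => (q.1 + m, q.2) := fun a b h => by
    simp only [Prod.mk.injEq, add_left_inj] at h
    exact Prod.ext h.1 h.2
  refine ((hinj.hasSum_iff fun q hq => ?_).2 h4).congr_fun fun q => ?_
  · have : ¬ m ≤ q.1 := fun hle => hq ⟨(q.1 - m, q.2), by
      simp only [Nat.sub_add_cancel hle]⟩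
    simp [hρ, this]
  · simp [hρ]

/-! ### The projection on the past -/

/-- The space of observations is the image of `ℓ²` under the isometry that takes the delayed rows of
a canonical factorization to the observations. -/
lemma exists_synthesis {H κ : Type*} [NormedAddCommGroup H] [InnerProductSpace ℂ H]
    [CompleteSpace H] {p : ℝ → Matrix ℕ ℕ ℂ} {Θ : ℝ → Matrix ℕ κ ℂ} {θ : ℕ → Matrix ℕ κ ℂ}
    (hΘ : IsCanonicalFactorization p Θ θ) {ζ : ℤ → ℕ → H}
    (hgram : ∀ q q' : ℕ × ℕ, inner ℂ (delayedRow hΘ.square_summable q)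
      (delayedRow hΘ.square_summable q') = inner ℂ (ζ (-(q.1 : ℤ)) q.2) (ζ (-(q'.1 : ℤ)) q'.2)) :
    ∃ V : ell2 (ℕ × κ) →L[ℂ] H,
      (∀ q, V (delayedRow hΘ.square_summable q) = ζ (-(q.1 : ℤ)) q.2) ∧
      ∀ e e', inner ℂ (V e) (V e') = inner ℂ e e' := by
  obtain ⟨V, hV, hiso⟩ := exists_isometry_of_inner_eq
    (y := fun q : ℕ × ℕ => ζ (-(q.1 : ℤ)) q.2) hgram
  exact ⟨V, hV, fun e e' => hiso e (hΘ.mem_closure e) e' (hΘ.mem_closure e')⟩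

lemma mem_pastSpace {H : Type*} [NormedAddCommGroup H] [NormedSpace ℂ H] (ζ : ℤ → ℕ → H)
    (j k : ℕ) : ζ (-(j : ℤ)) k ∈ pastSpace ζ :=
  Submodule.le_topologicalClosure _ (Submodule.subset_span ⟨-(j : ℤ), k, by omega, rfl⟩)

lemma hasSum_mem_of_isClosed {ι H : Type*} [NormedAddCommGroup H] [NormedSpace ℂ H]
    {K : Submodule ℂ H} (hK : IsClosed (K : Set H)) {u : ι → H} {s : H} (h : HasSum u s)
    (hu : ∀ i, u i ∈ K) : s ∈ K :=
  hK.mem_of_tendsto h (Eventually.of_forall fun _ => K.sum_mem fun i _ => hu i)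

lemma isClosed_pastSpace {H : Type*} [NormedAddCommGroup H] [NormedSpace ℂ H] (ζ : ℤ → ℕ → H) :
    IsClosed (pastSpace ζ : Set H) :=
  Submodule.isClosed_topologicalClosure _

lemma synthesis_mem_pastSpace {H κ : Type*} [NormedAddCommGroup H] [NormedSpace ℂ H]
    {p : ℝ → Matrix ℕ ℕ ℂ} {Θ : ℝ → Matrix ℕ κ ℂ} {θ : ℕ → Matrix ℕ κ ℂ}
    (hΘ : IsCanonicalFactorization p Θ θ) {ζ : ℤ → ℕ → H} {V : ell2 (ℕ × κ) →L[ℂ] H}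
    (hV : ∀ q, V (delayedRow hΘ.square_summable q) = ζ (-(q.1 : ℤ)) q.2) (w : ell2 (ℕ × κ)) :
    V w ∈ pastSpace ζ := by
  obtain ⟨c, hc⟩ := exists_tendsto_sum_of_mem_closure (hΘ.mem_closure w)
  refine (isClosed_pastSpace ζ).mem_of_tendsto ((V.continuous.tendsto w).comp hc)
    (Eventually.of_forall fun N => ?_)
  rw [Function.comp_apply, Finsupp.sum, map_sum]
  refine Submodule.sum_mem _ fun q _ => ?_
  rw [map_smul, hV]
  exact Submodule.smul_mem _ _ (mem_pastSpace ζ q.1 q.2)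

/-- The projection on the past is `V V^*`. -/
lemma starProjection_pastSpace {H κ : Type*} [NormedAddCommGroup H] [InnerProductSpace ℂ H]
    [CompleteSpace H] {p : ℝ → Matrix ℕ ℕ ℂ} {Θ : ℝ → Matrix ℕ κ ℂ} {θ : ℕ → Matrix ℕ κ ℂ}
    (hΘ : IsCanonicalFactorization p Θ θ) {ζ : ℤ → ℕ → H} {V : ell2 (ℕ × κ) →L[ℂ] H}
    (hV : ∀ q, V (delayedRow hΘ.square_summable q) = ζ (-(q.1 : ℤ)) q.2)
    (hiso : ∀ e e', inner ℂ (V e) (V e') = inner ℂ e e') (B : H) :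
    (pastSpace ζ).starProjection B = V (V.adjoint B) := by
  refine Submodule.eq_starProjection_of_mem_orthogonal
    (synthesis_mem_pastSpace hΘ hV _) ?_
  rw [pastSpace, Submodule.orthogonal_closure]
  have hle : Submodule.span ℂ {v | ∃ (j : ℤ) (k : ℕ), j ≤ 0 ∧ v = ζ j k} ≤
      (Submodule.span ℂ {B - V (V.adjoint B)})ᗮ := by
    rw [Submodule.span_le]
    rintro v ⟨j, k, hj, rfl⟩
    obtain ⟨n, rfl⟩ : ∃ n : ℕ, j = -(n : ℤ) := ⟨j.natAbs, by omega⟩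
    rw [SetLike.mem_coe, Submodule.mem_orthogonal_singleton_iff_inner_left, ← hV (n, k),
      inner_sub_right, hiso, ContinuousLinearMap.adjoint_inner_right, sub_self]
  have h1 := Submodule.orthogonal_le hle
  exact h1 (Submodule.le_orthogonal_orthogonal _ (Submodule.mem_span_singleton_self _))

lemma norm_sub_sq_synthesis {H E : Type*} [NormedAddCommGroup H] [InnerProductSpace ℂ H]
    [CompleteSpace H] [NormedAddCommGroup E] [InnerProductSpace ℂ E] [CompleteSpace E]
    {V : E →L[ℂ] H} (hiso : ∀ e e', inner ℂ (V e) (V e') = inner ℂ e e') (B : H) :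
    ‖B - V (V.adjoint B)‖ ^ 2 = ‖B‖ ^ 2 - ‖V.adjoint B‖ ^ 2 := by
  have h1 : inner ℂ (V (V.adjoint B)) (B - V (V.adjoint B)) = 0 := by
    rw [inner_sub_right, hiso, ContinuousLinearMap.adjoint_inner_right, sub_self]
  have h2 := norm_add_sq_eq_norm_sq_add_norm_sq_of_inner_eq_zero _ _ h1
  have h3 : ‖V (V.adjoint B)‖ = ‖V.adjoint B‖ := by
    rw [← sq_eq_sq₀ (norm_nonneg _) (norm_nonneg _)]
    have := congrArg Complex.re (hiso (V.adjoint B) (V.adjoint B))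
    rw [inner_self_eq_norm_sq_to_K, inner_self_eq_norm_sq_to_K] at this
    norm_cast at this
  rw [add_sub_cancel, h3] at h2
  linarith

/-- The estimate of a functional `B = ∑ b_{j,k} X_k(-j)` from observations `ζ = X + Y` with `Y`
orthogonal to `X`: convergence of the series, the coordinates of the projection with respect to the
innovations, and the mean square error. -/
theorem projection_of_signal {H κ κ₁ : Type*} [NormedAddCommGroup H] [InnerProductSpace ℂ H]
    [CompleteSpace H] [Countable κ] [Countable κ₁]
    {X Y ζ : ℤ → ℕ → H} (hζ : ∀ j k, ζ j k = X j k + Y j k)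
    (hYX : ∀ j k l n, inner ℂ (Y j k) (X l n) = 0)
    {p p₁ : ℝ → Matrix ℕ ℕ ℂ} {Θ : ℝ → Matrix ℕ κ ℂ} {θ : ℕ → Matrix ℕ κ ℂ}
    (hΘ : IsCanonicalFactorization p Θ θ) {Ψ : ℝ → Matrix κ ℕ ℂ} {ψ : ℕ → Matrix κ ℕ ℂ}
    (hΨ : IsInverseFactor Θ Ψ ψ) {Φ : ℝ → Matrix ℕ κ₁ ℂ} {φ : ℕ → Matrix ℕ κ₁ ℂ}
    (hΦ : IsFactorization p₁ Φ φ) (hbdd : IsL2Bounded (toeplitz φ))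
    (hdom : ∀ᵐ t ∂μπ, ∀ v : ℕ →₀ ℂ, 0 ≤ (v.sum fun k a => v.sum fun n b =>
      star a * (p t k n - p₁ t k n) * b).re)
    {V : ell2 (ℕ × κ) →L[ℂ] H}
    (hV : ∀ q, V (delayedRow hΘ.square_summable q) = ζ (-(q.1 : ℤ)) q.2)
    (hiso : ∀ e e', inner ℂ (V e) (V e') = inner ℂ e e')
    (hgram : ∀ q q' : ℕ × ℕ, inner ℂ (delayedRow hΦ.square_summable q)
      (delayedRow hΦ.square_summable q') = inner ℂ (X (-(q.1 : ℤ)) q.2) (X (-(q'.1 : ℤ)) q'.2))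
    {b : ℕ × ℕ → ℂ} (hb : Summable fun q => ‖b q‖ ^ 2) {B : H}
    (hB : HasSum (fun q => b q • X (-(q.1 : ℤ)) q.2) B) :
    (∀ p, Summable fun q => toeplitz φ p q * b q) ∧
    (Summable fun p => ‖infMulVec (toeplitz φ) b p‖ ^ 2) ∧
    (∀ m k, HasSum (fun p : ℕ × κ₁ => star (φ p.1 k p.2) *
      infMulVec (toeplitz φ) b (p.1 + m, p.2)) (cVec φ b (m, k))) ∧
    (∀ (m : ℕ) (μ : κ), Summable fun q : ℕ × ℕ =>
      star (ψ q.1 μ q.2) * cVec φ b (q.1 + m, q.2)) ∧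
    (∃ w : ell2 (ℕ × κ), (∀ p, w p = psiC ψ (cVec φ b) p) ∧
      (pastSpace ζ).starProjection B = V w) ∧
    ‖B - (pastSpace ζ).starProjection B‖ ^ 2 =
      sqNorm (infMulVec (toeplitz φ) b) - sqNorm (psiC ψ (cVec φ b)) := by
  classical
  obtain ⟨L, hL⟩ := hbdd
  obtain ⟨β, hβ⟩ := exists_ell2 hb
  obtain ⟨W, hW, hWiso⟩ := exists_isometry_of_inner_eq
    (y := fun q : ℕ × ℕ => X (-(q.1 : ℤ)) q.2) hgram
  have hLb : ∀ p, HasSum (fun q => toeplitz φ p q * b q) (L β p) := fun p => by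
    simpa only [hβ] using hL β p
  have hLb' : infMulVec (toeplitz φ) b = fun p => L β p := funext fun p => (hLb p).tsum_eq
  have hz := hasSum_delayedRow_of_bounded hΦ.square_summable hL β
  have hBW : B = W (L β) := by
    refine hB.unique ((hz.mapL W).congr_fun fun q => ?_)
    rw [map_smul, hW, hβ]
  have hrow : ∀ q, delayedRow hΦ.square_summable q ∈
      (Submodule.span ℂ (Set.range (delayedRow hΦ.square_summable))).topologicalClosure :=
    fun q => Submodule.le_topologicalClosure _ (Submodule.subset_span ⟨q, rfl⟩)
  have hLmem : L β ∈
      (Submodule.span ℂ (Set.range (delayedRow hΦ.square_summable))).topologicalClosure :=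
    hasSum_mem_of_isClosed (Submodule.isClosed_topologicalClosure _) hz
      fun q => Submodule.smul_mem _ _ (hrow q)
  have hYB : ∀ j k, inner ℂ (Y j k) B = 0 := fun j k => by
    refine (hB.mapL (innerSL ℂ (Y j k))).unique (hasSum_zero.congr_fun fun q => ?_)
    rw [innerSL_apply_apply, inner_smul_right, hYX, mul_zero]
  have hcsum : ∀ q : ℕ × ℕ, HasSum (fun p => star (toeplitz φ p q) * L β p)
      (inner ℂ (X (-(q.1 : ℤ)) q.2) B) := fun q => by
    have h1 := lp.hasSum_inner (𝕜 := ℂ) (delayedRow hΦ.square_summable q) (L β)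
    rw [← hWiso _ (hrow q) _ hLmem, hW, ← hBW] at h1
    refine h1.congr_fun fun p => ?_
    rw [RCLike.inner_apply, delayedRow_apply, starRingEnd_apply, mul_comm]
  have hc : ∀ q : ℕ × ℕ, cVec φ b q = inner ℂ (X (-(q.1 : ℤ)) q.2) B := fun q => by
    rw [cVec, hLb']
    exact (hcsum q).tsum_eq
  have hinn : ∀ (m : ℕ) (μ : κ), HasSum (fun q : ℕ × ℕ =>
      star (ψ q.1 μ q.2) * cVec φ b (q.1 + m, q.2))
      (inner ℂ (V (lp.single 2 (m, μ) 1)) B) := fun m μ => by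
    have := hasSum_inner_innovation hζ hYB hΘ hΨ hΦ hL hdom hV hW m μ
    simpa only [hc] using this
  have hw : ∀ q, V.adjoint B q = psiC ψ (cVec φ b) q := fun q => by
    have h1 : inner ℂ (lp.single 2 q (1 : ℂ) : ell2 (ℕ × κ)) (V.adjoint B) = V.adjoint B q := by
      rw [lp.inner_single_left]; simp
    rw [← h1, ContinuousLinearMap.adjoint_inner_right]
    exact (hinn q.1 q.2).tsum_eq.symm
  have hproj := starProjection_pastSpace hΘ hV hiso B
  refine ⟨fun p => (hLb p).summable, ?_, ?_, fun m μ => (hinn m μ).summable,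
    ⟨V.adjoint B, hw, hproj⟩, ?_⟩
  · rw [hLb']
    exact summable_sq_ell2 (L β)
  · intro m k
    rw [hc, hLb']
    have hinj : Function.Injective fun q : ℕ × κ₁ => (q.1 + m, q.2) := fun a b h => by
      simp only [Prod.mk.injEq, add_left_inj] at h
      exact Prod.ext h.1 h.2
    refine ((hinj.hasSum_iff fun q hq => ?_).2 (hcsum (m, k))).congr_fun fun q => ?_
    · have : ¬ m ≤ q.1 := fun hle => hq ⟨(q.1 - m, q.2), by
        simp only [Nat.sub_add_cancel hle]⟩
      simp [toeplitz, this]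
    · simp [toeplitz]
  · have h1 : ‖B‖ ^ 2 = ‖L β‖ ^ 2 := by
      have := congrArg Complex.re (hWiso _ hLmem _ hLmem)
      rw [← hBW, inner_self_eq_norm_sq_to_K, inner_self_eq_norm_sq_to_K] at this
      norm_cast at this
    rw [hproj, norm_sub_sq_synthesis hiso, h1, sqNorm, sqNorm, hLb',
      ← (hasSum_sq_ell2 (L β)).tsum_eq, ← (hasSum_sq_ell2 (V.adjoint B)).tsum_eq]
    simp only [hw]

/-! ### Coordinates of vector functions -/

/-- The vector function `r` belongs to `L₂(X X^*)`, and `w` are the coefficients of `Xᵀ r`. -/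
structure HasCoordinates {κ : Type*} (X : ℝ → Matrix ℕ κ ℂ) (r : ℝ → ℕ → ℂ) (w : ell2 (ℕ × κ)) :
    Prop where
  measurable : ∀ k, AEStronglyMeasurable (fun t => r t k) μπ
  ae_summable : ∀ᵐ t ∂μπ, Summable fun k => ‖r t k‖ ^ 2
  expansion : ∀ ν, HasExpansion (fun t => ∑' k, X t k ν * r t k) fun l => w (l, ν)

namespace HasCoordinates

variable {κ : Type*} {X : ℝ → Matrix ℕ κ ℂ} {r r' : ℝ → ℕ → ℂ} {w w' : ell2 (ℕ × κ)}

lemma const_mul (h : HasCoordinates X r w) (a : ℂ) :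
    HasCoordinates X (fun t k => a * r t k) (a • w) where
  measurable k := (h.measurable k).const_mul a
  ae_summable := by
    filter_upwards [h.ae_summable] with t ht
    simp_rw [norm_mul, mul_pow]
    exact ht.mul_left _
  expansion ν := by
    refine ((h.expansion ν).const_mul a).congr_ae (ae_of_all _ fun t => ?_)
    simp only
    rw [← tsum_mul_left]
    exact tsum_congr fun k => by ring

lemma sub [Countable κ] {p : ℝ → Matrix ℕ ℕ ℂ} {x : ℕ → Matrix ℕ κ ℂ}
    (hX : IsFactorization p X x) (h : HasCoordinates X r w) (h' : HasCoordinates X r' w') :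
    HasCoordinates X (fun t k => r t k - r' t k) (w - w') where
  measurable k := (h.measurable k).sub (h'.measurable k)
  ae_summable := by
    filter_upwards [h.ae_summable, h'.ae_summable] with t h1 h2
    exact summable_sq_sub h1 h2
  expansion ν := by
    refine ((h.expansion ν).sub (h'.expansion ν)).congr_ae ?_
    filter_upwards [h.ae_summable, h'.ae_summable, hX.ae_summable] with t h1 h2 h3
    rw [← (summable_norm_mulVec h3 h1 ν).of_norm.tsum_sub (summable_norm_mulVec h3 h2 ν).of_norm]
    exact tsum_congr fun k => mul_sub _ _ _

lemma congr (h : HasCoordinates X r w) (e : ∀ t k, r' t k = r t k) : HasCoordinates X r' w := by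
  rwa [show r' = r from funext fun t => funext (e t)]

lemma zero : HasCoordinates X (fun _ _ => 0) (0 : ell2 (ℕ × κ)) where
  measurable _ := aestronglyMeasurable_const
  ae_summable := ae_of_all _ fun t => by simp
  expansion ν := by simpa using HasExpansion.zero

lemma sum [Countable κ] {p : ℝ → Matrix ℕ ℕ ℂ} {x : ℕ → Matrix ℕ κ ℂ}
    (hX : IsFactorization p X x) {ι : Type*} (s : Finset ι) {u : ι → ℝ → ℕ → ℂ}
    {v : ι → ell2 (ℕ × κ)} (h : ∀ i, HasCoordinates X (u i) (v i)) :
    HasCoordinates X (fun t k => ∑ i ∈ s, u i t k) (∑ i ∈ s, v i) := by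
  classical
  induction s using Finset.induction_on with
  | empty => simpa using zero
  | insert i s hi ih =>
    have h1 := (h i).sub hX (ih.const_mul (-1))
    rw [neg_one_smul, sub_neg_eq_add] at h1
    rw [Finset.sum_insert hi]
    refine h1.congr fun t k => ?_
    rw [Finset.sum_insert hi]
    ring

theorem isSpectralCharacteristic [Countable κ] {H : Type*} [NormedAddCommGroup H]
    [NormedSpace ℂ H] {d τ : ℕ} {F : ℝ → Matrix ℕ ℕ ℂ} {x : ℕ → Matrix ℕ κ ℂ}
    (hX : IsCanonicalFactorization (stepDensity d τ F) X x) {ζ : ℤ → ℕ → H}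
    {V : ell2 (ℕ × κ) →L[ℂ] H}
    (hV : ∀ q, V (delayedRow hX.square_summable q) = ζ (-(q.1 : ℤ)) q.2)
    (h : HasCoordinates X r w) :
    IsSpectralCharacteristic d τ F ζ (fun t k => incFactor d τ t * r t k) (V w) :=
  isSpectralCharacteristic_of_expansion hX.toIsFactorization hV (hX.mem_closure w)
    h.measurable h.ae_summable h.expansion

end HasCoordinates

open Classical in
/-- The part of `w` with index `μ` in the second variable. -/
lemma exists_part {κ : Type*} (w : ell2 (ℕ × κ)) (μ : κ) :
    ∃ v : ell2 (ℕ × κ), ∀ l ν, v (l, ν) = if ν = μ then w (l, μ) else 0 := by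
  obtain ⟨v, hv⟩ := exists_ell2 (c := fun q : ℕ × κ => if q.2 = μ then w (q.1, μ) else 0) (by
    refine Summable.of_nonneg_of_le (fun _ => sq_nonneg _) (fun q => ?_) (summable_sq_ell2 w)
    by_cases h : q.2 = μ
    · rw [if_pos h, ← h]
    · rw [if_neg h, norm_zero, zero_pow two_ne_zero]
      exact sq_nonneg _)
  exact ⟨v, fun l ν => hv (l, ν)⟩

open Classical in
lemma hasSum_part {κ : Type*} (w : ell2 (ℕ × κ)) {v : κ → ell2 (ℕ × κ)}
    (hv : ∀ μ l ν, v μ (l, ν) = if ν = μ then w (l, μ) else 0) : HasSum v w := by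
  have h1 : HasSum (fun q => lp.single 2 q (w q)) w := lp.hasSum_single (by norm_num) w
  refine ((Equiv.prodComm κ ℕ).hasSum_iff.2 h1).prod_fiberwise fun μ => ?_
  have h2 : HasSum (fun q => lp.single 2 q (v μ q)) (v μ) := lp.hasSum_single (by norm_num) _
  have hinj : Function.Injective fun l : ℕ => (l, μ) := fun a b h => by simpa using h
  refine ((hinj.hasSum_iff fun q hq => ?_).2 h2).congr_fun fun l => ?_
  · have : q.2 ≠ μ := fun h => hq ⟨q.1, by simp [← h]⟩
    rw [show q = (q.1, q.2) from rfl, hv, if_neg this, lp.single_zero]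
  · simp [hv]

/-- The vector functions `Ψ_μ C_μ`, where `C` has coefficients `w`, have the parts of `w` as their
coordinates. -/
theorem exists_hasCoordinates {κ : Type*} {Θ : ℝ → Matrix ℕ κ ℂ} {Ψ : ℝ → Matrix κ ℕ ℂ}
    {ψ : ℕ → Matrix κ ℕ ℂ} (hΨ : IsInverseFactor Θ Ψ ψ) (w : ell2 (ℕ × κ)) :
    ∃ (C : ℝ → κ → ℂ) (v : κ → ell2 (ℕ × κ)),
      (∀ μ, HasExpansion (fun t => C t μ) fun l => w (l, μ)) ∧ HasSum v w ∧
      ∀ μ, HasCoordinates Θ (fun t k => Ψ t μ k * C t μ) (v μ) := by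
  classical
  choose v hv using exists_part w
  choose C hC using fun μ => HasExpansion.exists_of_summable (summable_sq_slice μ w)
  refine ⟨fun t μ => C μ t, v, hC, hasSum_part w hv, fun μ => ⟨fun k => ?_, ?_, fun ν => ?_⟩⟩
  · exact (hΨ.expansion μ k).1.1.mul (hC μ).1.1
  · obtain ⟨ρ, hρ⟩ := exists_ell2 (hΨ.square_summable μ)
    have h1 : ∀ k, HasExpansion (fun t => Ψ t μ k) fun l => ρ (l, k) := fun k =>
      (hΨ.expansion μ k).congr_coeff fun l => (hρ (l, k)).symm
    filter_upwards [ae_summable_sq_of_expansion h1] with t ht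
    simp_rw [norm_mul, mul_pow]
    exact ht.mul_right _
  · have h1 := (hC μ).const_mul ((1 : Matrix κ κ ℂ) μ ν)
    refine (h1.congr_ae ?_).congr_coeff fun l => ?_
    · filter_upwards [hΨ.mul_eq_one] with t ht
      refine (((ht μ ν).mul_right (C μ t)).congr_fun fun k => ?_).tsum_eq
      ring
    · rw [hv, Matrix.one_apply]
      by_cases h : μ = ν
      · simp [h]
      · rw [if_neg h, if_neg fun e => h e.symm, zero_mul]

/-! ### Absolutely summable coefficients -/

lemma sq_blockNorm (b : ℕ × ℕ → ℂ) (j : ℕ) : blockNorm b j ^ 2 = ∑' k, ‖b (j, k)‖ ^ 2 :=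
  Real.sq_sqrt (tsum_nonneg fun _ => sq_nonneg _)

lemma blockNorm_nonneg (b : ℕ × ℕ → ℂ) (j : ℕ) : 0 ≤ blockNorm b j := Real.sqrt_nonneg _

lemma summable_sq_of_blockNorm {b : ℕ × ℕ → ℂ} (hbk : ∀ j, Summable fun k => ‖b (j, k)‖ ^ 2)
    (hbs : Summable fun j => blockNorm b j) : Summable fun q => ‖b q‖ ^ 2 := by
  refine (summable_prod_of_nonneg fun q => sq_nonneg _).2 ⟨hbk, ?_⟩
  simp_rw [← sq_blockNorm]
  simp_rw [sq]
  have hz := hbs.tendsto_atTop_zero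
  refine Summable.of_norm_bounded_eventually_nat hbs ?_
  filter_upwards [hz.eventually (gt_mem_nhds zero_lt_one)] with j hj
  rw [Real.norm_of_nonneg (mul_self_nonneg _)]
  exact mul_le_of_le_one_left (blockNorm_nonneg b j) hj.le

lemma norm_le_blockNorm {b : ℕ × ℕ → ℂ} (hbk : ∀ j, Summable fun k => ‖b (j, k)‖ ^ 2) (j k : ℕ) :
    ‖b (j, k)‖ ≤ blockNorm b j :=
  Real.le_sqrt_of_sq_le ((hbk j).le_tsum k fun _ _ => sq_nonneg _)

lemma summable_norm_of_blockNorm {b : ℕ × ℕ → ℂ} (hbk : ∀ j, Summable fun k => ‖b (j, k)‖ ^ 2)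
    (hbs : Summable fun j => blockNorm b j) (k : ℕ) : Summable fun j => ‖b (j, k)‖ :=
  Summable.of_nonneg_of_le (fun _ => norm_nonneg _) (fun j => norm_le_blockNorm hbk j k) hbs

/-- Absolute convergence of `∑ b_{j,k} x_{j,k}` for vectors with `∑_k sup_j ‖x_{j,k}‖² < ∞`. -/
lemma summable_smul_of_blockNorm {b : ℕ × ℕ → ℂ} (hbk : ∀ j, Summable fun k => ‖b (j, k)‖ ^ 2)
    (hbs : Summable fun j => blockNorm b j) {E : Type*} [NormedAddCommGroup E] [NormedSpace ℂ E]
    [CompleteSpace E] {x : ℕ × ℕ → E} {y : ℕ → ℝ} (hy : Summable fun k => y k ^ 2)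
    (hxy : ∀ q, ‖x q‖ ≤ y q.2) : Summable fun q => b q • x q := by
  have hy0 : ∀ k, 0 ≤ y k := fun k => (norm_nonneg _).trans (hxy (0, k))
  have h0 : ∀ q : ℕ × ℕ, 0 ≤ ‖b q‖ * y q.2 := fun q => mul_nonneg (norm_nonneg _) (hy0 _)
  have h1 : ∀ j, Summable fun k => ‖b (j, k)‖ * y k := fun j => summable_mul_of_sq (hbk j) hy
  have h2 : Summable fun q : ℕ × ℕ => ‖b q‖ * y q.2 := by
    refine (summable_prod_of_nonneg h0).2 ⟨h1, ?_⟩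
    refine Summable.of_nonneg_of_le (fun j => tsum_nonneg fun k => h0 (j, k)) (fun j => ?_)
      (hbs.mul_right (Real.sqrt (∑' k, y k ^ 2)))
    rw [blockNorm, ← Real.sqrt_mul (tsum_nonneg fun _ => sq_nonneg _)]
    exact Real.le_sqrt_of_sq_le (tsum_mul_sq_le (hbk j) hy)
  refine Summable.of_norm_bounded h2 fun q => ?_
  rw [norm_smul]
  exact mul_le_mul_of_nonneg_left (hxy q) (norm_nonneg _)

lemma summable_bSeries {b : ℕ × ℕ → ℂ} (hbk : ∀ j, Summable fun k => ‖b (j, k)‖ ^ 2)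
    (hbs : Summable fun j => blockNorm b j) (x : ℝ) (k : ℕ) :
    Summable fun j : ℕ => b (j, k) * Complex.exp (-(Complex.I * j * x)) := by
  refine Summable.of_norm_bounded (summable_norm_of_blockNorm hbk hbs k) fun j => ?_
  rw [norm_mul, HasExpansion.norm_exp_neg, mul_one]

/-- An absolutely convergent trigonometric series is the expansion of its sum. -/
lemma hasExpansion_tsum {c : ℕ → ℂ} (hc : Summable fun j => ‖c j‖)
    (hc2 : Summable fun j => ‖c j‖ ^ 2) :
    HasExpansion (fun x => ∑' j : ℕ, c j * Complex.exp (-(Complex.I * j * x))) c := by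
  classical
  obtain ⟨w, hw⟩ := exists_ell2 hc2
  have h1 : HasSum (fun j => lp.single 2 j (w j)) w := lp.hasSum_single (by norm_num) w
  have h2 : ∀ N : ℕ, HasExpansion
      (fun x => ∑ j ∈ Finset.range N, c j * Complex.exp (-(Complex.I * j * x)))
      ((∑ j ∈ Finset.range N, lp.single 2 j (w j) : ell2 ℕ)) := fun N => by
    refine (HasExpansion.sum (Finset.range N) fun j _ =>
      (hasExpansion_exp j).const_mul (c j)).congr_coeff fun l => ?_
    rw [lp.coeFn_sum, Finset.sum_apply]
    refine Finset.sum_congr rfl fun j _ => ?_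
    rw [lp.single_apply, Pi.single_apply, ← hw]
    by_cases h : l = j
    · simp [h]
    · simp [h]
  refine (HasExpansion.of_tendsto h2 h1.tendsto_sum_nat ?_).congr_coeff hw
  refine tendstoInMeasure_of_tendsto_ae (fun N => (h2 N).1.1) (ae_of_all _ fun x => ?_)
  have h3 : Summable fun j : ℕ => c j * Complex.exp (-(Complex.I * j * x)) := by
    refine Summable.of_norm_bounded hc fun j => ?_
    rw [norm_mul, HasExpansion.norm_exp_neg, mul_one]
  exact h3.hasSum.tendsto_sum_nat

/-- The coordinates of `B_τ(e^{-i λ})`. -/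
theorem hasCoordinates_bSeries {κ : Type*} [Countable κ] {p : ℝ → Matrix ℕ ℕ ℂ}
    {X : ℝ → Matrix ℕ κ ℂ} {x : ℕ → Matrix ℕ κ ℂ} (hX : IsFactorization p X x)
    {b : ℕ × ℕ → ℂ} (hbk : ∀ j, Summable fun k => ‖b (j, k)‖ ^ 2)
    (hbs : Summable fun j => blockNorm b j) :
    ∃ w : ell2 (ℕ × κ), HasSum (fun q => b q • delayedRow hX.square_summable q) w ∧
      HasCoordinates X (fun t k => bSeries b t k) w := by
  obtain ⟨ρ, hρ⟩ := exists_ell2 (summable_sq_of_blockNorm hbk hbs)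
  have h1 := (summable_smul_of_blockNorm hbk hbs (x := delayedRow hX.square_summable)
    (summable_norm_sq_delayedRow hX.square_summable) fun q => (norm_delayedRow _ q).le).hasSum
  have h2 : ∀ k, HasExpansion (fun t => bSeries b t k) fun l => ρ (l, k) := fun k =>
    (hasExpansion_tsum (summable_norm_of_blockNorm hbk hbs k)
      ((summable_sq_slice k ρ).congr fun j => by rw [hρ])).congr_coeff fun l => (hρ (l, k)).symm
  refine ⟨_, h1, fun k => (h2 k).1.1, ae_summable_sq_of_expansion h2,
    hX.expansion_mulVec h2 ?_⟩
  simpa only [hρ] using h1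

/-! ### The spectral representation of the generated sequences -/

section Stationary

variable {Ω : Type*} [MeasurableSpace Ω] {P : Measure Ω}

lemma cov_eq_inner (X Y : Lp ℂ 2 P) : cov X Y = inner ℂ Y X := by
  rw [cov, L2.inner_def]
  rfl

lemma mse_eq_norm_sq (X Y : Lp ℂ 2 P) : mse X Y = ‖X - Y‖ ^ 2 := by
  have h : (inner ℂ (X - Y) (X - Y) : ℂ) = ((mse X Y : ℝ) : ℂ) := by
    rw [L2.inner_def, mse, ← integral_complex_ofReal]
    refine integral_congr_ae (ae_of_all _ fun ω => ?_)
    simp only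
    rw [inner_self_eq_norm_sq_to_K]
    norm_cast
  rw [inner_self_eq_norm_sq_to_K] at h
  exact Complex.ofReal_injective 
    (by simpa using h.symm : ((mse X Y : ℝ) : ℂ) = ((‖X - Y‖ ^ 2 : ℝ) : ℂ))

lemma inner_integral_eq_zero {α : Type*} [MeasurableSpace α] {μ : Measure α} {H : Type*}
    [NormedAddCommGroup H] [InnerProductSpace ℂ H] [CompleteSpace H] {u : α → H} {y : H}
    (h : ∀ t, inner ℂ y (u t) = 0) : inner ℂ y (∫ t, u t ∂μ) = 0 := by
  by_cases hu : Integrable u μ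
  · rw [← integral_inner hu]
    simp [h]
  · rw [integral_undef hu, inner_zero_right]

/-- Uncorrelated increments generate uncorrelated sequences. -/
lemma inner_genSeq_eq_zero {T : ℝ} {d : ℕ} {ξ η : ℝ → Lp ℂ 2 P} {τ : ℤ}
    (h : ∀ t s : ℝ, cov (incr d ξ t (τ * T)) (incr d η s (τ * T)) = 0) (j k l n) :
    inner ℂ (genSeq T d η τ j k) (genSeq T d ξ τ l n) = 0 := by
  simp only [genSeq, intervalIntegral]
  have h1 : ∀ t s : ℝ, inner ℂ (incr d η s (τ * T)) (incr d ξ t (τ * T)) = 0 := fun t s => by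
    rw [← cov_eq_inner, h]
  have h2 : ∀ (x y : ℝ) (s : ℝ), inner ℂ (incr d η s (τ * T))
      (∫ u in Set.Ioc x y, star (basisFun T n u) • incr d ξ (l * T - u) (τ * T)) = 0 :=
    fun x y s => inner_integral_eq_zero fun t => by rw [inner_smul_right, h1, mul_zero]
  have h3 : ∀ (x y : ℝ) (v : Lp ℂ 2 P), (∀ s : ℝ, inner ℂ (incr d η s (τ * T)) v = 0) →
      inner ℂ (∫ u in Set.Ioc x y, star (basisFun T k u) • incr d η (j * T - u) (τ * T)) v = 0 :=
    fun x y v hv => by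
    have h := inner_integral_eq_zero (y := v) (μ := volume.restrict (Set.Ioc x y))
      (u := fun u => star (basisFun T k u) • incr d η (j * T - u) (τ * T)) fun t => by
        rw [inner_smul_right, ← inner_conj_symm, hv, map_zero, mul_zero]
    exact (inner_conj_symm _ _).symm.trans ((congrArg (starRingEnd ℂ) h).trans (map_zero _))
  have h4 : ∀ s : ℝ, inner ℂ (incr d η s (τ * T))
      ((∫ u in Set.Ioc 0 T, star (basisFun T n u) • incr d ξ (l * T - u) (τ * T)) -
        ∫ u in Set.Ioc T 0, star (basisFun T n u) • incr d ξ (l * T - u) (τ * T)) = 0 := fun s => by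
    rw [inner_sub_right, h2, h2, sub_zero]
  rw [inner_sub_left, h3 _ _ _ h4, h3 _ _ _ h4, sub_zero]

lemma stepDensity_apply (d τ : ℕ) (f : ℝ → Matrix ℕ ℕ ℂ) (x : ℝ) (k n : ℕ) :
    stepDensity d τ f x k n =
      ((‖1 - Complex.exp (Complex.I * x * τ)‖ ^ (2 * d) / x ^ (2 * d) : ℝ) : ℂ) * f x k n := rfl

lemma stepDensity_add (d τ : ℕ) (f g : ℝ → Matrix ℕ ℕ ℂ) (x : ℝ) (k n : ℕ) :
    stepDensity d τ (fun x => f x + g x) x k n =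
      stepDensity d τ f x k n + stepDensity d τ g x k n := by
  simp only [stepDensity_apply, Matrix.add_apply, mul_add]

lemma increment_kernel (d τ : ℕ) (x : ℝ) :
    (1 - Complex.exp (-(Complex.I * ((τ : ℤ) : ℂ) * x))) ^ d *
      (1 - Complex.exp (Complex.I * ((τ : ℤ) : ℂ) * x)) ^ d / (x : ℂ) ^ (2 * d) =
      ((‖1 - Complex.exp (Complex.I * x * τ)‖ ^ (2 * d) / x ^ (2 * d) : ℝ) : ℂ) := by
  have h1 : 1 - Complex.exp (-(Complex.I * ((τ : ℤ) : ℂ) * x)) =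
      starRingEnd ℂ (1 - Complex.exp (Complex.I * x * τ)) := by
    rw [map_sub, map_one, ← Complex.exp_conj]
    congr 2
    simp
    ring
  have h2 : Complex.I * ((τ : ℤ) : ℂ) * x = Complex.I * x * τ := by push_cast; ring
  rw [h1, h2, ← mul_pow, Complex.conj_mul']
  push_cast
  rw [← pow_mul]

/-- The covariances of the generated sequence are the Fourier coefficients of `stepDensity`. -/
lemma inner_genSeq {T : ℝ} {d : ℕ} {ξ : ℝ → Lp ℂ 2 P} {f : ℝ → Matrix ℕ ℕ ℂ}
    (hf : IsSpectralDensity T d ξ f) (τ : ℕ) (s k t n : ℕ) :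
    inner ℂ (genSeq T d ξ τ (-(t : ℤ)) n) (genSeq T d ξ τ (-(s : ℤ)) k) =
      (1 / (2 * Real.pi) : ℂ) * ∫ y, Complex.exp (-(Complex.I * s * y)) *
        star (Complex.exp (-(Complex.I * t * y))) * stepDensity d τ f y k n ∂μπ := by
  rw [← cov_eq_inner, hf.structural]
  congr 1
  refine integral_congr_ae (ae_of_all _ fun y => ?_)
  simp only
  rw [stepDensity_apply, ← increment_kernel]
  have h1 : Complex.exp (-(Complex.I * s * y)) * star (Complex.exp (-(Complex.I * t * y))) =
      Complex.exp (Complex.I * ((-(s : ℤ) - -(t : ℤ) : ℤ) : ℂ) * y) := by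
    rw [← starRingEnd_apply, ← Complex.exp_conj, ← Complex.exp_add]
    congr 1
    simp
    ring
  rw [h1]
  ring

lemma gram_genSeq {T : ℝ} {d : ℕ} {ξ : ℝ → Lp ℂ 2 P} {f : ℝ → Matrix ℕ ℕ ℂ}
    (hf : IsSpectralDensity T d ξ f) {τ : ℕ} {κ : Type*} [Countable κ] {X : ℝ → Matrix ℕ κ ℂ}
    {x : ℕ → Matrix ℕ κ ℂ} (hX : IsFactorization (stepDensity d τ f) X x) (q q' : ℕ × ℕ) :
    inner ℂ (delayedRow hX.square_summable q) (delayedRow hX.square_summable q') =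
      inner ℂ (genSeq T d ξ τ (-(q.1 : ℤ)) q.2) (genSeq T d ξ τ (-(q'.1 : ℤ)) q'.2) := by
  rw [inner_genSeq hf]
  exact hX.inner_delayedRow q'.1 q'.2 q.1 q.2

lemma gram_obsSeq {T : ℝ} {d : ℕ} {ξ η : ℝ → Lp ℂ 2 P} {f g : ℝ → Matrix ℕ ℕ ℂ}
    (hf : IsSpectralDensity T d ξ f) (hg : IsSpectralDensity T d η g) {τ : ℕ}
    (huncorr : ∀ t s : ℝ, cov (incr d ξ t (τ * T)) (incr d η s (τ * T)) = 0)
    (hfi : ∀ k n, Integrable (fun x => stepDensity d τ f x k n) μπ)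
    (hgi : ∀ k n, Integrable (fun x => stepDensity d τ g x k n) μπ)
    {κ : Type*} [Countable κ] {X : ℝ → Matrix ℕ κ ℂ} {x : ℕ → Matrix ℕ κ ℂ}
    (hX : IsFactorization (stepDensity d τ fun x => f x + g x) X x) (q q' : ℕ × ℕ) :
    inner ℂ (delayedRow hX.square_summable q) (delayedRow hX.square_summable q') =
      inner ℂ (obsSeq T d τ ξ η (-(q.1 : ℤ)) q.2) (obsSeq T d τ ξ η (-(q'.1 : ℤ)) q'.2) := by
  have h0 := inner_genSeq_eq_zero (τ := (τ : ℤ)) (T := T) (d := d) (ξ := ξ) (η := η)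
    (by simpa using huncorr)
  have h0' : ∀ j k l n, inner ℂ (genSeq T d ξ τ l n) (genSeq T d η τ j k) = 0 :=
    fun j k l n => by rw [← inner_conj_symm, h0, map_zero]
  have hE : ∀ {u : ℝ → ℂ}, Integrable u μπ → Integrable (fun y : ℝ =>
      Complex.exp (-(Complex.I * q'.1 * y)) * star (Complex.exp (-(Complex.I * q.1 * y))) * u y)
      μπ := fun {u} hu => by
    refine hu.bdd_mul (c := 1) (Continuous.aestronglyMeasurable (by fun_prop))
      (ae_of_all _ fun y => ?_)
    rw [norm_mul, norm_star, HasExpansion.norm_exp_neg, HasExpansion.norm_exp_neg, mul_one]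
  rw [obsSeq, obsSeq, inner_add_left, inner_add_right, inner_add_right, h0, h0', add_zero,
    zero_add, inner_genSeq hf, inner_genSeq hg, ← mul_add,
    ← integral_add (hE (hfi _ _)) (hE (hgi _ _))]
  refine (hX.inner_delayedRow q'.1 q'.2 q.1 q.2).trans ?_
  congr 1
  refine integral_congr_ae (ae_of_all _ fun y => ?_)
  simp only
  rw [stepDensity_add, mul_add]

/-- The density of the signal is dominated by the density of the observations. -/
lemma stepDensity_dominated {T : ℝ} {d : ℕ} {η : ℝ → Lp ℂ 2 P} {g : ℝ → Matrix ℕ ℕ ℂ}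
    (hg : IsSpectralDensity T d η g) (τ : ℕ) {p p₁ : ℝ → Matrix ℕ ℕ ℂ}
    (hp : ∀ x k n, p x k n - p₁ x k n = stepDensity d τ g x k n) :
    ∀ᵐ x ∂μπ, ∀ v : ℕ →₀ ℂ, 0 ≤ (v.sum fun k a => v.sum fun n b =>
      star a * (p x k n - p₁ x k n) * b).re := by
  filter_upwards [hg.nonneg] with x hx v
  have h : (v.sum fun k a => v.sum fun n b => star a * (p x k n - p₁ x k n) * b) =
      ((‖1 - Complex.exp (Complex.I * x * τ)‖ ^ (2 * d) / x ^ (2 * d) : ℝ) : ℂ) *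
        v.sum fun k a => v.sum fun n b => star a * g x k n * b := by
    simp only [Finsupp.sum, Finset.mul_sum, hp, stepDensity_apply]
    refine Finset.sum_congr rfl fun k _ => Finset.sum_congr rfl fun n _ => ?_
    ring
  rw [h, Complex.re_ofReal_mul]
  refine mul_nonneg (div_nonneg (by positivity) ?_) (hx v)
  exact (even_two_mul d).pow_nonneg x

end Stationary

/-! ### Abel summation by parts of order `d` -/

section Abel

variable {E F : Type*} [NormedAddCommGroup E] [NormedSpace ℂ E] [NormedAddCommGroup F]
  [NormedSpace ℂ F]

/-- The operator `S ↦ (S n - ρ S (n + τ))_n`. -/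
def shiftDiff {V : Type*} [AddCommGroup V] [Module ℂ V] (τ : ℕ) (ρ : ℝ) (S : ℕ → V) (n : ℕ) : V :=
  S n - (ρ : ℂ) • S (n + τ)

/-- The operator `b ↦ (b n - b (n - τ))_n`, where `b` vanishes at negative indices. -/
def lagDiff {V : Type*} [AddCommGroup V] (τ : ℕ) (b : ℕ → V) (n : ℕ) : V :=
  b n - if τ ≤ n then b (n - τ) else 0

lemma shiftDiff_comm {V : Type*} [AddCommGroup V] [Module ℂ V] (τ : ℕ) (ρ₁ ρ₂ : ℝ) :
    Function.Commute (shiftDiff (V := V) τ ρ₁) (shiftDiff τ ρ₂) := fun S => by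
  funext n
  simp only [shiftDiff, smul_sub, smul_smul]
  rw [mul_comm (ρ₂ : ℂ)]
  abel

lemma shiftDiff_one_iterate {V : Type*} [AddCommGroup V] [Module ℂ V] (τ d : ℕ) (S : ℕ → V)
    (n : ℕ) : (shiftDiff τ 1)^[d] S n =
      ∑ l ∈ Finset.range (d + 1), ((-1 : ℂ) ^ l * (d.choose l : ℂ)) • S (n + l * τ) := by
  induction d generalizing S with
  | zero => simp
  | succ d ih =>
    rw [Function.iterate_succ_apply, ih, Finset.sum_range_succ' _ (d + 1)]
    simp only [shiftDiff, Complex.ofReal_one, one_smul, smul_sub, Finset.sum_sub_distrib]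
    rw [Finset.sum_range_succ' _ d]
    have h : ∑ l ∈ Finset.range (d + 1), ((-1 : ℂ) ^ (l + 1) * ((d + 1).choose (l + 1) : ℂ)) •
        S (n + (l + 1) * τ) =
        ∑ l ∈ Finset.range d, ((-1 : ℂ) ^ (l + 1) * (d.choose (l + 1) : ℂ)) •
          S (n + (l + 1) * τ) -
        ∑ l ∈ Finset.range (d + 1), ((-1 : ℂ) ^ l * (d.choose l : ℂ)) • S (n + l * τ + τ) := by
      have h1 : ∑ l ∈ Finset.range d, ((-1 : ℂ) ^ (l + 1) * (d.choose (l + 1) : ℂ)) •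
          S (n + (l + 1) * τ) = ∑ l ∈ Finset.range (d + 1),
            ((-1 : ℂ) ^ (l + 1) * (d.choose (l + 1) : ℂ)) • S (n + (l + 1) * τ) := by
        rw [Finset.sum_range_succ, Nat.choose_succ_self]
        simp
      rw [h1, ← Finset.sum_sub_distrib]
      refine Finset.sum_congr rfl fun l _ => ?_
      rw [show n + l * τ + τ = n + (l + 1) * τ by ring, ← sub_smul, Nat.choose_succ_succ]
      congr 1
      push_cast
      ring
    rw [h]
    simp
    abel

lemma summable_lagDiff {E : Type*} [NormedAddCommGroup E] {τ : ℕ} {b : ℕ → E} (hb : Summable fun n => ‖b n‖) :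
    Summable fun n => ‖lagDiff τ b n‖ := by
  have h : Summable fun n => ‖if τ ≤ n then b (n - τ) else 0‖ := by
    refine (summable_nat_add_iff τ).1 ?_
    simpa using hb
  exact Summable.of_nonneg_of_le (fun _ => norm_nonneg _) (fun n => norm_sub_le _ _) (hb.add h)

lemma summable_lagDiff_iterate {τ : ℕ} {b : ℕ → E} (hb : Summable fun n => ‖b n‖) (d : ℕ) :
    Summable fun n => ‖(lagDiff τ)^[d] b n‖ := by
  induction d with
  | zero => exact hb
  | succ d ih =>
    simp only [Function.iterate_succ_apply']
    exact summable_lagDiff ih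

lemma summable_pow_smul_apply [CompleteSpace F] {S : ℕ → E →L[ℂ] F} {b : ℕ → E} {r C : ℝ}
    (hr : 0 ≤ r) (hS : ∀ n, r ^ n * ‖S n‖ ≤ C) (hb : Summable fun n => ‖b n‖) :
    Summable fun n => ((r ^ n : ℝ) : ℂ) • S n (b n) := by
  refine Summable.of_norm_bounded (hb.mul_left C) fun n => ?_
  rw [norm_smul, Complex.norm_real, Real.norm_of_nonneg (pow_nonneg hr n)]
  calc r ^ n * ‖S n (b n)‖ ≤ r ^ n * (‖S n‖ * ‖b n‖) :=
        mul_le_mul_of_nonneg_left ((S n).le_opNorm _) (pow_nonneg hr n)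
    _ = r ^ n * ‖S n‖ * ‖b n‖ := by ring
    _ ≤ C * ‖b n‖ := mul_le_mul_of_nonneg_right (hS n) (norm_nonneg _)

/-- Summation by parts for Abel means. -/
lemma tsum_pow_smul_lagDiff [CompleteSpace F] {S : ℕ → E →L[ℂ] F} {b : ℕ → E} {τ : ℕ} {r C : ℝ}
    (hr : 0 < r) (hS : ∀ n, r ^ n * ‖S n‖ ≤ C) (hb : Summable fun n => ‖b n‖) :
    ∑' n, ((r ^ n : ℝ) : ℂ) • S n (lagDiff τ b n) =
      ∑' n, ((r ^ n : ℝ) : ℂ) • shiftDiff τ (r ^ τ) S n (b n) := by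
  have h1 := summable_pow_smul_apply hr.le hS hb
  have hS2 : ∀ n, r ^ n * ‖((r ^ τ : ℝ) : ℂ) • S (n + τ)‖ ≤ C := fun n => by
    rw [norm_smul, Complex.norm_real, Real.norm_of_nonneg (pow_nonneg hr.le τ), ← mul_assoc,
      ← pow_add]
    exact hS _
  have h2 := summable_pow_smul_apply hr.le hS2 hb
  have h3 : Summable fun n => ((r ^ n : ℝ) : ℂ) • S n (if τ ≤ n then b (n - τ) else 0) := by
    refine (summable_nat_add_iff τ).1 (h2.congr fun n => ?_)
    rw [if_pos (Nat.le_add_left _ _), Nat.add_sub_cancel, smul_apply, smul_smul,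
      pow_add]
    push_cast
    rfl
  have h4 : ∑' n, ((r ^ n : ℝ) : ℂ) • S n (if τ ≤ n then b (n - τ) else 0) =
      ∑' n, ((r ^ n : ℝ) : ℂ) • (((r ^ τ : ℝ) : ℂ) • S (n + τ)) (b n) := by
    rw [← h3.sum_add_tsum_nat_add τ, Finset.sum_eq_zero, zero_add]
    · refine tsum_congr fun n => ?_
      rw [if_pos (Nat.le_add_left _ _), Nat.add_sub_cancel, smul_apply,
        smul_smul, pow_add]
      push_cast
      rfl
    · intro n hn
      rw [if_neg (by simpa using hn), map_zero, smul_zero]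
  simp only [lagDiff, shiftDiff, map_sub, smul_sub, sub_apply]
  rw [h1.tsum_sub h3, h1.tsum_sub h2, h4]

lemma tsum_pow_smul_lagDiff_iterate [CompleteSpace F] {S : ℕ → E →L[ℂ] F} {b : ℕ → E} {τ : ℕ}
    {r C : ℝ} (hr : 0 < r) (hS : ∀ n, r ^ n * ‖S n‖ ≤ C) (hb : Summable fun n => ‖b n‖) (d : ℕ) :
    ∑' n, ((r ^ n : ℝ) : ℂ) • S n ((lagDiff τ)^[d] b n) =
      ∑' n, ((r ^ n : ℝ) : ℂ) • (shiftDiff τ (r ^ τ))^[d] S n (b n) := by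
  induction d generalizing S C with
  | zero => rfl
  | succ d ih =>
    simp only [Function.iterate_succ_apply' (lagDiff τ)]
    rw [tsum_pow_smul_lagDiff hr hS (summable_lagDiff_iterate hb d)]
    simp only [Function.iterate_succ_apply (shiftDiff τ (r ^ τ))]
    refine ih (C := C + C) fun n => ?_
    calc r ^ n * ‖shiftDiff τ (r ^ τ) S n‖
        ≤ r ^ n * (‖S n‖ + ‖((r ^ τ : ℝ) : ℂ) • S (n + τ)‖) :=
          mul_le_mul_of_nonneg_left (norm_sub_le _ _) (pow_nonneg hr.le n)
      _ = r ^ n * ‖S n‖ + r ^ (n + τ) * ‖S (n + τ)‖ := by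
          rw [norm_smul, Complex.norm_real, Real.norm_of_nonneg (pow_nonneg hr.le τ), pow_add]
          ring
      _ ≤ C + C := add_le_add (hS _) (hS _)

/-- A discrete Gronwall estimate: bounded Abel-weighted differences with lag `τ` make the weighted
sequence itself of order `(1 - r ^ τ)⁻¹`. -/
lemma weighted_bound {F : Type*} [NormedAddCommGroup F] {τ : ℕ} (hτ : 0 < τ) {r M : ℝ} (hr0 : 0 ≤ r) (hr1 : r ≤ 1) {G : ℕ → F}
    (hG : ∀ n, r ^ n * ‖G n - G (n + τ)‖ ≤ M) (h0 : ∀ n < τ, ‖G n‖ ≤ M) (n : ℕ) :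
    (1 - r ^ τ) * (r ^ n * ‖G n‖) ≤ M := by
  have hρ0 : 0 ≤ r ^ τ := pow_nonneg hr0 τ
  have hρ1 : r ^ τ ≤ 1 := pow_le_one₀ hr0 hr1
  induction n using Nat.strong_induction_on with
  | _ n ih =>
    rcases lt_or_ge n τ with h | h
    · have h1 : r ^ n ≤ 1 := pow_le_one₀ hr0 hr1
      have h2 : (1 - r ^ τ) * r ^ n ≤ 1 := mul_le_one₀ (by linarith) (pow_nonneg hr0 n) h1
      rw [← mul_assoc]
      exact (mul_le_of_le_one_left (norm_nonneg _) h2).trans (h0 n h)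
    · obtain ⟨m, rfl⟩ := Nat.exists_eq_add_of_le' h
      have h1 := ih m (by omega)
      have h2 : ‖G (m + τ)‖ ≤ ‖G m‖ + ‖G m - G (m + τ)‖ := by
        have := norm_sub_le (G m) (G m - G (m + τ))
        rwa [sub_sub_cancel] at this
      have h3 := hG m
      have h4 : r ^ m * ‖G (m + τ)‖ ≤ r ^ m * ‖G m‖ + M := by
        have := mul_le_mul_of_nonneg_left h2 (pow_nonneg hr0 m)
        linarith
      have h5 := mul_le_mul_of_nonneg_left h4 (sub_nonneg.2 hρ1)
      calc (1 - r ^ τ) * (r ^ (m + τ) * ‖G (m + τ)‖)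
          = r ^ τ * ((1 - r ^ τ) * (r ^ m * ‖G (m + τ)‖)) := by rw [pow_add]; ring
        _ ≤ r ^ τ * ((1 - r ^ τ) * (r ^ m * ‖G m‖ + M)) := mul_le_mul_of_nonneg_left h5 hρ0
        _ ≤ r ^ τ * (M + (1 - r ^ τ) * M) := by
            refine mul_le_mul_of_nonneg_left ?_ hρ0
            linarith
        _ = M - (1 - r ^ τ) ^ 2 * M := by ring
        _ ≤ M := by
            have hM : 0 ≤ M := le_trans (norm_nonneg _) (h0 0 hτ)
            have := mul_nonneg (sq_nonneg (1 - r ^ τ)) hM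
            linarith

/-- A sequence with bounded differences of order `d` grows slower than any geometric sequence. -/
lemma exists_geometric_bound {τ : ℕ} (hτ : 0 < τ) {r : ℝ} (hr0 : 0 ≤ r) (hr1 : r < 1) (d : ℕ)
    {S : ℕ → F} {K : ℝ} (hS : ∀ n, ‖(shiftDiff τ 1)^[d] S n‖ ≤ K) :
    ∃ C, ∀ n, r ^ n * ‖S n‖ ≤ C := by
  induction d generalizing S with
  | zero =>
    exact ⟨K, fun n => (mul_le_of_le_one_left (norm_nonneg _) (pow_le_one₀ hr0 hr1.le)).trans
      (hS n)⟩
  | succ d ih =>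
    obtain ⟨C, hC⟩ := ih (S := shiftDiff τ 1 S) hS
    have hρ : 0 < 1 - r ^ τ := sub_pos.2 (pow_lt_one₀ hr0 hr1 hτ.ne')
    refine ⟨(1 - r ^ τ)⁻¹ * (C + ∑ n ∈ Finset.range τ, ‖S n‖), fun n => ?_⟩
    rw [← div_eq_inv_mul, le_div_iff₀' hρ]
    have hC0 : 0 ≤ C := le_trans (by positivity) (hC 0)
    have hs0 : 0 ≤ ∑ n ∈ Finset.range τ, ‖S n‖ := Finset.sum_nonneg fun _ _ => norm_nonneg _
    refine weighted_bound hτ hr0 hr1.le (fun n => ?_) (fun n hn => ?_) n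
    · have := hC n
      simp only [shiftDiff, Complex.ofReal_one, one_smul] at this
      linarith
    · have := Finset.single_le_sum (f := fun n => ‖S n‖) (fun _ _ => norm_nonneg _)
        (Finset.mem_range.2 hn)
      linarith

lemma exists_shiftDiff_bound (τ d : ℕ) (S : ℕ → F) (n : ℕ) :
    ∃ B, ∀ ρ : ℝ, 0 ≤ ρ → ρ ≤ 1 → ‖(shiftDiff τ ρ)^[d] S n‖ ≤ B := by
  induction d generalizing n with
  | zero => exact ⟨‖S n‖, fun _ _ _ => le_rfl⟩
  | succ d ih =>
    obtain ⟨B₁, h₁⟩ := ih n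
    obtain ⟨B₂, h₂⟩ := ih (n + τ)
    refine ⟨B₁ + B₂, fun ρ h0 h1 => ?_⟩
    rw [Function.iterate_succ_apply', shiftDiff]
    refine (norm_sub_le _ _).trans (add_le_add (h₁ ρ h0 h1) ?_)
    rw [norm_smul, Complex.norm_real, Real.norm_of_nonneg h0]
    exact (mul_le_of_le_one_left (norm_nonneg _) h1).trans (h₂ ρ h0 h1)

/-- Uniform bound for the Abel-weighted differences of order `d`. The step of the induction writes
`1 - ρ σ = (1 - σ) + (1 - ρ) σ` for the shift `σ`; the factor `1 - ρ` absorbs the growth of a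
sequence with bounded differences. -/
lemma exists_uniform_bound {τ : ℕ} (hτ : 0 < τ) (d : ℕ) {S : ℕ → F} {K : ℝ}
    (hS : ∀ n, ‖(shiftDiff τ 1)^[d] S n‖ ≤ K) :
    ∃ C, ∀ r : ℝ, 0 ≤ r → r ≤ 1 → ∀ n, r ^ n * ‖(shiftDiff τ (r ^ τ))^[d] S n‖ ≤ C := by
  induction d generalizing S with
  | zero =>
    exact ⟨K, fun r hr0 hr1 n =>
      (mul_le_of_le_one_left (norm_nonneg _) (pow_le_one₀ hr0 hr1)).trans (hS n)⟩
  | succ d ih =>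
    obtain ⟨C, hC⟩ := ih (S := shiftDiff τ 1 S) hS
    choose B hB using exists_shiftDiff_bound τ d S
    have hC0 : 0 ≤ C := le_trans (by positivity) (hC 1 zero_le_one le_rfl 0)
    have hB0 : ∀ n, 0 ≤ B n := fun n => (norm_nonneg _).trans (hB n 1 zero_le_one le_rfl)
    have hs0 : 0 ≤ ∑ n ∈ Finset.range τ, B n := Finset.sum_nonneg fun n _ => hB0 n
    refine ⟨C + (C + ∑ n ∈ Finset.range τ, B n + C), fun r hr0 hr1 n => ?_⟩
    have hρ0 : 0 ≤ r ^ τ := pow_nonneg hr0 τ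
    have hρ1 : r ^ τ ≤ 1 := pow_le_one₀ hr0 hr1
    set G := (shiftDiff τ (r ^ τ))^[d] S with hG
    have h1 : ∀ n, (shiftDiff τ (r ^ τ))^[d] (shiftDiff τ 1 S) n = G n - G (n + τ) := fun n => by
      rw [((shiftDiff_comm τ (r ^ τ) 1).iterate_left d).eq, ← hG, shiftDiff, Complex.ofReal_one,
        one_smul]
    have h2 : ∀ n, r ^ n * ‖G n - G (n + τ)‖ ≤ C := fun n => by
      rw [← h1]
      exact hC r hr0 hr1 n
    have h3 : (1 - r ^ τ) * (r ^ n * ‖G n‖) ≤ C + ∑ n ∈ Finset.range τ, B n := by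
      refine weighted_bound hτ hr0 hr1 (fun n => (h2 n).trans (by linarith)) (fun n hn => ?_) n
      have := Finset.single_le_sum (fun n _ => hB0 n) (Finset.mem_range.2 hn)
      have := hB n _ hρ0 hρ1
      linarith
    have h4 : (shiftDiff τ (r ^ τ))^[d + 1] S n =
        G n - G (n + τ) + ((1 - r ^ τ : ℝ) : ℂ) • (G n - (G n - G (n + τ))) := by
      rw [Function.iterate_succ_apply', ← hG, shiftDiff, sub_sub_cancel, Complex.ofReal_sub,
        Complex.ofReal_one, sub_smul, one_smul]
      abel
    have h5 : ‖(shiftDiff τ (r ^ τ))^[d + 1] S n‖ ≤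
        ‖G n - G (n + τ)‖ + (1 - r ^ τ) * (‖G n‖ + ‖G n - G (n + τ)‖) := by
      rw [h4]
      refine (norm_add_le _ _).trans (add_le_add le_rfl ?_)
      rw [norm_smul, Complex.norm_real, Real.norm_of_nonneg (sub_nonneg.2 hρ1)]
      exact mul_le_mul_of_nonneg_left (norm_sub_le _ _) (sub_nonneg.2 hρ1)
    have h6 : (1 - r ^ τ) * (r ^ n * ‖G n - G (n + τ)‖) ≤ C :=
      (mul_le_of_le_one_left (by positivity) (by linarith)).trans (h2 n)
    have h7 := mul_le_mul_of_nonneg_left h5 (pow_nonneg hr0 n)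
    have h8 := h2 n
    calc r ^ n * ‖(shiftDiff τ (r ^ τ))^[d + 1] S n‖
        ≤ r ^ n * (‖G n - G (n + τ)‖ + (1 - r ^ τ) * (‖G n‖ + ‖G n - G (n + τ)‖)) := h7
      _ = r ^ n * ‖G n - G (n + τ)‖ + ((1 - r ^ τ) * (r ^ n * ‖G n‖) +
            (1 - r ^ τ) * (r ^ n * ‖G n - G (n + τ)‖)) := by ring
      _ ≤ _ := by linarith

lemma continuous_shiftDiff (τ d : ℕ) (S : ℕ → F) (n : ℕ) :
    Continuous fun ρ : ℝ => (shiftDiff τ ρ)^[d] S n := by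
  induction d generalizing n with
  | zero => exact continuous_const
  | succ d ih =>
    simp only [Function.iterate_succ_apply', shiftDiff]
    exact (ih n).sub (Complex.continuous_ofReal.smul (ih (n + τ)))

/-- Summation by parts of order `d`: if `∑ S n ((1 - σ*)^d b) n` converges, `∑ ‖b n‖ < ∞`, and the
differences `(1 - σ)^d S` are bounded, then its sum is `∑ ((1 - σ)^d S) n (b n)`, although the
boundary terms need not vanish. Abel means replace the boundary terms. -/
lemma hasSum_shiftDiff {H : Type*} [NormedAddCommGroup H] [InnerProductSpace ℂ H] [CompleteSpace H]
    {τ : ℕ} (hτ : 0 < τ) (d : ℕ) {S : ℕ → E →L[ℂ] H} {b : ℕ → E} {K : ℝ} {A : H}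
    (hS : ∀ n, ‖(shiftDiff τ 1)^[d] S n‖ ≤ K) (hb : Summable fun n => ‖b n‖)
    (hA : Tendsto (fun N => ∑ n ∈ Finset.range N, S n ((lagDiff τ)^[d] b n)) atTop (𝓝 A)) :
    HasSum (fun n => (shiftDiff τ 1)^[d] S n (b n)) A := by
  obtain ⟨C, hC⟩ := exists_uniform_bound hτ d hS
  have hd : ∀ r : ℝ, 0 ≤ r → r ≤ 1 → ∀ n,
      ‖((r ^ n : ℝ) : ℂ) • (shiftDiff τ (r ^ τ))^[d] S n (b n)‖ ≤ C * ‖b n‖ := fun r h0 h1 n => by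
    rw [norm_smul, Complex.norm_real, Real.norm_of_nonneg (pow_nonneg h0 n)]
    calc _ ≤ r ^ n * (‖(shiftDiff τ (r ^ τ))^[d] S n‖ * ‖b n‖) :=
          mul_le_mul_of_nonneg_left (ContinuousLinearMap.le_opNorm _ _) (pow_nonneg h0 n)
      _ = r ^ n * ‖(shiftDiff τ (r ^ τ))^[d] S n‖ * ‖b n‖ := by ring
      _ ≤ C * ‖b n‖ := mul_le_mul_of_nonneg_right (hC r h0 h1 n) (norm_nonneg _)
  have hI : ∀ᶠ r : ℝ in 𝓝[<] 1, 0 < r ∧ r < 1 := by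
    filter_upwards [Ioo_mem_nhdsLT (zero_lt_one (α := ℝ))] with r hr
    exact hr
  have h1 : Tendsto (fun r : ℝ => ∑' n, ((r ^ n : ℝ) : ℂ) •
      (shiftDiff τ (r ^ τ))^[d] S n (b n)) (𝓝[<] 1)
      (𝓝 (∑' n, (shiftDiff τ 1)^[d] S n (b n))) := by
    refine tendsto_tsum_of_dominated_convergence (hb.mul_left C) (fun n => ?_) ?_
    · have hc : Continuous fun r : ℝ => ((r ^ n : ℝ) : ℂ) •
          (shiftDiff τ (r ^ τ))^[d] S n (b n) :=
        (Complex.continuous_ofReal.comp (continuous_pow n)).smul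
          (((continuous_shiftDiff τ d S n).comp (continuous_pow τ)).clm_apply continuous_const)
      have := (hc.tendsto 1).mono_left (nhdsWithin_le_nhds (s := Set.Iio 1))
      simpa using this
    · filter_upwards [hI] with r hr n
      exact hd r hr.1.le hr.2.le n
  have hsum : Summable fun n => (shiftDiff τ 1)^[d] S n (b n) := by
    refine Summable.of_norm_bounded (hb.mul_left C) fun n => ?_
    simpa using hd 1 zero_le_one le_rfl n
  suffices h : ∑' n, (shiftDiff τ 1)^[d] S n (b n) = A by
    rw [← h]
    exact hsum.hasSum
  refine ext_inner_left ℂ fun y => ?_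
  have h2 : Tendsto (fun N => ∑ n ∈ Finset.range N, inner ℂ y (S n ((lagDiff τ)^[d] b n))) atTop
      (𝓝 (inner ℂ y A)) := by
    have := (innerSL ℂ y).continuous.continuousAt.tendsto.comp hA
    simpa [Function.comp_def, inner_sum] using this
  have h3 := Complex.tendsto_tsum_powerSeries_nhdsWithin_lt h2
  have h4 := (innerSL ℂ y).continuous.continuousAt.tendsto.comp h1
  refine tendsto_nhds_unique (h4.congr' ?_) (by simpa [Filter.tendsto_map'_iff] using h3)
  filter_upwards [hI] with r hr
  obtain ⟨C', hC'⟩ := exists_geometric_bound hτ hr.1.le hr.2 d hS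
  have hs := summable_pow_smul_apply hr.1.le hC' (summable_lagDiff_iterate (τ := τ) hb d)
  rw [Function.comp_apply, ← tsum_pow_smul_lagDiff_iterate hr.1 hC' hb d,
    ContinuousLinearMap.map_tsum _ hs]
  refine tsum_congr fun n => ?_
  simp only [innerSL_apply_apply, inner_smul_right]
  push_cast
  ring

/-- The convolution with the coefficients of `(∑_j x^{τ j})^d` inverts the difference operator of
order `d`. -/
lemma lagDiff_iterate_dCoeff {V : Type*} [AddCommGroup V] [Module ℂ V] {τ : ℕ} (hτ : 0 < τ) (d : ℕ)
    (a : ℕ → V) :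
    (lagDiff τ)^[d] (fun n => ∑ m ∈ Finset.range (n + 1), dCoeff d τ (n - m) • a m) = a := by
  induction d with
  | zero =>
    funext n
    simp only [Function.iterate_zero, id, dCoeff, pow_zero, PowerSeries.coeff_one]
    rw [Finset.sum_eq_single n]
    · simp
    · intro m hm hne
      have := Finset.mem_range.1 hm
      rw [if_neg (by omega), zero_smul]
    · simp
  | succ d ih =>
    rw [Function.iterate_succ_apply]
    convert ih using 2
    funext n
    have hc : ∀ k, dCoeff (d + 1) τ k - (if τ ≤ k then dCoeff (d + 1) τ (k - τ) else 0) =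
        dCoeff d τ k := fun k => by
      have hG : (1 - PowerSeries.X ^ τ) *
          (PowerSeries.mk fun n => if τ ∣ n then (1 : ℂ) else 0) = 1 := by
        ext k
        rw [sub_mul, one_mul, map_sub, PowerSeries.coeff_X_pow_mul', PowerSeries.coeff_mk,
          PowerSeries.coeff_one]
        by_cases hk : τ ≤ k
        · have hd : τ ∣ k - τ ↔ τ ∣ k :=
            ⟨fun h => by simpa [Nat.sub_add_cancel hk] using dvd_add h (dvd_refl τ),
              fun h => Nat.dvd_sub h (dvd_refl τ)⟩
          rw [if_pos hk, PowerSeries.coeff_mk, if_neg (show k ≠ 0 by omega)]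
          simp only [hd, sub_self]
        · rw [if_neg hk, sub_zero]
          refine if_congr ⟨fun h => ?_, fun h => h ▸ dvd_zero τ⟩ rfl rfl
          exact Nat.eq_zero_of_dvd_of_lt h (not_le.1 hk)
      rw [dCoeff, dCoeff, dCoeff, ← PowerSeries.coeff_X_pow_mul', ← map_sub,
        ← one_sub_mul, pow_succ', ← mul_assoc, hG, one_mul]
    have h2 : (if τ ≤ n then ∑ m ∈ Finset.range (n - τ + 1), dCoeff (d + 1) τ (n - τ - m) • a m
        else 0) = ∑ m ∈ Finset.range (n + 1),
          (if τ ≤ n - m then dCoeff (d + 1) τ (n - m - τ) else 0) • a m := by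
      split_ifs with h
      · refine (Finset.sum_congr rfl fun m hm => ?_).trans
          (Finset.sum_subset (Finset.range_subset_range.2 (by omega)) fun m _ hm => ?_)
        · have := Finset.mem_range.1 hm
          rw [if_pos (by omega), Nat.sub_right_comm]
        · rw [Finset.mem_range] at hm
          rw [if_neg (by omega), zero_smul]
      · refine (Finset.sum_eq_zero fun m _ => ?_).symm
        rw [if_neg (by omega), zero_smul]
    rw [lagDiff, h2, ← Finset.sum_sub_distrib]
    refine Finset.sum_congr rfl fun m _ => ?_
    rw [← sub_smul, hc]

end Abel

/-! ### The functional as a series in the generated sequence -/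

section Enumeration

lemma freq_injective : Function.Injective freq := by
  intro k l h
  unfold freq at h
  rcases Nat.even_or_odd' k with ⟨i, rfl | rfl⟩ <;> rcases Nat.even_or_odd' l with ⟨j, rfl | rfl⟩
  · simp only [pow_succ, pow_mul] at h
    norm_num at h
    omega
  · simp only [pow_succ, pow_mul] at h
    norm_num at h
    omega
  · simp only [pow_succ, pow_mul] at h
    norm_num at h
    omega
  · simp only [pow_succ, pow_mul] at h
    norm_num at h
    omega

lemma freq_two_mul (i : ℕ) : freq (2 * i) = -i := by
  simp only [freq, pow_succ, pow_mul]
  norm_num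
  omega

lemma freq_two_mul_add_one (i : ℕ) : freq (2 * i + 1) = i + 1 := by
  simp only [freq, pow_succ, pow_mul]
  norm_num
  omega

lemma freq_surjective : Function.Surjective freq := by
  intro n
  rcases Int.eq_nat_or_neg n with ⟨i, rfl | rfl⟩
  · rcases Nat.eq_zero_or_pos i with rfl | h
    · exact ⟨2 * 0, by rw [freq_two_mul]; simp⟩
    · refine ⟨2 * (i - 1) + 1, ?_⟩
      rw [freq_two_mul_add_one]
      omega
  · exact ⟨2 * i, freq_two_mul i⟩

lemma freq_swapIdx (k : ℕ) : freq (swapIdx k) = -freq k := by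
  rcases Nat.even_or_odd' k with ⟨i, rfl | rfl⟩
  · rcases Nat.eq_zero_or_pos i with rfl | h
    · simp [swapIdx, freq]
    · rw [swapIdx, if_neg (by omega), if_neg (by omega), freq_two_mul,
        show 2 * i - 1 = 2 * (i - 1) + 1 by omega, freq_two_mul_add_one]
      omega
  · rw [swapIdx, if_neg (by omega), if_pos (by omega), freq_two_mul_add_one,
      show 2 * i + 1 + 1 = 2 * (i + 1) by omega, freq_two_mul]
    push_cast
    rfl

/-- The enumeration of the frequencies in the order of the coefficients `aVec`. -/
noncomputable def swappedFreq : ℕ ≃ ℤ :=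
  Equiv.ofBijective (fun k => freq (swapIdx k)) (by
    simp only [freq_swapIdx]
    exact (Equiv.neg ℤ).bijective.comp ⟨freq_injective, freq_surjective⟩)

lemma swappedFreq_apply (k : ℕ) : swappedFreq k = freq (swapIdx k) := rfl

lemma star_basisFun (T : ℝ) (k : ℕ) (u : ℝ) : star (basisFun T k u) = trigFun T (swappedFreq k) u := by
  rw [swappedFreq_apply, freq_swapIdx]
  exact star_trigFun T (freq k) u

end Enumeration

section Segments

variable {Ω : Type*} [MeasurableSpace Ω] {P : Measure Ω}

lemma memLp_segment {a : ℝ → ℂ} (ha : ∀ R : ℝ, MemLp a 2 (volume.restrict (Set.Icc 0 R))) {T : ℝ}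
    (hT : 0 < T) (n : ℕ) :
    MemLp (fun u => a (u + n * T)) 2 (volume.restrict (Set.Ioc 0 T)) := by
  have h1 := (measurePreserving_add_right (volume : Measure ℝ) (n * T)).restrict_preimage
    (measurableSet_Ioc (a := 0 + n * T) (b := T + n * T))
  rw [Set.preimage_add_const_Ioc, add_sub_cancel_right, add_sub_cancel_right] at h1
  refine ((ha (T + n * T)).mono_measure (Measure.restrict_mono ?_ le_rfl)).comp_measurePreserving h1
  intro x hx
  have : 0 ≤ n * T := by positivity
  exact ⟨by linarith [hx.1], hx.2⟩

lemma memLp_reflected {F : Type*} [NormedAddCommGroup F] {ξ : ℝ → F}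
    (hξ : ∀ R : ℝ, MemLp ξ 2 (volume.restrict (Set.Icc (-R) R))) (T c : ℝ) :
    MemLp (fun u => ξ (c - u)) 2 (volume.restrict (Set.Ioc 0 T)) := by
  have h1 := ((volume : Measure ℝ).measurePreserving_sub_left c).restrict_preimage
    (measurableSet_Ico (a := c - T) (b := c - 0))
  rw [Set.preimage_const_sub_Ico, sub_sub_cancel, sub_sub_cancel] at h1
  refine ((hξ (|c| + |T|)).mono_measure (Measure.restrict_mono ?_ le_rfl)).comp_measurePreserving h1
  intro x hx
  have h2 := le_abs_self c
  have h3 := neg_abs_le c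
  have h4 := le_abs_self T
  have h5 := neg_abs_le T
  have h6 := abs_nonneg T
  exact ⟨by linarith [hx.1], by linarith [hx.2]⟩

lemma incr_reflected (d : ℕ) (ξ : ℝ → Lp ℂ 2 P) (c s u : ℝ) :
    incr d ξ (c - u) s = ∑ l ∈ Finset.range (d + 1),
      ((-1 : ℂ) ^ l * (d.choose l : ℂ)) • ξ (c - l * s - u) :=
  Finset.sum_congr rfl fun l _ => by rw [sub_right_comm]

lemma memLp_incr {ξ : ℝ → Lp ℂ 2 P}
    (hξ : ∀ R : ℝ, MemLp ξ 2 (volume.restrict (Set.Icc (-R) R))) (d : ℕ) (T c s : ℝ) :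
    MemLp (fun u => incr d ξ (c - u) s) 2 (volume.restrict (Set.Ioc 0 T)) := by
  simp only [incr_reflected]
  exact memLp_finsetSum _ fun l _ => (memLp_reflected hξ T (c - l * s)).const_smul
    ((-1 : ℂ) ^ l * (d.choose l : ℂ))

lemma norm_incr_periodic {T : ℝ} {d : ℕ} {ξ : ℝ → Lp ℂ 2 P} (hξ : HasPeriodicIncrements T d ξ)
    (τ : ℤ) (t : ℝ) : ‖incr d ξ (t + T) (τ * T)‖ = ‖incr d ξ t (τ * T)‖ := by
  have h := hξ.cov_periodic τ τ t t
  rw [cov_eq_inner, cov_eq_inner, inner_self_eq_norm_sq_to_K, inner_self_eq_norm_sq_to_K] at h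
  exact (sq_eq_sq₀ (norm_nonneg _) (norm_nonneg _)).1 (by exact_mod_cast h)

/-- The path of the process on the reflected segment `(c - T, c]`. -/
noncomputable def pathLp {ξ : ℝ → Lp ℂ 2 P}
    (hξ : ∀ R : ℝ, MemLp ξ 2 (volume.restrict (Set.Icc (-R) R))) (T c : ℝ) :
    Lp (Lp ℂ 2 P) 2 (volume.restrict (Set.Ioc 0 T)) :=
  (memLp_reflected hξ T c).toLp

/-- The path of the increments on the reflected segment `(c - T, c]`. -/
noncomputable def incrPathLp {ξ : ℝ → Lp ℂ 2 P}
    (hξ : ∀ R : ℝ, MemLp ξ 2 (volume.restrict (Set.Icc (-R) R))) (d : ℕ) (T s c : ℝ) :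
    Lp (Lp ℂ 2 P) 2 (volume.restrict (Set.Ioc 0 T)) :=
  (memLp_incr hξ d T c s).toLp

/-- The pairing `∫₀ᵀ v(u) x(u) du` of a scalar and a vector function. -/
noncomputable def segmentPairing (P : Measure Ω) (T : ℝ) :
    Lp ℂ 2 (volume.restrict (Set.Ioc 0 T)) →L[ℂ]
      Lp (Lp ℂ 2 P) 2 (volume.restrict (Set.Ioc 0 T)) →L[ℂ] Lp ℂ 2 P :=
  (ContinuousLinearMap.lsmul ℂ ℂ).lpPairing (volume.restrict (Set.Ioc 0 T)) 2 2

lemma segmentPairing_toLp {T : ℝ} {v : ℝ → ℂ} {x : ℝ → Lp ℂ 2 P}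
    (hv : MemLp v 2 (volume.restrict (Set.Ioc 0 T)))
    (hx : MemLp x 2 (volume.restrict (Set.Ioc 0 T))) :
    segmentPairing P T hv.toLp hx.toLp = ∫ u in Set.Ioc 0 T, v u • x u := by
  rw [segmentPairing, ContinuousLinearMap.lpPairing_eq_integral]
  refine integral_congr_ae ?_
  filter_upwards [hv.coeFn_toLp, hx.coeFn_toLp] with u h1 h2
  rw [h1, h2, ContinuousLinearMap.lsmul_apply]

lemma incrPathLp_eq_sum {ξ : ℝ → Lp ℂ 2 P}
    (hξ : ∀ R : ℝ, MemLp ξ 2 (volume.restrict (Set.Icc (-R) R))) (d : ℕ) (T s c : ℝ) :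
    incrPathLp hξ d T s c = ∑ l ∈ Finset.range (d + 1),
      ((-1 : ℂ) ^ l * (d.choose l : ℂ)) • pathLp hξ T (c - l * s) := by
  have h : ∀ m : Finset ℕ, ∀ hm : MemLp (fun u => ∑ l ∈ m, ((-1 : ℂ) ^ l * (d.choose l : ℂ)) •
      ξ (c - l * s - u)) 2 (volume.restrict (Set.Ioc 0 T)),
      hm.toLp = ∑ l ∈ m, ((-1 : ℂ) ^ l * (d.choose l : ℂ)) • pathLp hξ T (c - l * s) := by
    intro m
    induction m using Finset.induction_on with
    | empty => intro hm; simp only [Finset.sum_empty]; exact MemLp.toLp_zero _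
    | insert i m hi ih =>
      intro hm
      have h1 := (memLp_reflected hξ T (c - i * s)).const_smul ((-1 : ℂ) ^ i * (d.choose i : ℂ))
      have h2 : MemLp (fun u => ∑ l ∈ m, ((-1 : ℂ) ^ l * (d.choose l : ℂ)) •
          ξ (c - l * s - u)) 2 (volume.restrict (Set.Ioc 0 T)) :=
        memLp_finsetSum _ fun l _ => (memLp_reflected hξ T (c - l * s)).const_smul
          ((-1 : ℂ) ^ l * (d.choose l : ℂ))
      rw [Finset.sum_insert hi, ← ih h2, pathLp, ← MemLp.toLp_const_smul, ← MemLp.toLp_add]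
      refine MemLp.toLp_congr _ _ (ae_of_all _ fun u => ?_)
      simp [Finset.sum_insert hi]
  rw [← h _ ((memLp_incr hξ d T c s).ae_eq (ae_of_all _ fun u => incr_reflected d ξ c s u))]
  exact MemLp.toLp_congr _ _ (ae_of_all _ fun u => incr_reflected d ξ c s u)

lemma norm_incrPathLp {T : ℝ} {d : ℕ} {ξ : ℝ → Lp ℂ 2 P} (hξ : HasPeriodicIncrements T d ξ)
    (τ n : ℕ) : ‖incrPathLp hξ.locally_memLp d T (τ * T) (-(n * T))‖ =
      ‖incrPathLp hξ.locally_memLp d T (τ * T) 0‖ := by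
  induction n with
  | zero => simp
  | succ n ih =>
    rw [← ih, incrPathLp, incrPathLp, Lp.norm_toLp, Lp.norm_toLp]
    congr 1
    refine eLpNorm_congr_norm_ae (ae_of_all _ fun u => ?_)
    have h := norm_incr_periodic hξ τ (-((n + 1 : ℕ) * T) - u)
    rw [Int.cast_natCast] at h
    rw [← h]
    congr 2
    push_cast
    ring

lemma segmentPairing_trigLp {T : ℝ} (hT : 0 < T) {ξ : ℝ → Lp ℂ 2 P}
    (hξ : ∀ R : ℝ, MemLp ξ 2 (volume.restrict (Set.Icc (-R) R))) (d τ j k : ℕ) :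
    segmentPairing P T (trigLp T 0 T (swappedFreq k)) (incrPathLp hξ d T (τ * T) (-(j * T))) =
      genSeq T d ξ τ (-(j : ℤ)) k := by
  rw [trigLp, incrPathLp, segmentPairing_toLp, genSeq, intervalIntegral.integral_of_le hT.le]
  refine integral_congr_ae (ae_of_all _ fun u => ?_)
  simp only
  rw [star_basisFun]
  push_cast
  rw [neg_mul]

/-- The vectors `b_j` as functions on the segment. -/
lemma exists_segmentCoeff {a : ℝ → ℂ} (ha : ∀ R : ℝ, MemLp a 2 (volume.restrict (Set.Icc 0 R)))
    {T : ℝ} (hT : 0 < T) (d : ℕ) {τ : ℕ} (hτ : 0 < τ) :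
    ∃ β : ℕ → Lp ℂ 2 (volume.restrict (Set.Ioc 0 T)),
      (lagDiff τ)^[d] β = (fun n => (memLp_segment ha hT n).toLp) ∧
      ∀ j k, bVec T d τ a (j, k) = inner ℂ (trigLp T 0 T (swappedFreq k)) (β j) := by
  refine ⟨_, lagDiff_iterate_dCoeff hτ d _, fun j k => ?_⟩
  simp only [bVec, inner_sum, inner_smul_right]
  refine Finset.sum_congr rfl fun m _ => ?_
  congr 1
  rw [inner_trigLp, aVec, intervalIntegral.integral_of_le hT.le]
  refine integral_congr_ae (ae_of_all _ fun u => ?_)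
  simp only
  rw [mul_comm]
  rfl

lemma hasSum_sq_trigLp {T : ℝ} (hT : 0 < T) (β : Lp ℂ 2 (volume.restrict (Set.Ioc 0 T))) :
    HasSum (fun k => ‖(inner ℂ (trigLp T 0 T (swappedFreq k)) β : ℂ)‖ ^ 2) (‖β‖ ^ 2) := by
  have h := hasSum_sq_ell2 ((trigBasis hT (zero_add T).symm).repr β)
  rw [LinearIsometryEquiv.norm_map] at h
  refine ((swappedFreq.hasSum_iff).2 h).congr_fun fun k => ?_
  rw [Function.comp_apply, HilbertBasis.repr_apply_apply, coe_trigBasis]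

lemma hasSum_trigLp {T : ℝ} (hT : 0 < T) (β : Lp ℂ 2 (volume.restrict (Set.Ioc 0 T))) :
    HasSum (fun k => (inner ℂ (trigLp T 0 T (swappedFreq k)) β : ℂ) •
      trigLp T 0 T (swappedFreq k)) β := by
  have h := (trigBasis hT (zero_add T).symm).hasSum_repr β
  refine ((swappedFreq.hasSum_iff).2 h).congr_fun fun k => ?_
  rw [Function.comp_apply, HilbertBasis.repr_apply_apply, coe_trigBasis]

lemma summable_sq_bVec {a : ℝ → ℂ} (ha : ∀ R : ℝ, MemLp a 2 (volume.restrict (Set.Icc 0 R)))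
    {T : ℝ} (hT : 0 < T) (d : ℕ) {τ : ℕ} (hτ : 0 < τ) (j : ℕ) :
    Summable fun k => ‖bVec T d τ a (j, k)‖ ^ 2 := by
  obtain ⟨β, -, hβ⟩ := exists_segmentCoeff ha hT d hτ
  simp only [hβ]
  exact (hasSum_sq_trigLp hT _).summable

/-- The integrals over the segments of length `T` sum up to the functional. -/
lemma tendsto_sum_segments {T : ℝ} (hT : 0 < T) {ξ : ℝ → Lp ℂ 2 P}
    (hξ : ∀ R : ℝ, MemLp ξ 2 (volume.restrict (Set.Icc (-R) R))) {a : ℝ → ℂ}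
    (ha : ∀ R : ℝ, MemLp a 2 (volume.restrict (Set.Icc 0 R))) {A : Lp ℂ 2 P}
    (hA : Tendsto (fun R : ℝ => ∫ t in (0 : ℝ)..R, a t • ξ (-t)) atTop (𝓝 A)) :
    Tendsto (fun N => ∑ n ∈ Finset.range N, segmentPairing P T (memLp_segment ha hT n).toLp
      (pathLp hξ T (-(n * T)))) atTop (𝓝 A) := by
  have hN : Tendsto (fun N : ℕ => (N : ℝ) * T) atTop atTop :=
    tendsto_natCast_atTop_atTop.atTop_mul_const hT
  refine (hA.comp hN).congr fun N => ?_
  have h1 : ∀ n : ℕ, segmentPairing P T (memLp_segment ha hT n).toLp (pathLp hξ T (-(n * T))) =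
      ∫ t in (n * T)..((n + 1 : ℕ) * T), a t • ξ (-t) := fun n => by
    rw [pathLp, segmentPairing_toLp, ← intervalIntegral.integral_of_le hT.le]
    have h2 := intervalIntegral.integral_comp_add_right (a := 0) (b := T)
      (fun t => a t • ξ (-t)) (n * T)
    rw [zero_add, show T + n * T = ((n + 1 : ℕ) : ℝ) * T by push_cast; ring] at h2
    rw [← h2]
    refine intervalIntegral.integral_congr fun u _ => ?_
    rw [neg_add_rev, ← sub_eq_add_neg]
  have h3 : ∀ n < N, IntervalIntegrable (fun t => a t • ξ (-t)) volume ((n : ℕ) * T)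
      ((n + 1 : ℕ) * T) := fun n _ => by
    have h4 : MemLp (fun t => ξ (-t)) 2 (volume.restrict (Set.Ioc 0 ((n + 1 : ℕ) * T))) := by
      simpa using memLp_reflected hξ ((n + 1 : ℕ) * T) 0
    have h5 : MemLp a 2 (volume.restrict (Set.Ioc 0 ((n + 1 : ℕ) * T))) :=
      (ha _).mono_measure (Measure.restrict_mono Set.Ioc_subset_Icc_self le_rfl)
    have h6 : IntegrableOn (fun t => a t • ξ (-t)) (Set.Ioc 0 ((n + 1 : ℕ) * T)) :=
      memLp_one_iff_integrable.1 (h4.smul h5)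
    rw [intervalIntegrable_iff, Set.uIoc_of_le (by gcongr; omega)]
    exact h6.mono_set (Set.Ioc_subset_Ioc_left (by positivity))
  simp only [h1]
  rw [intervalIntegral.sum_integral_adjacent_intervals (a := fun n : ℕ => (n : ℝ) * T) h3]
  simp

/-- The functional `A ξ` is the sum of the series `∑ b_{j,k} ξ_k(-j, τ)`. -/
theorem hasSum_functional {T : ℝ} (hT : 0 < T) {d τ : ℕ} (hτ : 0 < τ) {ξ : ℝ → Lp ℂ 2 P}
    (hξ : HasPeriodicIncrements T d ξ) {a : ℝ → ℂ}
    (ha : ∀ R : ℝ, MemLp a 2 (volume.restrict (Set.Icc 0 R)))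
    (hb : Summable fun j : ℕ => blockNorm (bVec T d τ a) j) {A : Lp ℂ 2 P}
    (hA : Tendsto (fun R : ℝ => ∫ t in (0 : ℝ)..R, a t • ξ (-t)) atTop (𝓝 A))
    (hs : Summable fun q : ℕ × ℕ => bVec T d τ a q • genSeq T d ξ τ (-(q.1 : ℤ)) q.2) :
    HasSum (fun q : ℕ × ℕ => bVec T d τ a q • genSeq T d ξ τ (-(q.1 : ℤ)) q.2) A := by
  obtain ⟨β, hβ, hbβ⟩ := exists_segmentCoeff ha hT d hτ
  have hnorm : ∀ j, blockNorm (bVec T d τ a) j = ‖β j‖ := fun j => by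
    rw [blockNorm]
    simp only [hbβ]
    rw [(hasSum_sq_trigLp hT (β j)).tsum_eq, Real.sqrt_sq (norm_nonneg _)]
  simp only [hnorm] at hb
  set S : ℕ → Lp ℂ 2 (volume.restrict (Set.Ioc 0 T)) →L[ℂ] Lp ℂ 2 P := fun n =>
    (segmentPairing P T).flip (pathLp hξ.locally_memLp T (-(n * T))) with hSdef
  have hS : ∀ n, (shiftDiff τ 1)^[d] S n =
      (segmentPairing P T).flip (incrPathLp hξ.locally_memLp d T (τ * T) (-(n * T))) := fun n => by
    rw [shiftDiff_one_iterate, incrPathLp_eq_sum, map_sum]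
    refine Finset.sum_congr rfl fun l _ => ?_
    rw [map_smul, hSdef]
    simp only
    congr 3
    push_cast
    ring
  have h1 : HasSum (fun n => (shiftDiff τ 1)^[d] S n (β n)) A := by
    refine hasSum_shiftDiff hτ d (K := ‖(segmentPairing P T).flip‖ *
      ‖incrPathLp hξ.locally_memLp d T (τ * T) 0‖) (fun n => ?_) hb ?_
    · rw [hS, ← norm_incrPathLp hξ τ n]
      exact ContinuousLinearMap.le_opNorm _ _
    · rw [hβ]
      exact tendsto_sum_segments hT hξ.locally_memLp ha hA
  have h2 : ∀ j, HasSum (fun k => bVec T d τ a (j, k) • genSeq T d ξ τ (-(j : ℤ)) k)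
      ((shiftDiff τ 1)^[d] S j (β j)) := fun j => by
    have h3 := (hasSum_trigLp hT (β j)).mapL ((shiftDiff τ 1)^[d] S j)
    refine h3.congr_fun fun k => ?_
    rw [map_smul, hbβ, hS, ContinuousLinearMap.flip_apply,
      segmentPairing_trigLp hT hξ.locally_memLp]
  have h4 := (hs.hasSum.prod_fiberwise h2).unique h1
  rw [← h4]
  exact hs.hasSum

end Segments

/-! ### The spectral characteristic of the estimate -/

section Characteristic

variable {H κ : Type*} [NormedAddCommGroup H] [NormedSpace ℂ H] [Countable κ] {d τ : ℕ}
  {F : ℝ → Matrix ℕ ℕ ℂ} {Θ : ℝ → Matrix ℕ κ ℂ} {θ : ℕ → Matrix ℕ κ ℂ} {ζ : ℤ → ℕ → H}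
  {V : ell2 (ℕ × κ) →L[ℂ] H} {r₀ : ℝ → ℕ → ℂ} {w₀ w : ell2 (ℕ × κ)} {r : κ → ℝ → ℕ → ℂ}
  {v : κ → ell2 (ℕ × κ)}

lemma hasSpectralSeries_of_coordinates (hΘ : IsCanonicalFactorization (stepDensity d τ F) Θ θ)
    (hV : ∀ q, V (delayedRow hΘ.square_summable q) = ζ (-(q.1 : ℤ)) q.2)
    (h₀ : HasCoordinates Θ r₀ w₀) (h : ∀ μ, HasCoordinates Θ (r μ) (v μ)) (hv : HasSum v w) :
    HasSpectralSeries d τ F ζ (fun t k => incFactor d τ t * r₀ t k)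
      (fun μ t k => incFactor d τ t * r μ t k) (V (w₀ + w)) := by
  refine ⟨V w₀, fun μ => V (v μ), h₀.isSpectralCharacteristic hΘ hV,
    fun μ => (h μ).isSpectralCharacteristic hΘ hV, ?_⟩
  rw [map_add, add_sub_cancel_left]
  exact hv.mapL V

lemma hasCoordinates_tsum [Finite κ] {p : ℝ → Matrix ℕ ℕ ℂ} (hΘ : IsFactorization p Θ θ)
    (h : ∀ μ, HasCoordinates Θ (r μ) (v μ)) (hv : HasSum v w) :
    HasCoordinates Θ (fun t k => ∑' μ, r μ t k) w := by
  have := Fintype.ofFinite κ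
  have h1 := HasCoordinates.sum hΘ Finset.univ h
  rw [← hv.unique (hasSum_fintype v)] at h1
  exact h1.congr fun t k => tsum_fintype _

end Characteristic

section Signal

variable {Ω : Type*} [MeasurableSpace Ω] {P : Measure Ω} {T : ℝ} {d τ : ℕ} {ξ η : ℝ → Lp ℂ 2 P}

lemma norm_genSeq_le_obsSeq
    (huncorr : ∀ t s : ℝ, cov (incr d ξ t (τ * T)) (incr d η s (τ * T)) = 0) (j : ℤ) (k : ℕ) :
    ‖genSeq T d ξ τ j k‖ ≤ ‖obsSeq T d τ ξ η j k‖ ∧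
      ‖genSeq T d η τ j k‖ ≤ ‖obsSeq T d τ ξ η j k‖ := by
  have h0 : inner ℂ (genSeq T d ξ τ j k) (genSeq T d η τ j k) = 0 := by
    rw [← inner_conj_symm, inner_genSeq_eq_zero (by simpa using huncorr), map_zero]
  have h1 := norm_add_sq_eq_norm_sq_add_norm_sq_of_inner_eq_zero _ _ h0
  rw [obsSeq]
  constructor <;> refine abs_le_of_sq_le_sq' ?_ (norm_nonneg _) |>.2 <;> nlinarith [norm_nonneg
    (genSeq T d ξ τ j k), norm_nonneg (genSeq T d η τ j k)]

end Signal

end PCFilter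

theorem theorem4 {Ω : Type*} [MeasurableSpace Ω] (P : Measure Ω) [IsProbabilityMeasure P]
    (T : ℝ) (hT : 0 < T) (d τ : ℕ) (hτ : 0 < τ)
    -- the signal and the noise
    (ξ η : ℝ → Lp ℂ 2 P)
    (hξ : PCFilter.HasPeriodicIncrements T d ξ) (hη : PCFilter.HasPeriodicIncrements T d η)
    (hξ0 : ∀ j k, PCFilter.expect (PCFilter.genSeq T d ξ τ j k) = 0)
    (hη0 : ∀ j k, PCFilter.expect (PCFilter.genSeq T d η τ j k) = 0)
    (huncorr : ∀ t s : ℝ,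
      PCFilter.cov (PCFilter.incr d ξ t (τ * T)) (PCFilter.incr d η s (τ * T)) = 0)
    (f g : ℝ → Matrix ℕ ℕ ℂ)
    (hf : PCFilter.IsSpectralDensity T d ξ f) (hg : PCFilter.IsSpectralDensity T d η g)
    -- the functional `A ξ = ∫₀^∞ a(t) ξ(-t) dt`
    (a : ℝ → ℂ) (ha : ∀ R : ℝ, MemLp a 2 (volume.restrict (Set.Icc 0 R)))
    (hb : Summable fun j : ℕ => PCFilter.blockNorm (PCFilter.bVec T d τ a) j)
    (hb' : Summable fun j : ℕ => ((j : ℝ) + 1) * PCFilter.blockNorm (PCFilter.bVec T d τ a) j)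
    (A : Lp ℂ 2 P)
    (hA : Tendsto (fun R : ℝ => ∫ t in (0 : ℝ)..R, a t • ξ (-t)) atTop (𝓝 A))
    -- the factorization of the density of the observations and its inverse
    {κ : Type*} [Countable κ]
    (Θ : ℝ → Matrix ℕ κ ℂ) (θ : ℕ → Matrix ℕ κ ℂ)
    (hΘ : PCFilter.IsCanonicalFactorization
      (PCFilter.stepDensity d τ fun x => f x + g x) Θ θ)
    (Ψ : ℝ → Matrix κ ℕ ℂ) (ψ : ℕ → Matrix κ ℕ ℂ)
    (hΨ : PCFilter.IsInverseFactor Θ Ψ ψ) :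
    -- the factorization of the density of the signal is given
    (∀ {κ₁ : Type*} [Countable κ₁] (Φ : ℝ → Matrix ℕ κ₁ ℂ) (φ : ℕ → Matrix ℕ κ₁ ℂ),
      PCFilter.IsFactorization (PCFilter.stepDensity d τ f) Φ φ →
      PCFilter.IsL2Bounded (PCFilter.toeplitz φ) →
      -- all the series that enter the formulas converge
      (∀ p, Summable fun q => PCFilter.toeplitz φ p q * PCFilter.bVec T d τ a q) ∧
      (Summable fun p =>
        ‖PCFilter.infMulVec (PCFilter.toeplitz φ) (PCFilter.bVec T d τ a) p‖ ^ 2) ∧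
      (∀ m k, HasSum (fun p : ℕ × κ₁ => star (φ p.1 k p.2) *
          PCFilter.infMulVec (PCFilter.toeplitz φ) (PCFilter.bVec T d τ a) (p.1 + m, p.2))
        (PCFilter.cVec φ (PCFilter.bVec T d τ a) (m, k))) ∧
      (∀ (m : ℕ) (μ : κ), Summable fun q : ℕ × ℕ =>
        star (ψ q.1 μ q.2) * PCFilter.cVec φ (PCFilter.bVec T d τ a) (q.1 + m, q.2)) ∧
      (Summable fun p =>
        ‖PCFilter.psiC ψ (PCFilter.cVec φ (PCFilter.bVec T d τ a)) p‖ ^ 2) ∧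
      -- the spectral characteristic
      (∃ C : ℝ → κ → ℂ,
        (∀ μ, PCFilter.HasExpansion (fun x => C x μ)
          fun m => PCFilter.psiC ψ (PCFilter.cVec φ (PCFilter.bVec T d τ a)) (m, μ)) ∧
        PCFilter.HasSpectralSeries d τ (fun x => f x + g x) (PCFilter.obsSeq T d τ ξ η)
          (fun _ _ => 0)
          (fun μ x k => PCFilter.incFactor d τ x * (Ψ x μ k * C x μ))
          (PCFilter.optEstimate T d τ ξ η A) ∧
        (Finite κ →
          PCFilter.IsSpectralCharacteristic d τ (fun x => f x + g x)
            (PCFilter.obsSeq T d τ ξ η)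
            (fun x k => PCFilter.incFactor d τ x * ∑' μ, Ψ x μ k * C x μ)
            (PCFilter.optEstimate T d τ ξ η A))) ∧
      -- the mean square error
      PCFilter.mse A (PCFilter.optEstimate T d τ ξ η A) =
        PCFilter.sqNorm (PCFilter.infMulVec (PCFilter.toeplitz φ) (PCFilter.bVec T d τ a)) -
          PCFilter.sqNorm (PCFilter.psiC ψ (PCFilter.cVec φ (PCFilter.bVec T d τ a)))) ∧
    -- the factorization of the density of the noise is given
    (∀ {κ₂ : Type*} [Countable κ₂] (W : ℝ → Matrix ℕ κ₂ ℂ) (w : ℕ → Matrix ℕ κ₂ ℂ),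
      PCFilter.IsFactorization (PCFilter.stepDensity d τ g) W w →
      PCFilter.IsL2Bounded (PCFilter.toeplitz w) →
      -- all the series that enter the formulas converge
      (∀ p, Summable fun q => PCFilter.toeplitz w p q * PCFilter.bVec T d τ a q) ∧
      (Summable fun p =>
        ‖PCFilter.infMulVec (PCFilter.toeplitz w) (PCFilter.bVec T d τ a) p‖ ^ 2) ∧
      (∀ m k, HasSum (fun p : ℕ × κ₂ => star (w p.1 k p.2) *
          PCFilter.infMulVec (PCFilter.toeplitz w) (PCFilter.bVec T d τ a) (p.1 + m, p.2))
        (PCFilter.cVec w (PCFilter.bVec T d τ a) (m, k))) ∧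
      (∀ (m : ℕ) (μ : κ), Summable fun q : ℕ × ℕ =>
        star (ψ q.1 μ q.2) * PCFilter.cVec w (PCFilter.bVec T d τ a) (q.1 + m, q.2)) ∧
      (Summable fun p =>
        ‖PCFilter.psiC ψ (PCFilter.cVec w (PCFilter.bVec T d τ a)) p‖ ^ 2) ∧
      -- the series `B_τ(e^{-i λ})` converges
      (∀ (x : ℝ) (k : ℕ), Summable fun j : ℕ =>
        PCFilter.bVec T d τ a (j, k) * Complex.exp (-(Complex.I * j * x))) ∧
      -- the spectral characteristic
      (∃ C : ℝ → κ → ℂ,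
        (∀ μ, PCFilter.HasExpansion (fun x => C x μ)
          fun m => PCFilter.psiC ψ (PCFilter.cVec w (PCFilter.bVec T d τ a)) (m, μ)) ∧
        PCFilter.HasSpectralSeries d τ (fun x => f x + g x) (PCFilter.obsSeq T d τ ξ η)
          (fun x k => PCFilter.incFactor d τ x * PCFilter.bSeries (PCFilter.bVec T d τ a) x k)
          (fun μ x k => -(PCFilter.incFactor d τ x * (Ψ x μ k * C x μ)))
          (PCFilter.optEstimate T d τ ξ η A) ∧
        (Finite κ →
          PCFilter.IsSpectralCharacteristic d τ (fun x => f x + g x)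
            (PCFilter.obsSeq T d τ ξ η)
            (fun x k => PCFilter.incFactor d τ x *
              (PCFilter.bSeries (PCFilter.bVec T d τ a) x k - ∑' μ, Ψ x μ k * C x μ))
            (PCFilter.optEstimate T d τ ξ η A))) ∧
      -- the mean square error
      PCFilter.mse A (PCFilter.optEstimate T d τ ξ η A) =
        PCFilter.sqNorm (PCFilter.infMulVec (PCFilter.toeplitz w) (PCFilter.bVec T d τ a)) -
          PCFilter.sqNorm (PCFilter.psiC ψ (PCFilter.cVec w (PCFilter.bVec T d τ a)))) := by
  have hu' : ∀ t s : ℝ, PCFilter.cov (PCFilter.incr d ξ t (((τ : ℤ) : ℝ) * T))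
      (PCFilter.incr d η s (((τ : ℤ) : ℝ) * T)) = 0 := by simpa using huncorr
  have hηξ := PCFilter.inner_genSeq_eq_zero hu'
  have hξη : ∀ j k l n, inner ℂ (PCFilter.genSeq T d ξ τ j k) (PCFilter.genSeq T d η τ l n) = 0 :=
    fun j k l n => by rw [← inner_conj_symm, hηξ, map_zero]
  have hbk := PCFilter.summable_sq_bVec ha hT d hτ
  have hb2 := PCFilter.summable_sq_of_blockNorm hbk hb
  -- integrability of both densities follows from that of either one
  have hsumi := hΘ.toIsFactorization.integrable
  simp only [PCFilter.stepDensity_add] at hsumi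
  -- the series of the functional converges absolutely for both processes
  have habs : (∀ q q' : ℕ × ℕ, inner ℂ (PCFilter.delayedRow hΘ.square_summable q)
      (PCFilter.delayedRow hΘ.square_summable q') =
        inner ℂ (PCFilter.obsSeq T d τ ξ η (-(q.1 : ℤ)) q.2)
          (PCFilter.obsSeq T d τ ξ η (-(q'.1 : ℤ)) q'.2)) →
      ∀ x : ℕ × ℕ → Lp ℂ 2 P, (∀ q, ‖x q‖ ≤ ‖PCFilter.obsSeq T d τ ξ η (-(q.1 : ℤ)) q.2‖) →
      Summable fun q => PCFilter.bVec T d τ a q • x q := fun hgram x hx => by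
    refine PCFilter.summable_smul_of_blockNorm hbk hb
      (PCFilter.summable_norm_sq_delayedRow hΘ.square_summable) fun q => (hx q).trans ?_
    rw [← PCFilter.norm_delayedRow, norm_eq_sqrt_re_inner (𝕜 := ℂ),
      norm_eq_sqrt_re_inner (𝕜 := ℂ) (PCFilter.delayedRow _ q), hgram]
  refine ⟨fun {κ₁} _ Φ φ hΦ hbdd => ?_, fun {κ₂} _ W w hW hbdd => ?_⟩
  · have hfi := hΦ.integrable
    have hgi : ∀ k n, Integrable (fun x => PCFilter.stepDensity d τ g x k n)
        (volume.restrict (Set.Ioc (-Real.pi) Real.pi)) := fun k n => by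
      exact ((hsumi k n).sub (hfi k n)).congr (ae_of_all _ fun x => by simp)
    have hgram := PCFilter.gram_obsSeq hf hg huncorr hfi hgi hΘ.toIsFactorization
    obtain ⟨V, hV, hiso⟩ := PCFilter.exists_synthesis hΘ hgram
    have hAsum := PCFilter.hasSum_functional hT hτ hξ ha hb hA
      (habs hgram _ fun q => (PCFilter.norm_genSeq_le_obsSeq huncorr _ _).1)
    obtain ⟨h1, h2, h3, h4, ⟨w, hw, hproj⟩, herr⟩ := PCFilter.projection_of_signal
      (fun _ _ => rfl) hηξ hΘ hΨ hΦ hbdd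
      (PCFilter.stepDensity_dominated hg τ fun x k n => by
        rw [PCFilter.stepDensity_add, add_sub_cancel_left])
      hV hiso (PCFilter.gram_genSeq hf hΦ) hb2 hAsum
    obtain ⟨C, v, hC, hv, hcoord⟩ := PCFilter.exists_hasCoordinates hΨ w
    have hest : PCFilter.optEstimate T d τ ξ η A = V w := hproj
    refine ⟨h1, h2, h3, h4, (PCFilter.summable_sq_ell2 w).congr fun p => by rw [hw],
      ⟨C, fun μ => (hC μ).congr_coeff fun l => hw (l, μ), ?_, fun _ => ?_⟩, ?_⟩
    · rw [hest]
      simpa using PCFilter.hasSpectralSeries_of_coordinates hΘ hV PCFilter.HasCoordinates.zero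
        hcoord hv
    · rw [hest]
      exact (PCFilter.hasCoordinates_tsum hΘ.toIsFactorization hcoord hv).isSpectralCharacteristic
        hΘ hV
    · rw [PCFilter.mse_eq_norm_sq]
      exact herr
  · have hgi := hW.integrable
    have hfi : ∀ k n, Integrable (fun x => PCFilter.stepDensity d τ f x k n)
        (volume.restrict (Set.Ioc (-Real.pi) Real.pi)) := fun k n => by
      exact ((hsumi k n).sub (hgi k n)).congr (ae_of_all _ fun x => by simp)
    have hgram := PCFilter.gram_obsSeq hf hg huncorr hfi hgi hΘ.toIsFactorization
    obtain ⟨V, hV, hiso⟩ := PCFilter.exists_synthesis hΘ hgram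
    have hAsum := PCFilter.hasSum_functional hT hτ hξ ha hb hA
      (habs hgram _ fun q => (PCFilter.norm_genSeq_le_obsSeq huncorr _ _).1)
    -- the functional of the noise, and the functional of the observations
    obtain ⟨N, hN⟩ := habs hgram _ fun q => (PCFilter.norm_genSeq_le_obsSeq huncorr _ _).2
    obtain ⟨wB, hwB, hcB⟩ := PCFilter.hasCoordinates_bSeries hΘ.toIsFactorization hbk hb
    have hAN : A + N = V wB := by
      refine (hAsum.add hN).unique ((hwB.mapL V).congr_fun fun q => ?_)
      rw [map_smul, hV, PCFilter.obsSeq, smul_add]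
    obtain ⟨h1, h2, h3, h4, ⟨u, hu, hproj⟩, herr⟩ := PCFilter.projection_of_signal
      (ζ := PCFilter.obsSeq T d τ ξ η) (fun _ _ => add_comm _ _) hξη hΘ hΨ hW hbdd
      (PCFilter.stepDensity_dominated hf τ fun x k n => by
        rw [PCFilter.stepDensity_add, add_sub_cancel_right])
      hV hiso (PCFilter.gram_genSeq hg hW) hb2 hN
    obtain ⟨C, v, hC, hv, hcoord⟩ := PCFilter.exists_hasCoordinates hΨ u
    have hestN : PCFilter.optEstimate T d τ ξ η A =
        V wB - (PCFilter.pastSpace (PCFilter.obsSeq T d τ ξ η)).starProjection N := by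
      rw [PCFilter.optEstimate, eq_sub_iff_add_eq, ← map_add, hAN]
      exact Submodule.starProjection_eq_self_iff.2 (PCFilter.synthesis_mem_pastSpace hΘ hV wB)
    have hest : PCFilter.optEstimate T d τ ξ η A = V (wB - u) := by rw [hestN, hproj, map_sub]
    refine ⟨h1, h2, h3, h4, (PCFilter.summable_sq_ell2 u).congr fun p => by rw [hu],
      PCFilter.summable_bSeries hbk hb,
      ⟨C, fun μ => (hC μ).congr_coeff fun l => hu (l, μ), ?_, fun _ => ?_⟩, ?_⟩
    · rw [hest, sub_eq_add_neg]
      have hvn : HasSum (fun μ => (-1 : ℂ) • v μ) (-u) := by simpa using hv.neg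
      simpa using PCFilter.hasSpectralSeries_of_coordinates hΘ hV hcB
        (fun μ => (hcoord μ).const_mul (-1)) hvn
    · rw [hest]
      exact (hcB.sub hΘ.toIsFactorization
        (PCFilter.hasCoordinates_tsum hΘ.toIsFactorization hcoord hv)).isSpectralCharacteristic
        hΘ hV
    · rw [PCFilter.mse_eq_norm_sq, hestN, ← herr, ← hAN, ← norm_neg]
      congr 2
      abel
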